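/- Let $\Omega\subset\mathbb{R}^2$ be a bounded open set, $T>0$, $\kappa>0$, $2.8\le p\le 5$, $\alpha:=\frac{3p-1}{2p}\in(1,2)$, $p':=\frac{p}{p-1}$, $\alpha':=\frac{\alpha}{\alpha-1}$. Let $W_0^{1,p}(\Omega)$ be the closure of $\mathcal{D}(\Omega)$ in $W^{1,p}(\Omega)$ and $W^{-1,p'}(\Omega)$ its dual; a function $f\in L^{p'}(\Omega)$ is identified with $v\mapsto\int_\Omega fv\,dx$. Assume $(H1)$--$(H4)$ (flat lithosphere $b=0$, zero basal velocity, $\mu$ and $\tilde a$ independent of the ice height), that is: $\mu=\mu(x)$ is measurable with $\mu_1\le\mu(x)\le\mu_2$ for all $x\in\overline\Omega$, for some constants $\mu_1,\mu_2>0$, and $\tilde a\in W^{1,p}(0,T;\mathcal{C}^0(\overline\Omega))$. Let $u_0\in K:=\{v\in W_0^{1,p}(\Omega);\ v\ge0\}$, let $\{v\}^-:=\max\{-v,0\}$, and let $$B_\kappa(v):=-\nabla\cdot(\mu|\nabla v|^{p-2}\nabla v)-\tfrac1\kappa\{v\}^-\in W^{-1,p'}(\Omega),\qquad v\in W_0^{1,p}(\Omega).$$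 For every integer $N\ge1$ put $\ell:=T/N$ and let $u_{\kappa,\ell}^0:=u_0,\ u_{\kappa,\ell}^1,\dots,u_{\kappa,\ell}^N\in W_0^{1,p}(\Omega)$ solve the semi-discrete problem $$\tfrac1\ell\big(|u_{\kappa,\ell}^{n+1}|^{\alpha-2}u_{\kappa,\ell}^{n+1}-|u_{\kappa,\ell}^{n}|^{\alpha-2}u_{\kappa,\ell}^{n}\big)+B_\kappa(u_{\kappa,\ell}^{n+1})=\tfrac1\ell\int_{n\ell}^{(n+1)\ell}\tilde a(t)\,dt\quad\text{in }W^{-1,p'}(\Omega),\qquad 0\le n\le N-1.$$ For a vector $\boldsymbol v=(v^n)_{n=0}^N$ and $n\ell<t\le(n+1)\ell$ let $\Pi_\ell\boldsymbol v(t):=v^{n+1}$ and $D_\ell(\Pi_\ell\boldsymbol v)(t):=(v^{n+1}-v^n)/\ell$. Then there are a subsequence $N\to\infty$ (that is, $\ell\to0$) and $u_\kappa,g_\kappa,v_\kappa,w_\kappa,\chi_\kappa$ such that, along it, \begin{gather*} \Pi_\ell\boldsymbol u_{\kappa,\ell}\overset{\ast}{\rightharpoonup}u_\kappa\text{ in }L^\infty(0,T;W_0^{1,p}(\Omega)),\\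 B_\kappa(\Pi_\ell\boldsymbol u_{\kappa,\ell})\overset{\ast}{\rightharpoonup}g_\kappa\text{ in }L^\infty(0,T;W^{-1,p'}(\Omega)),\\ |\Pi_\ell\boldsymbol u_{\kappa,\ell}|^{\frac{\alpha-2}2}\Pi_\ell\boldsymbol u_{\kappa,\ell}\overset{\ast}{\rightharpoonup}v_\kappa\text{ in }L^\infty(0,T;L^2(\Omega)),\\ D_\ell\big(|\Pi_\ell\boldsymbol u_{\kappa,\ell}|^{\frac{\alpha-2}2}\Pi_\ell\boldsymbol u_{\kappa,\ell}\big)\rightharpoonup\tfrac{d v_\kappa}{dt}\text{ in }L^2(0,T;L^2(\Omega)),\\ |\Pi_\ell\boldsymbol u_{\kappa,\ell}|^{\alpha-2}\Pi_\ell\boldsymbol u_{\kappa,\ell}\overset{\ast}{\rightharpoonup}w_\kappa\text{ in }L^\infty(0,T;L^{\alpha'}(\Omega)),\\ D_\ell\big(|\Pi_\ell\boldsymbol u_{\kappa,\ell}|^{\alpha-2}\Pi_\ell\boldsymbol u_{\kappa,\ell}\big)\overset{\ast}{\rightharpoonup}\tfrac{d w_\kappa}{dt}\text{ in }L^\infty(0,T;W^{-1,p'}(\Omega)),\\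 |u_{\kappa,\ell}^N|^{\alpha-2}u_{\kappa,\ell}^N\rightharpoonup\chi_\kappa\text{ in }L^{\alpha'}(\Omega). \end{gather*} Moreover $v_\kappa=|u_\kappa|^{\frac{\alpha-2}2}u_\kappa$ and $w_\kappa=|u_\kappa|^{\alpha-2}u_\kappa$, and $u_\kappa$ solves the penalized problem $\mathcal{P}_\kappa$: $u_\kappa\in L^\infty(0,T;W_0^{1,p}(\Omega))$, $\frac{d}{dt}(|u_\kappa|^{\frac{\alpha-2}2}u_\kappa)\in L^2(0,T;L^2(\Omega))$, $\frac{d}{dt}(|u_\kappa|^{\alpha-2}u_\kappa)\in L^\infty(0,T;W^{-1,p'}(\Omega))$, $$\Big\langle\tfrac{d}{dt}(|u_\kappa|^{\alpha-2}u_\kappa),v\Big\rangle+\int_\Omega\mu|\nabla u_\kappa|^{p-2}\nabla u_\kappa\cdot\nabla v\,dx-\tfrac1\kappa\int_\Omega\{u_\kappa\}^-v\,dx=\int_\Omega\tilde a(t)v\,dx$$ for all $v\in W_0^{1,p}(\Omega)$, in the sense of distributions on $(0,T)$, and $u_\kappa(0)=u_0$, where $u_\kappa$ is taken as a function in $\mathcal{C}^0([0,T];L^\alpha(\Omega))$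 for which $|u_\kappa|^{\frac{\alpha-2}2}u_\kappa\in\mathcal{C}^0([0,T];L^2(\Omega))$. -/

import Mathlib

open MeasureTheory Set Filter Topology
open scoped ENNReal ContDiff BoundedContinuousFunction

noncomputable section

namespace IceSheet

/-! ### Data: domain, exponents, coefficient -/

/-- The Euclidean plane. -/
abbrev Plane : Type := EuclideanSpace ℝ (Fin 2)

/-- Bounded open subsets of the plane. -/
structure BddOpen where
  carrier : Set Plane
  isOpen : IsOpen carrier
  isBounded : Bornology.IsBounded carrier

/-- Lebesgue measure on `Ω`. -/
def BddOpen.vol (Ω : BddOpen) : Measure Plane := volume.restrict Ω.carrier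

instance (Ω : BddOpen) : IsFiniteMeasure Ω.vol :=
  ⟨by
    rw [BddOpen.vol, Measure.restrict_apply_univ]
    exact Ω.isBounded.measure_lt_top⟩

/-- The space of continuous real functions on the (compact) closure of `Ω`, with the sup norm. -/
abbrev BddOpen.CClosure (Ω : BddOpen) : Type := (closure Ω.carrier) →ᵇ ℝ

/-- Exponents `p` in the Glen power law: `2.8 ≤ p ≤ 5`. -/
structure GlenExp where
  val : ℝ
  lower : 2.8 ≤ val
  upper : val ≤ 5

namespace GlenExp

variable (p : GlenExp)

/-- The exponent `α = (3p - 1) / (2p)`. -/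
def alpha : ℝ := (3 * p.val - 1) / (2 * p.val)

/-- The conjugate exponent `p' = p / (p - 1)`. -/
def conj : ℝ := p.val / (p.val - 1)

/-- The conjugate exponent `α' = α / (α - 1)`. -/
def alphaConj : ℝ := p.alpha / (p.alpha - 1)

/-- The exponent `p` as an index of a Lebesgue space; likewise `conjE`, `alphaE`, `alphaConjE` for
`p'`, `α`, `α'`. -/
def pE : ℝ≥0∞ := ENNReal.ofReal p.val
def conjE : ℝ≥0∞ := ENNReal.ofReal p.conj
def alphaE : ℝ≥0∞ := ENNReal.ofReal p.alpha
def alphaConjE : ℝ≥0∞ := ENNReal.ofReal p.alphaConj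

lemma two_lt : 2 < p.val := lt_of_lt_of_le (by norm_num) p.lower

lemma one_lt_alpha : 1 < p.alpha := by
  have h := p.two_lt
  rw [alpha, lt_div_iff₀ (by linarith)]
  linarith

lemma alpha_lt_two : p.alpha < 2 := by
  have h := p.two_lt
  rw [alpha, div_lt_iff₀ (by linarith)]
  linarith

lemma holder : p.val.HolderConjugate p.conj :=
  Real.HolderConjugate.conjExponent (by linarith [p.two_lt])

lemma holder_alpha : p.alpha.HolderConjugate p.alphaConj :=
  Real.HolderConjugate.conjExponent p.one_lt_alpha

instance : ENNReal.HolderConjugate p.conjE p.pE := p.holder.symm.ennrealOfReal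

instance : ENNReal.HolderConjugate p.alphaE p.alphaConjE := p.holder_alpha.ennrealOfReal

instance : Fact (1 ≤ p.pE) :=
  ⟨by rw [pE, ENNReal.one_le_ofReal]; linarith [p.two_lt]⟩

instance : Fact (1 ≤ p.conjE) :=
  ⟨by rw [conjE, ENNReal.one_le_ofReal]; exact p.holder.symm.lt.le⟩

instance : Fact (1 ≤ p.alphaE) :=
  ⟨by rw [alphaE, ENNReal.one_le_ofReal]; exact p.one_lt_alpha.le⟩

instance : Fact (1 ≤ p.alphaConjE) :=
  ⟨by rw [alphaConjE, ENNReal.one_le_ofReal]; exact p.holder_alpha.symm.lt.le⟩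

lemma alphaE_le_pE : p.alphaE ≤ p.pE :=
  ENNReal.ofReal_le_ofReal (by linarith [p.two_lt, p.alpha_lt_two])

lemma conjE_le_pE : p.conjE ≤ p.pE := by
  refine ENNReal.ofReal_le_ofReal ?_
  have h := p.two_lt
  rw [conj, div_le_iff₀ (by linarith)]
  nlinarith

lemma conjE_le_alphaConjE : p.conjE ≤ p.alphaConjE := by
  refine ENNReal.ofReal_le_ofReal ?_
  have h := p.two_lt
  have h1 := p.one_lt_alpha
  have h2 := p.alpha_lt_two
  rw [conj, alphaConj, div_le_div_iff₀ (by linarith) (by linarith)]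
  nlinarith

end GlenExp

/-- The coefficient `μ` of the model: a measurable function of `x ∈ Ω` alone which takes its values
on the closure of `Ω` between two positive constants. -/
structure Coefficient (Ω : BddOpen) where
  toFun : Plane → ℝ
  aestronglyMeasurable : AEStronglyMeasurable toFun Ω.vol
  bounds : ∃ μ₁ μ₂ : ℝ, 0 < μ₁ ∧ 0 < μ₂ ∧
    ∀ x ∈ closure Ω.carrier, μ₁ ≤ toFun x ∧ toFun x ≤ μ₂

/-! ### The Sobolev space `W₀^{1,p}(Ω)` and its dual -/

/-- `W₀^{1,p}(Ω)`, realised as the closure in `L^p(Ω) × L^p(Ω; ℝ²)` of the pairs `(φ, ∇φ)` with `φ`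
a test function on `Ω`. The norm is `max (‖u‖_{L^p}) (‖∇u‖_{L^p})`, which is equivalent to the usual
one. -/
def sobolevZero (Ω : BddOpen) (p : GlenExp) :
    Submodule ℝ (Lp ℝ p.pE Ω.vol × Lp Plane p.pE Ω.vol) :=
  (Submodule.span ℝ {z : Lp ℝ p.pE Ω.vol × Lp Plane p.pE Ω.vol |
    ∃ φ : Plane → ℝ, ContDiff ℝ ∞ φ ∧ HasCompactSupport φ ∧ tsupport φ ⊆ Ω.carrier ∧
      z.1 =ᵐ[Ω.vol] φ ∧ z.2 =ᵐ[Ω.vol] gradient φ}).topologicalClosure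

/-- The Banach space `W₀^{1,p}(Ω)`. -/
abbrev W0 (Ω : BddOpen) (p : GlenExp) : Type := sobolevZero Ω p

/-- `W^{-1,p'}(Ω)`, the dual of `W₀^{1,p}(Ω)`. -/
abbrev WDual (Ω : BddOpen) (p : GlenExp) : Type := W0 Ω p →L[ℝ] ℝ

variable {Ω : BddOpen} {p : GlenExp}

/-- The function in `L^p(Ω)` underlying an element of `W₀^{1,p}(Ω)`. -/
def W0.fn (u : W0 Ω p) : Lp ℝ p.pE Ω.vol := u.1.1

/-- The weak gradient of an element of `W₀^{1,p}(Ω)`. -/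
def W0.grad (u : W0 Ω p) : Lp Plane p.pE Ω.vol := u.1.2

/-- The set `K` of the elements of `W₀^{1,p}(Ω)` that are nonnegative (almost everywhere in `Ω`;
equivalently everywhere on the closure, for the continuous representative). -/
def obstacleSet (Ω : BddOpen) (p : GlenExp) : Set (W0 Ω p) :=
  {v | ∀ᵐ x ∂Ω.vol, 0 ≤ v.fn x}

/-- A function `f ∈ L^{p'}(Ω)` as the element `v ↦ ∫_Ω f v dx` of `W^{-1,p'}(Ω)`. -/
def toDual (f : Plane → ℝ) (hf : MemLp f p.conjE Ω.vol) : WDual Ω p :=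
  ((ContinuousLinearMap.mul ℝ ℝ).lpPairing Ω.vol p.conjE p.pE (hf.toLp f)) ∘L
    (ContinuousLinearMap.fst ℝ _ _) ∘L (sobolevZero Ω p).subtypeL

lemma toDual_apply (f : Plane → ℝ) (hf : MemLp f p.conjE Ω.vol) (v : W0 Ω p) :
    toDual f hf v = ∫ x in Ω.carrier, f x * v.fn x := by
  change (ContinuousLinearMap.mul ℝ ℝ).lpPairing Ω.vol p.conjE p.pE (hf.toLp f) v.1.1 = _
  rw [ContinuousLinearMap.lpPairing_eq_integral]
  refine integral_congr_ae ?_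
  filter_upwards [hf.coeFn_toLp] with x hx
  simp [hx, W0.fn]

/-- A vector field `F ∈ L^{p'}(Ω; ℝ²)` as the element `v ↦ ∫_Ω F · ∇v dx`, that is `-∇ · F`,
of `W^{-1,p'}(Ω)`. -/
def negDiv (F : Plane → Plane) (hF : MemLp F p.conjE Ω.vol) : WDual Ω p :=
  ((innerSL ℝ (E := Plane)).lpPairing Ω.vol p.conjE p.pE (hF.toLp F)) ∘L
    (ContinuousLinearMap.snd ℝ _ _) ∘L (sobolevZero Ω p).subtypeL

lemma negDiv_apply (F : Plane → Plane) (hF : MemLp F p.conjE Ω.vol) (v : W0 Ω p) :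
    negDiv F hF v = ∫ x in Ω.carrier, inner ℝ (F x) (v.grad x) := by
  change (innerSL ℝ (E := Plane)).lpPairing Ω.vol p.conjE p.pE (hF.toLp F) v.1.2 = _
  rw [ContinuousLinearMap.lpPairing_eq_integral]
  refine integral_congr_ae ?_
  filter_upwards [hF.coeFn_toLp] with x hx
  rw [hx, W0.grad, innerSL_apply_apply]

/-! ### The nonlinear terms -/

/-- `ξ ↦ |ξ|^s ξ`. -/
def spow (s ξ : ℝ) : ℝ := |ξ| ^ s * ξ

lemma measurable_spow (s : ℝ) : Measurable (spow s) := by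
  unfold spow
  fun_prop

lemma abs_spow {r : ℝ} (hr : 0 < r) (ξ : ℝ) : |spow (r - 1) ξ| = |ξ| ^ r := by
  rcases eq_or_ne ξ 0 with rfl | h
  · simp [spow, Real.zero_rpow hr.ne']
  · have h' : 0 < |ξ| := abs_pos.mpr h
    rw [spow, abs_mul, abs_of_nonneg (Real.rpow_nonneg h'.le _)]
    nth_rewrite 2 [← Real.rpow_one |ξ|]
    rw [← Real.rpow_add h']
    congr 1
    ring

lemma memLp_norm_rpow {E : Type*} [NormedAddCommGroup E] {f : Plane → E} {q r : ℝ} (hr : 0 < r)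
    (hf : MemLp f (ENNReal.ofReal q) Ω.vol) :
    MemLp (fun x => ‖f x‖ ^ r) (ENNReal.ofReal (q / r)) Ω.vol := by
  have h := hf.norm_rpow_div (ENNReal.ofReal r)
  rwa [ENNReal.toReal_ofReal hr.le, ← ENNReal.ofReal_div_of_pos hr] at h

lemma memLp_spow {f : Plane → ℝ} {q r : ℝ} (hr : 0 < r)
    (hf : MemLp f (ENNReal.ofReal q) Ω.vol) :
    MemLp (fun x => spow (r - 1) (f x)) (ENNReal.ofReal (q / r)) Ω.vol := by
  refine (memLp_norm_rpow hr hf).of_le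
    ((measurable_spow _).comp_aemeasurable hf.aestronglyMeasurable.aemeasurable).aestronglyMeasurable
    (Eventually.of_forall fun x => ?_)
  rw [Real.norm_eq_abs, abs_spow hr, Real.norm_eq_abs, Real.norm_eq_abs,
    abs_of_nonneg (Real.rpow_nonneg (abs_nonneg _) _)]

lemma memLp_halfPow {f : Plane → ℝ} (hf : MemLp f p.alphaE Ω.vol) :
    MemLp (fun x => spow ((p.alpha - 2) / 2) (f x)) 2 Ω.vol := by
  have h1 := p.one_lt_alpha
  have h := memLp_spow (r := p.alpha / 2) (by linarith) hf
  have e1 : p.alpha / 2 - 1 = (p.alpha - 2) / 2 := by ring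
  have e2 : p.alpha / (p.alpha / 2) = 2 := by field_simp
  rw [e1, e2] at h
  simpa using h

lemma memLp_fullPow {f : Plane → ℝ} (hf : MemLp f p.alphaE Ω.vol) :
    MemLp (fun x => spow (p.alpha - 2) (f x)) p.alphaConjE Ω.vol := by
  have h1 := p.one_lt_alpha
  have h := memLp_spow (r := p.alpha - 1) (by linarith) hf
  have e1 : p.alpha - 1 - 1 = p.alpha - 2 := by ring
  rwa [e1] at h

lemma W0.memLp_alpha (u : W0 Ω p) : MemLp u.fn p.alphaE Ω.vol :=
  (Lp.memLp u.fn).mono_exponent p.alphaE_le_pE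

/-- `|u|^{(α-2)/2} u` as an element of `L²(Ω)`. -/
def halfPow (u : W0 Ω p) : Lp ℝ 2 Ω.vol :=
  (memLp_halfPow u.memLp_alpha).toLp (fun x => spow ((p.alpha - 2) / 2) (u.fn x))

/-- `|u|^{α-2} u` as an element of `L^{α'}(Ω)`. -/
def fullPow (u : W0 Ω p) : Lp ℝ p.alphaConjE Ω.vol :=
  (memLp_fullPow u.memLp_alpha).toLp (fun x => spow (p.alpha - 2) (u.fn x))

/-- The embedding of `L^{α'}(Ω)` in `W^{-1,p'}(Ω)`. -/
def alphaConjToDual (w : Lp ℝ p.alphaConjE Ω.vol) : WDual Ω p :=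
  toDual w ((Lp.memLp w).mono_exponent p.conjE_le_alphaConjE)

lemma memLp_negPart (u : W0 Ω p) : MemLp (fun x => max (-(u.fn x)) 0) p.conjE Ω.vol := by
  have h : MemLp (fun x => u.fn x) p.conjE Ω.vol :=
    (Lp.memLp u.fn).mono_exponent p.conjE_le_pE
  refine h.of_le ?_ (Eventually.of_forall fun x => ?_)
  · have := h.aestronglyMeasurable.aemeasurable
    exact (by fun_prop : AEMeasurable (fun x => max (-(u.fn x)) 0) Ω.vol).aestronglyMeasurable
  · rw [Real.norm_eq_abs, Real.norm_eq_abs, abs_of_nonneg (le_max_right _ _)]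
    exact max_le (neg_le_abs _) (abs_nonneg _)

lemma memLp_flux (μ : Coefficient Ω) (u : W0 Ω p) :
    MemLp (fun x => (μ.toFun x * ‖u.grad x‖ ^ (p.val - 2)) • u.grad x) p.conjE Ω.vol := by
  have hp := p.two_lt
  obtain ⟨μ₁, μ₂, h1, h2, hb⟩ := μ.bounds
  have h : MemLp (fun x => ‖u.grad x‖ ^ (p.val - 1)) p.conjE Ω.vol :=
    memLp_norm_rpow (by linarith) (Lp.memLp u.grad)
  have hg := (Lp.memLp u.grad).aestronglyMeasurable
  refine (h.const_mul μ₂).of_le ?_ ?_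
  · have hn : AEStronglyMeasurable (fun x => ‖u.grad x‖ ^ (p.val - 2)) Ω.vol :=
      (hg.norm.aemeasurable.pow_const _).aestronglyMeasurable
    exact (μ.aestronglyMeasurable.mul hn).smul hg
  · have hmem : ∀ᵐ x ∂Ω.vol, x ∈ Ω.carrier := ae_restrict_mem Ω.isOpen.measurableSet
    filter_upwards [hmem] with x hx
    obtain ⟨hl, hu⟩ := hb x (subset_closure hx)
    have hn : 0 ≤ ‖u.grad x‖ := norm_nonneg _
    have e : ‖u.grad x‖ ^ (p.val - 1) = ‖u.grad x‖ ^ (p.val - 2) * ‖u.grad x‖ := by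
      rw [show p.val - 1 = (p.val - 2) + 1 by ring, Real.rpow_add_one' hn (by linarith)]
    have hr : 0 ≤ ‖u.grad x‖ ^ (p.val - 2) := Real.rpow_nonneg hn _
    rw [norm_smul, norm_mul, norm_mul, Real.norm_eq_abs, Real.norm_eq_abs, Real.norm_eq_abs,
      Real.norm_eq_abs, abs_of_nonneg (h1.le.trans hl), abs_of_nonneg h2.le, abs_of_nonneg hr,
      abs_of_nonneg (Real.rpow_nonneg hn _), e, mul_assoc]
    exact mul_le_mul_of_nonneg_right hu (mul_nonneg hr hn)

/-- The operator `B_κ(u) = -∇ · (μ |∇u|^{p-2} ∇u) - {u}⁻ / κ`, with `{u}⁻ = max (-u) 0`, from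
`W₀^{1,p}(Ω)` to `W^{-1,p'}(Ω)`. -/
def opB (μ : Coefficient Ω) (κ : ℝ) (u : W0 Ω p) : WDual Ω p :=
  negDiv (fun x => (μ.toFun x * ‖u.grad x‖ ^ (p.val - 2)) • u.grad x) (memLp_flux μ u)
    - κ⁻¹ • toDual (fun x => max (-(u.fn x)) 0) (memLp_negPart u)

lemma memLp_extend (f : Ω.CClosure) :
    MemLp (Function.extend Subtype.val f 0) p.conjE Ω.vol := by
  have hc : ContinuousOn (Function.extend Subtype.val f 0) (closure Ω.carrier) := by
    rw [continuousOn_iff_continuous_domRestrict]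
    convert f.continuous using 1
    ext x
    exact Subtype.val_injective.extend_apply f 0 x
  refine MemLp.of_bound ((hc.mono subset_closure).aestronglyMeasurable Ω.isOpen.measurableSet) ‖f‖
    (Eventually.of_forall fun x => ?_)
  by_cases hx : x ∈ closure Ω.carrier
  · have h := Subtype.val_injective.extend_apply f 0 (⟨x, hx⟩ : closure Ω.carrier)
    rw [show Function.extend Subtype.val f 0 x = f ⟨x, hx⟩ from h]
    exact f.norm_coe_le_norm _
  · rw [Function.extend_apply' _ _ _ (by rintro ⟨y, rfl⟩; exact hx y.2)]
    simp

/-- A continuous function on the closure of `Ω`, as the element `v ↦ ∫_Ω f v dx` of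
`W^{-1,p'}(Ω)`. -/
def contToDual (f : Ω.CClosure) : WDual Ω p :=
  toDual (Function.extend Subtype.val f 0) (memLp_extend f)

/-! ### Vector-valued functions of time -/

/-- Lebesgue measure on `(0, T)`. The functions `u : ℝ → X` below matter only on `(0, T)`, and
`u ∈ L^q(0,T;X)` is `MemLp u q (timeVol T)`. -/
def timeVol (T : ℝ) : Measure ℝ := volume.restrict (Ioo 0 T)

section Time

variable {X Y : Type*} [NormedAddCommGroup X] [NormedSpace ℝ X]
  [NormedAddCommGroup Y] [NormedSpace ℝ Y]

/-- `w = dv/dt` in the sense of `X`-valued distributions on `(0, T)`. -/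
def HasWeakTimeDeriv (T : ℝ) (v w : ℝ → X) : Prop :=
  Integrable v (timeVol T) ∧ Integrable w (timeVol T) ∧
    ∀ ψ : ℝ → ℝ, ContDiff ℝ ∞ ψ → HasCompactSupport ψ → tsupport ψ ⊆ Ioo 0 T →
      ∫ t, deriv ψ t • v t ∂timeVol T = - ∫ t, ψ t • w t ∂timeVol T

/-- `v ∈ W^{1,q}(0,T;X)`. -/
def MemW1 (q : ℝ≥0∞) (T : ℝ) (v : ℝ → X) : Prop :=
  MemLp v q (timeVol T) ∧ ∃ w : ℝ → X, MemLp w q (timeVol T) ∧ HasWeakTimeDeriv T v w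

/-- Convergence of `U k` to `u` in `L^q(0,T;X)` against all test functions in `L^{q'}(0,T;Y)`, where
`B` is a (bounded bilinear) pairing of `Y` and `X`. For `q = ∞`, `q' = 1` and `X` the dual of `Y` through `B` this is
weak-star convergence in `L^∞(0,T;X)`; for `q = q' = 2` and `Y` the dual of a reflexive `X` it is
weak convergence in `L²(0,T;X)`. -/
def WeakTendsto (q q' : ℝ≥0∞) (T : ℝ) (B : Y → X → ℝ) (U : ℕ → ℝ → X) (u : ℝ → X) :
    Prop :=
  (∀ k, MemLp (U k) q (timeVol T)) ∧ MemLp u q (timeVol T) ∧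
    ∀ f : ℝ → Y, MemLp f q' (timeVol T) →
      Tendsto (fun k => ∫ t, B (f t) (U k t) ∂timeVol T) atTop
        (𝓝 (∫ t, B (f t) (u t) ∂timeVol T))

/-- The piecewise constant interpolant `Π_ℓ v`, with value `v (n+1)` on `(nℓ, (n+1)ℓ]`. -/
def interp {V : Type*} (l : ℝ) (v : ℕ → V) (t : ℝ) : V := v ⌈t / l⌉₊

/-- The difference quotient `D_ℓ(Π_ℓ v)`, with value `(v (n+1) - v n) / ℓ` on `(nℓ, (n+1)ℓ]`. -/
def diffQuot (l : ℝ) (v : ℕ → X) (t : ℝ) : X := l⁻¹ • (v ⌈t / l⌉₊ - v (⌈t / l⌉₊ - 1))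

lemma ceil_div_eq {l t : ℝ} (hl : 0 < l) (n : ℕ) (h1 : n * l < t) (h2 : t ≤ (n + 1) * l) :
    ⌈t / l⌉₊ = n + 1 := by
  rw [Nat.ceil_eq_iff (Nat.succ_ne_zero n)]
  constructor
  · rw [lt_div_iff₀ hl]
    simpa using h1
  · rw [div_le_iff₀ hl]
    push_cast
    exact h2

lemma interp_eq {V : Type*} {l t : ℝ} (hl : 0 < l) (v : ℕ → V) (n : ℕ) (h1 : n * l < t)
    (h2 : t ≤ (n + 1) * l) : interp l v t = v (n + 1) := by
  rw [interp, ceil_div_eq hl n h1 h2]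

lemma diffQuot_eq {l t : ℝ} (hl : 0 < l) (v : ℕ → X) (n : ℕ) (h1 : n * l < t)
    (h2 : t ≤ (n + 1) * l) : diffQuot l v t = l⁻¹ • (v (n + 1) - v n) := by
  rw [diffQuot, ceil_div_eq hl n h1 h2, Nat.add_sub_cancel]

end Time

/-! ### The semi-discrete scheme and the penalized problem -/

/-- `u 0, …, u N` solves the semi-discrete scheme with time step `ℓ = T / N`: `u 0 = u₀` and
`(|u^{n+1}|^{α-2} u^{n+1} - |u^n|^{α-2} u^n) / ℓ - ∇ · (μ |∇u^{n+1}|^{p-2} ∇u^{n+1}) - {u^{n+1}}⁻ / κ`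
equals the mean of `a` over `(nℓ, (n+1)ℓ)`, in `W^{-1,p'}(Ω)`, for `0 ≤ n ≤ N - 1`. -/
def IsDiscreteSolution (T κ : ℝ) (μ : Coefficient Ω) (a : ℝ → Ω.CClosure) (u₀ : W0 Ω p)
    (N : ℕ) (u : ℕ → W0 Ω p) : Prop :=
  u 0 = u₀ ∧ ∀ n < N,
    (T / N)⁻¹ • (alphaConjToDual (fullPow (u (n + 1))) - alphaConjToDual (fullPow (u n)))
        + opB μ κ (u (n + 1))
      = contToDual ((T / N)⁻¹ • ∫ t in (n * (T / N))..((n + 1) * (T / N)), a t)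

/-- `u(0) = u₀`: the function `u` coincides a.e. in time with `ū` continuous from `[0, T]` to
`L^α(Ω)`, for which moreover `|ū|^{(α-2)/2} ū` is continuous from `[0, T]` to `L²(Ω)`,
and `ū(0) = u₀`. -/
def HasInitialValue (T : ℝ) (u : ℝ → W0 Ω p) (u₀ : W0 Ω p) : Prop :=
  ∃ ū : ℝ → Lp ℝ p.alphaE Ω.vol,
    (∀ᵐ t ∂timeVol T, ū t =ᵐ[Ω.vol] (u t).fn) ∧
    ContinuousOn ū (Icc 0 T) ∧
    ContinuousOn (fun t => (memLp_halfPow (Lp.memLp (ū t))).toLp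
      (fun x => spow ((p.alpha - 2) / 2) (ū t x))) (Icc 0 T) ∧
    ū 0 =ᵐ[Ω.vol] u₀.fn

/-- `u` solves the penalized problem `P_κ`. -/
def IsPenalizedSolution (T κ : ℝ) (μ : Coefficient Ω) (a : ℝ → Ω.CClosure) (u₀ : W0 Ω p)
    (u : ℝ → W0 Ω p) : Prop :=
  MemLp u ∞ (timeVol T) ∧
  (∃ dv : ℝ → Lp ℝ 2 Ω.vol, MemLp dv 2 (timeVol T) ∧
    HasWeakTimeDeriv T (fun t => halfPow (u t)) dv) ∧
  (∃ dw : ℝ → WDual Ω p, MemLp dw ∞ (timeVol T) ∧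
    HasWeakTimeDeriv T (fun t => alphaConjToDual (fullPow (u t))) dw ∧
    ∀ v : W0 Ω p, ∀ ψ : ℝ → ℝ, ContDiff ℝ ∞ ψ → HasCompactSupport ψ → tsupport ψ ⊆ Ioo 0 T →
      ∫ t, ψ t * (dw t v + opB μ κ (u t) v) ∂timeVol T
        = ∫ t, ψ t * contToDual (a t) v ∂timeVol T) ∧
  HasInitialValue T u u₀

end IceSheet

end

noncomputable section

namespace IceSheet

/-! ### Morrey's inequality for test functions of the plane -/

lemma finrank_plane : Module.finrank ℝ Plane = 2 := by simp [Plane]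

lemma abs_sub_zero_le_integral_fderiv {φ : Plane → ℝ} (hφ : ContDiff ℝ 1 φ) (y : Plane) :
    |φ y - φ 0| ≤ ‖y‖ * ∫ t in (0:ℝ)..1, ‖fderiv ℝ φ (t • y)‖ := by
  have hd : ∀ t : ℝ, HasDerivAt (fun t : ℝ => φ (t • y)) (fderiv ℝ φ (t • y) y) t := fun t => by
    have h1 : HasDerivAt (fun t : ℝ => t • y) y t := by
      simpa using (hasDerivAt_id t).smul_const y
    exact ((hφ.differentiable one_ne_zero) (t • y)).hasFDerivAt.comp_hasDerivAt t h1
  have hc : Continuous fun t : ℝ => fderiv ℝ φ (t • y) :=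
    (hφ.continuous_fderiv one_ne_zero).comp (by fun_prop)
  have h := intervalIntegral.integral_eq_sub_of_hasDerivAt (a := 0) (b := 1) (fun t _ => hd t)
    ((hc.clm_apply continuous_const).intervalIntegrable 0 1)
  simp only [one_smul, zero_smul] at h
  rw [← h, ← intervalIntegral.integral_const_mul, ← Real.norm_eq_abs]
  refine (intervalIntegral.norm_integral_le_integral_norm zero_le_one).trans ?_
  refine intervalIntegral.integral_mono_on zero_le_one
    ((hc.clm_apply continuous_const).norm.intervalIntegrable 0 1)
    ((hc.norm.const_mul _).intervalIntegrable 0 1) fun t _ => ?_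
  rw [mul_comm]
  exact ContinuousLinearMap.le_opNorm _ _

lemma integral_comp_smul_le {g : Plane → ℝ} (hg : Continuous g) (hs : HasCompactSupport g)
    (h0 : ∀ x, 0 ≤ g x) {q : ℝ} (hq : 1 < q) {s : Set Plane} (hsm : volume s ≠ ⊤) {t : ℝ}
    (ht : 0 < t) :
    ∫ y in s, g (t • y) ≤
      t ^ (-(2 / q)) * ((∫ y, g y ^ q) ^ (1 / q) * (volume.real s) ^ (1 - 1 / q)) := by
  have hq0 : 0 < q := by linarith
  have hc : q.HolderConjugate (q / (q - 1)) := Real.HolderConjugate.conjExponent hq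
  have hgt : Continuous fun y => g (t • y) := hg.comp (by fun_prop)
  have hst : HasCompactSupport fun y => g (t • y) :=
    hs.comp_homeomorph (Homeomorph.smulOfNeZero t ht.ne')
  have hfin : IsFiniteMeasure (volume.restrict s) := ⟨by simpa using hsm.lt_top⟩
  have hm : MemLp (fun y => g (t • y)) (ENNReal.ofReal q) (volume.restrict s) :=
    (hgt.memLp_of_hasCompactSupport hst).restrict s
  have h := integral_mul_le_Lp_mul_Lq_of_nonneg hc (μ := volume.restrict s)
    (f := fun y => g (t • y)) (g := fun _ => (1 : ℝ)) (Eventually.of_forall fun y => h0 _)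
    (Eventually.of_forall fun y => zero_le_one) hm (memLp_const 1)
  simp only [mul_one, Real.one_rpow, integral_const, smul_eq_mul, measureReal_restrict_apply_univ]
    at h
  have hI : Integrable (fun y => g (t • y) ^ q) :=
    (hgt.rpow_const fun _ => Or.inr hq0.le).integrable_of_hasCompactSupport
      (hst.comp_left (g := fun x : ℝ => x ^ q) (Real.zero_rpow hq0.ne'))
  have h1 : ∫ y in s, g (t • y) ^ q ≤ t ^ (-2 : ℝ) * ∫ y, g y ^ q := by
    refine (setIntegral_le_integral hI
      (Eventually.of_forall fun y => Real.rpow_nonneg (h0 _) _)).trans (le_of_eq ?_)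
    rw [Measure.integral_comp_smul volume (fun y => g y ^ q) t, finrank_plane, smul_eq_mul,
      abs_of_nonneg (by positivity), Real.rpow_neg ht.le]
    norm_num
  have e : 1 / (q / (q - 1)) = 1 - 1 / q := by
    field_simp
  have hJ : 0 ≤ ∫ y, g y ^ q := integral_nonneg fun y => Real.rpow_nonneg (h0 _) _
  rw [e] at h
  refine h.trans ?_
  rw [← mul_assoc]
  gcongr
  refine (Real.rpow_le_rpow (integral_nonneg fun y => Real.rpow_nonneg (h0 _) _) h1
    (by positivity)).trans (le_of_eq ?_)
  rw [Real.mul_rpow (Real.rpow_nonneg ht.le _) hJ, ← Real.rpow_mul ht.le]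
  congr 2
  ring

lemma setIntegral_abs_sub_zero_le {φ : Plane → ℝ} (hφ : ContDiff ℝ 1 φ)
    (hs : HasCompactSupport φ) {q : ℝ} (hq : 2 < q) {c : Plane} {r : ℝ} (hr : 0 < r)
    (hc : ‖c‖ ≤ r) :
    ∫ y in Metric.closedBall c r, |φ y - φ 0| ≤ 2 * r * (q / (q - 2)) *
      ((∫ y, ‖fderiv ℝ φ y‖ ^ q) ^ (1 / q) *
        (volume.real (Metric.closedBall c r)) ^ (1 - 1 / q)) := by
  set s := Metric.closedBall c r
  set g : Plane → ℝ := fun y => ‖fderiv ℝ φ y‖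
  have hg : Continuous g := (hφ.continuous_fderiv one_ne_zero).norm
  have hgs : HasCompactSupport g := (hs.fderiv (𝕜 := ℝ)).norm
  have hsc : IsCompact s := isCompact_closedBall c r
  set M := (∫ y, g y ^ q) ^ (1 / q) * (volume.real s) ^ (1 - 1 / q)
  have hM : 0 ≤ M := by positivity
  have hcont : Continuous fun z : Plane × ℝ => g (z.2 • z.1) := hg.comp (by fun_prop)
  have hint : Integrable (fun z : Plane × ℝ => g (z.2 • z.1))
      ((volume.restrict s).prod (volume.restrict (Ioc 0 1))) := by
    rw [Measure.prod_restrict]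
    exact (hcont.continuousOn.integrableOn_compact (hsc.prod isCompact_Icc)).mono_set
      (prod_mono le_rfl Ioc_subset_Icc_self)
  have hI2 : IntegrableOn (fun y => ∫ t in Ioc (0:ℝ) 1, g (t • y)) s := hint.integral_prod_left
  calc ∫ y in s, |φ y - φ 0| ≤ ∫ y in s, (2 * r) * ∫ t in Ioc (0:ℝ) 1, g (t • y) := by
        refine setIntegral_mono_on ?_ (hI2.const_mul _) measurableSet_closedBall fun y hy => ?_
        · exact ((hφ.continuous.sub continuous_const).abs.continuousOn).integrableOn_compact hsc
        · refine (abs_sub_zero_le_integral_fderiv hφ y).trans ?_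
          rw [intervalIntegral.integral_of_le zero_le_one]
          have hy' : ‖y‖ ≤ 2 * r := by
            have : ‖y - c‖ ≤ r := by simpa [s, dist_eq_norm] using hy
            linarith [norm_le_norm_add_norm_sub' y c]
          exact mul_le_mul_of_nonneg_right hy' (integral_nonneg fun t => norm_nonneg _)
    _ = (2 * r) * ∫ t in Ioc (0:ℝ) 1, ∫ y in s, g (t • y) := by
        rw [integral_const_mul, integral_integral_swap hint]
    _ ≤ (2 * r) * ∫ t in Ioc (0:ℝ) 1, t ^ (-(2 / q)) * M := by
        have hlt : -1 < -(2 / q) := by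
          rw [neg_lt_neg_iff, div_lt_one (by linarith)]; exact hq
        have hri : IntegrableOn (fun t : ℝ => t ^ (-(2 / q)) * M) (Ioc 0 1) := by
          have := (intervalIntegral.intervalIntegrable_rpow' (a := 0) (b := 1) hlt).mul_const M
          rwa [intervalIntegrable_iff_integrableOn_Ioc_of_le zero_le_one] at this
        refine mul_le_mul_of_nonneg_left ?_ (by positivity)
        refine setIntegral_mono_on hint.integral_prod_right hri measurableSet_Ioc fun t ht => ?_
        exact integral_comp_smul_le hg hgs (fun _ => norm_nonneg _) (by linarith)
          hsc.measure_lt_top.ne ht.1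
    _ = _ := by
        have hlt : -1 < -(2 / q) := by
          rw [neg_lt_neg_iff, div_lt_one (by linarith)]; exact hq
        have : q ≠ 0 := by linarith
        have h2 : q - 2 ≠ 0 := by linarith
        rw [integral_mul_const, ← intervalIntegral.integral_of_le zero_le_one,
          integral_rpow (Or.inl hlt), Real.one_rpow, Real.zero_rpow (by linarith)]
        have e : -(2 / q) + 1 = (q - 2) / q := by field_simp; ring
        rw [e]
        field_simp
        ring

/-- The constant in Morrey's inequality. -/
def morreyConst (q : ℝ) : ℝ :=
  4 * (q / (q - 2)) * (volume.real (Metric.closedBall (0 : Plane) 1)) ^ (-(1 / q))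

lemma morreyConst_nonneg {q : ℝ} (hq : 2 < q) : 0 ≤ morreyConst q := by
  have : 0 < q - 2 := by linarith
  unfold morreyConst
  positivity

lemma setIntegral_abs_sub_le {φ : Plane → ℝ} (hφ : ContDiff ℝ 1 φ)
    (hs : HasCompactSupport φ) {q : ℝ} (hq : 2 < q) {c x : Plane} {r : ℝ} (hr : 0 < r)
    (hc : ‖c - x‖ ≤ r) :
    ∫ y in Metric.closedBall c r, |φ y - φ x| ≤ 2 * r * (q / (q - 2)) *
      ((∫ y, ‖fderiv ℝ φ y‖ ^ q) ^ (1 / q) *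
        (volume.real (Metric.closedBall c r)) ^ (1 - 1 / q)) := by
  have h := setIntegral_abs_sub_zero_le (φ := fun y => φ (x + y)) (hφ.comp (by fun_prop))
    (hs.comp_homeomorph (Homeomorph.addLeft x)) hq (c := c - x) hr hc
  have hpre : (fun y => x + y) ⁻¹' Metric.closedBall c r = Metric.closedBall (c - x) r := by
    ext y
    simp [dist_eq_norm, sub_sub_eq_add_sub, add_comm]
  have hmp : MeasurePreserving (fun y : Plane => x + y) volume volume :=
    measurePreserving_add_left volume x
  have hme : MeasurableEmbedding (fun y : Plane => x + y) := measurableEmbedding_addLeft x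
  have e1 := hmp.setIntegral_preimage_emb hme (fun y => |φ y - φ x|) (Metric.closedBall c r)
  have e2 := hmp.integral_comp hme (fun y => ‖fderiv ℝ φ y‖ ^ q)
  have e3 : volume.real (Metric.closedBall (c - x) r) = volume.real (Metric.closedBall c r) := by
    rw [← hpre, Measure.real, hmp.measure_preimage_emb hme]
    rfl
  simp only [fderiv_comp_add_left, add_zero] at h
  rw [hpre] at e1
  rwa [e1, e2, e3] at h

/-- **Morrey's inequality** in the plane. -/
theorem morrey {φ : Plane → ℝ} (hφ : ContDiff ℝ 1 φ)
    (hs : HasCompactSupport φ) {q : ℝ} (hq : 2 < q) (x y : Plane) :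
    |φ x - φ y| ≤ morreyConst q * (∫ z, ‖fderiv ℝ φ z‖ ^ q) ^ (1 / q) *
      dist x y ^ (1 - 2 / q) := by
  rcases eq_or_ne x y with rfl | hxy
  · have : (1 - 2 / q) ≠ 0 := by
      have : 2 / q < 1 := by rw [div_lt_one (by linarith)]; exact hq
      linarith
    simp [Real.zero_rpow this]
  set r := dist x y
  have hr : 0 < r := dist_pos.2 hxy
  set c := midpoint ℝ x y
  set s := Metric.closedBall c r
  have hsc : IsCompact s := isCompact_closedBall c r
  have hcx : ‖c - x‖ ≤ r := by
    rw [← dist_eq_norm, dist_midpoint_left]; norm_num; linarith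
  have hcy : ‖c - y‖ ≤ r := by
    rw [← dist_eq_norm, dist_midpoint_right]; norm_num; linarith
  have hx := setIntegral_abs_sub_le hφ hs hq hr hcx
  have hy := setIntegral_abs_sub_le hφ hs hq hr hcy
  set V := volume.real s
  set b := volume.real (Metric.closedBall (0 : Plane) 1)
  have hb : 0 < b := by
    refine ENNReal.toReal_pos (Metric.measure_closedBall_pos _ _ one_pos).ne' ?_
    exact measure_closedBall_lt_top.ne
  have hV : V = r ^ (2 : ℝ) * b := by
    have := Measure.addHaar_real_closedBall' (volume : Measure Plane) c hr.le
    rw [finrank_plane] at this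
    exact_mod_cast this
  have hVpos : 0 < V := by rw [hV]; positivity
  set G := (∫ z, ‖fderiv ℝ φ z‖ ^ q) ^ (1 / q)
  have hi : ∀ z : Plane, IntegrableOn (fun w => |φ w - φ z|) s := fun z =>
    ((hφ.continuous.sub continuous_const).abs.continuousOn).integrableOn_compact hsc
  have h1 : V * |φ x - φ y| ≤ ∫ w in s, (|φ w - φ x| + |φ w - φ y|) := by
    have : ∫ w in s, |φ x - φ y| = V * |φ x - φ y| := by
      rw [setIntegral_const, smul_eq_mul]
    rw [← this]
    refine setIntegral_mono (integrableOn_const hsc.measure_lt_top.ne) ((hi x).add (hi y))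
      fun w => ?_
    have := abs_sub_le (φ x) (φ w) (φ y)
    rw [abs_sub_comm (φ x) (φ w)] at this
    exact this
  rw [integral_add (hi x) (hi y)] at h1
  have h2 : V * |φ x - φ y| ≤ 4 * r * (q / (q - 2)) * (G * V ^ (1 - 1 / q)) := by linarith
  have e : 4 * r * (q / (q - 2)) * (G * V ^ (1 - 1 / q)) =
      V * (morreyConst q * G * r ^ (1 - 2 / q)) := by
    have e1 : V ^ (1 - 1 / q) = V * (r ^ (-(2 / q)) * b ^ (-(1 / q))) := by
      rw [sub_eq_add_neg, Real.rpow_add hVpos, Real.rpow_one]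
      congr 1
      rw [hV, Real.mul_rpow (by positivity) hb.le, ← Real.rpow_mul hr.le]
      congr 2
      ring
    have e2 : r ^ (1 - 2 / q) = r * r ^ (-(2 / q)) := by
      rw [sub_eq_add_neg, Real.rpow_add hr, Real.rpow_one]
    rw [e1, e2, morreyConst]
    ring
  rw [e] at h2
  exact le_of_mul_le_mul_left h2 hVpos

variable {Ω : BddOpen} {p : GlenExp}

/-! ### Test functions -/

lemma GlenExp.pos (p : GlenExp) : 0 < p.val := by linarith [p.two_lt]

lemma GlenExp.pE_eq (p : GlenExp) : p.pE = ENNReal.ofReal p.val := rfl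

lemma Lp_norm_rpow {X : Type*} [MeasurableSpace X] {ν : Measure X} {E : Type*}
    [NormedAddCommGroup E] {q : ℝ≥0∞} {r : ℝ} (hr : 0 < r) (hq : q = ENNReal.ofReal r)
    (f : Lp E q ν) : ‖f‖ ^ r = ∫ x, ‖f x‖ ^ r ∂ν := by
  subst hq
  have hI : 0 ≤ ∫ x, ‖f x‖ ^ r ∂ν := integral_nonneg fun x => Real.rpow_nonneg (norm_nonneg _) _
  rw [Lp.norm_def, (Lp.memLp f).eLpNorm_eq_integral_rpow_norm (by simpa using hr)
    ENNReal.ofReal_ne_top, ENNReal.toReal_ofReal hr.le,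
    ENNReal.toReal_ofReal (Real.rpow_nonneg hI _), ← Real.rpow_mul hI,
    inv_mul_cancel₀ hr.ne', Real.rpow_one]

lemma integrable_Lp_norm_rpow {X : Type*} [MeasurableSpace X] {ν : Measure X} {E : Type*}
    [NormedAddCommGroup E] {q : ℝ≥0∞} {r : ℝ} (hr : 0 < r) (hq : q = ENNReal.ofReal r)
    (f : Lp E q ν) : Integrable (fun x => ‖f x‖ ^ r) ν := by
  subst hq
  have := (Lp.memLp f).integrable_norm_rpow (by simpa using hr) ENNReal.ofReal_ne_top
  rwa [ENNReal.toReal_ofReal hr.le] at this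

/-- `φ` is a smooth function with compact support in `Ω`. -/
structure IsTest (Ω : BddOpen) (φ : Plane → ℝ) : Prop where
  contDiff : ContDiff ℝ ∞ φ
  compact : HasCompactSupport φ
  subset : tsupport φ ⊆ Ω.carrier

namespace IsTest

variable {φ ψ : Plane → ℝ}

lemma contDiff_one (h : IsTest Ω φ) : ContDiff ℝ 1 φ := h.contDiff.of_le (by exact_mod_cast le_top)

lemma differentiable (h : IsTest Ω φ) : Differentiable ℝ φ :=
  h.contDiff_one.differentiable one_ne_zero

lemma zero : IsTest Ω (fun _ => 0) :=
  ⟨contDiff_const, HasCompactSupport.zero, by simp [tsupport, Function.support]⟩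

lemma add (h : IsTest Ω φ) (h' : IsTest Ω ψ) : IsTest Ω (φ + ψ) :=
  ⟨h.contDiff.add h'.contDiff, h.compact.add h'.compact,
    (tsupport_add φ ψ).trans (union_subset h.subset h'.subset)⟩

lemma smul (h : IsTest Ω φ) (c : ℝ) : IsTest Ω (c • φ) :=
  ⟨contDiff_const.smul h.contDiff, h.compact.smul_left,
    (closure_mono (Function.support_const_smul_subset c φ)).trans h.subset⟩

lemma eq_zero (h : IsTest Ω φ) {x : Plane} (hx : x ∉ Ω.carrier) : φ x = 0 :=
  image_eq_zero_of_notMem_tsupport fun h' => hx (h.subset h')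

lemma fderiv_eq_zero (h : IsTest Ω φ) {x : Plane} (hx : x ∉ Ω.carrier) : fderiv ℝ φ x = 0 :=
  image_eq_zero_of_notMem_tsupport fun h' => hx (h.subset (tsupport_fderiv_subset ℝ h'))

end IsTest

/-- `z` is the pair formed of `φ` and its gradient. -/
def Represents (Ω : BddOpen) (p : GlenExp) (φ : Plane → ℝ)
    (z : Lp ℝ p.pE Ω.vol × Lp Plane p.pE Ω.vol) : Prop :=
  IsTest Ω φ ∧ z.1 =ᵐ[Ω.vol] φ ∧ z.2 =ᵐ[Ω.vol] gradient φ

lemma gradient_add' {φ ψ : Plane → ℝ} (hφ : Differentiable ℝ φ) (hψ : Differentiable ℝ ψ)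
    (x : Plane) : gradient (φ + ψ) x = gradient φ x + gradient ψ x := by
  rw [gradient, gradient, gradient, fderiv_add (hφ x) (hψ x), map_add]

lemma gradient_smul' {φ : Plane → ℝ} (hφ : Differentiable ℝ φ) (c : ℝ)
    (x : Plane) : gradient (c • φ) x = c • gradient φ x := by
  rw [gradient, gradient, fderiv_const_smul (hφ x)]
  simp

lemma norm_gradient (φ : Plane → ℝ) (x : Plane) : ‖gradient φ x‖ = ‖fderiv ℝ φ x‖ := by
  rw [gradient, LinearIsometryEquiv.norm_map]

lemma represents_of_mem_span {z : Lp ℝ p.pE Ω.vol × Lp Plane p.pE Ω.vol}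
    (hz : z ∈ Submodule.span ℝ {z : Lp ℝ p.pE Ω.vol × Lp Plane p.pE Ω.vol |
    ∃ φ : Plane → ℝ, ContDiff ℝ ∞ φ ∧ HasCompactSupport φ ∧ tsupport φ ⊆ Ω.carrier ∧
      z.1 =ᵐ[Ω.vol] φ ∧ z.2 =ᵐ[Ω.vol] gradient φ}) : ∃ φ, Represents Ω p φ z := by
  induction hz using Submodule.span_induction with
  | mem z hz =>
    obtain ⟨φ, h1, h2, h3, h4, h5⟩ := hz
    exact ⟨φ, ⟨h1, h2, h3⟩, h4, h5⟩
  | zero =>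
    refine ⟨fun _ => 0, IsTest.zero, Lp.coeFn_zero _ _ _, ?_⟩
    have : gradient (fun _ : Plane => (0 : ℝ)) = 0 := by
      ext1 x
      simp [gradient]
    rw [this]
    exact Lp.coeFn_zero _ _ _
  | add x y _ _ hx hy =>
    obtain ⟨φ, h1, h2, h3⟩ := hx
    obtain ⟨ψ, g1, g2, g3⟩ := hy
    refine ⟨φ + ψ, h1.add g1, ?_, ?_⟩
    · filter_upwards [Lp.coeFn_add x.1 y.1, h2, g2] with t a b c
      rw [Prod.fst_add, a, Pi.add_apply, b, c, Pi.add_apply]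
    · filter_upwards [Lp.coeFn_add x.2 y.2, h3, g3] with t a b c
      rw [Prod.snd_add, a, Pi.add_apply, b, c, gradient_add' h1.differentiable g1.differentiable]
  | smul c x _ hx =>
    obtain ⟨φ, h1, h2, h3⟩ := hx
    refine ⟨c • φ, h1.smul c, ?_, ?_⟩
    · filter_upwards [Lp.coeFn_smul c x.1, h2] with t a b
      rw [Prod.smul_fst, a, Pi.smul_apply, b, Pi.smul_apply]
    · filter_upwards [Lp.coeFn_smul c x.2, h3] with t a b
      rw [Prod.smul_snd, a, Pi.smul_apply, b, gradient_smul' h1.differentiable]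

/-- Closed properties of pairs that hold for test functions hold on `W₀^{1,p}(Ω)`. -/
lemma W0.induction_closed {S : Set (Lp ℝ p.pE Ω.vol × Lp Plane p.pE Ω.vol)} (hS : IsClosed S)
    (h : ∀ φ z, Represents Ω p φ z → z ∈ S) (u : W0 Ω p) : u.1 ∈ S := by
  refine hS.closure_subset_iff.2 ?_ u.2
  intro z hz
  obtain ⟨φ, hφ⟩ := represents_of_mem_span hz
  exact h φ z hφ

lemma W0.norm_eq (u : W0 Ω p) : ‖u‖ = max ‖u.fn‖ ‖u.grad‖ := rfl

lemma W0.norm_fn_le (u : W0 Ω p) : ‖u.fn‖ ≤ ‖u‖ := le_max_left _ _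

lemma W0.norm_grad_le (u : W0 Ω p) : ‖u.grad‖ ≤ ‖u‖ := le_max_right _ _

/-- `u ↦ u` from `W₀^{1,p}(Ω)` to `L^p(Ω)`. -/
def W0.fnL : W0 Ω p →L[ℝ] Lp ℝ p.pE Ω.vol :=
  (ContinuousLinearMap.fst ℝ _ _) ∘L (sobolevZero Ω p).subtypeL

/-- `u ↦ ∇u` from `W₀^{1,p}(Ω)` to `L^p(Ω; ℝ²)`. -/
def W0.gradL : W0 Ω p →L[ℝ] Lp Plane p.pE Ω.vol :=
  (ContinuousLinearMap.snd ℝ _ _) ∘L (sobolevZero Ω p).subtypeL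

instance : CompleteSpace (W0 Ω p) :=
  (Submodule.isClosed_topologicalClosure _).completeSpace_coe

instance : Fact (p.pE ≠ ⊤) := ⟨ENNReal.ofReal_ne_top⟩

instance : IsSeparable Ω.vol := by
  unfold BddOpen.vol
  infer_instance

instance : SecondCountableTopology (W0 Ω p) :=
  TopologicalSpace.Subtype.secondCountableTopology
    (sobolevZero Ω p : Set (Lp ℝ p.pE Ω.vol × Lp Plane p.pE Ω.vol))

/-! ### Morrey's inequality and its consequences -/

lemma Represents.integral_fderiv {φ : Plane → ℝ} {z : Lp ℝ p.pE Ω.vol × Lp Plane p.pE Ω.vol}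
    (h : Represents Ω p φ z) : (∫ x, ‖fderiv ℝ φ x‖ ^ p.val) ^ (1 / p.val) = ‖z.2‖ := by
  have h1 : ∫ x, ‖fderiv ℝ φ x‖ ^ p.val = ∫ x, ‖z.2 x‖ ^ p.val ∂Ω.vol := by
    rw [← setIntegral_eq_integral_of_forall_compl_eq_zero (s := Ω.carrier)]
    · refine integral_congr_ae ?_
      filter_upwards [h.2.2] with x hx
      rw [hx, norm_gradient]
    · intro x hx
      rw [h.1.fderiv_eq_zero hx, norm_zero, Real.zero_rpow p.pos.ne']
  rw [h1, ← Lp_norm_rpow p.pos p.pE_eq z.2, ← Real.rpow_mul (norm_nonneg _),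
    mul_one_div_cancel p.pos.ne',
    Real.rpow_one]

lemma Represents.abs_sub_le {φ : Plane → ℝ} {z : Lp ℝ p.pE Ω.vol × Lp Plane p.pE Ω.vol}
    (h : Represents Ω p φ z) (x y : Plane) :
    |φ x - φ y| ≤ morreyConst p.val * ‖z.2‖ * dist x y ^ (1 - 2 / p.val) := by
  rw [← h.integral_fderiv]
  exact morrey h.1.contDiff_one h.1.compact p.two_lt x y

lemma GlenExp.morrey_exp_pos (p : GlenExp) : 0 < 1 - 2 / p.val := by
  have : 2 / p.val < 1 := by rw [div_lt_one p.pos]; exact p.two_lt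
  linarith

lemma exists_sup_bound (Ω : BddOpen) (p : GlenExp) : ∃ C : ℝ, 0 ≤ C ∧
    ∀ φ z, Represents Ω p φ z → ∀ x, |φ x| ≤ C * ‖z.2‖ := by
  obtain ⟨D, hD⟩ := Ω.isBounded.subset_closedBall 0
  set D' := max D 0
  have hK := morreyConst_nonneg p.two_lt
  refine ⟨morreyConst p.val * (2 * D' + 1) ^ (1 - 2 / p.val), by positivity, fun φ z h x => ?_⟩
  by_cases hx : x ∈ Ω.carrier
  · have hx' : ‖x‖ ≤ D' := by
      have := hD hx
      rw [mem_closedBall_zero_iff] at this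
      exact this.trans (le_max_left _ _)
    set y : Plane := EuclideanSpace.single 0 (D' + 1)
    have hy : ‖y‖ = D' + 1 := by
      rw [PiLp.norm_single, Real.norm_eq_abs, abs_of_nonneg (by positivity)]
    have hy' : y ∉ Ω.carrier := fun hy' => by
      have := hD hy'
      rw [mem_closedBall_zero_iff, hy] at this
      linarith [le_max_left D 0]
    have h1 := h.abs_sub_le x y
    rw [h.1.eq_zero hy', sub_zero] at h1
    refine h1.trans ?_
    have hd : dist x y ≤ 2 * D' + 1 := by
      rw [dist_eq_norm]
      linarith [norm_sub_le x y]
    have := Real.rpow_le_rpow dist_nonneg hd p.morrey_exp_pos.le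
    calc morreyConst p.val * ‖z.2‖ * dist x y ^ (1 - 2 / p.val)
        ≤ morreyConst p.val * ‖z.2‖ * (2 * D' + 1) ^ (1 - 2 / p.val) := by gcongr
      _ = _ := by ring
  · rw [h.1.eq_zero hx, abs_zero]
    positivity

/-- **Poincaré's inequality.** -/
theorem W0.poincare (Ω : BddOpen) (p : GlenExp) :
    ∃ C : ℝ, 1 ≤ C ∧ ∀ u : W0 Ω p, ‖u‖ ≤ C * ‖u.grad‖ := by
  obtain ⟨C, hC, h⟩ := exists_sup_bound Ω p
  set V := (Ω.vol.real univ) ^ (p.pE.toReal)⁻¹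
  have hV : 0 ≤ V := Real.rpow_nonneg measureReal_nonneg _
  refine ⟨max 1 (V * C), le_max_left _ _, fun u => ?_⟩
  have h1 : ‖u.fn‖ ≤ V * C * ‖u.grad‖ := by
    refine W0.induction_closed (S := {z | ‖z.1‖ ≤ V * C * ‖z.2‖})
      (isClosed_le (by fun_prop) (by fun_prop)) (fun φ z hz => ?_) u
    change ‖z.1‖ ≤ V * C * ‖z.2‖
    rw [mul_assoc]
    refine Lp.norm_le_of_ae_bound (by positivity) ?_
    filter_upwards [hz.2.1] with x hx
    rw [hx]
    exact h φ z hz x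
  rw [W0.norm_eq]
  refine max_le (h1.trans ?_) ?_
  · gcongr
    exact le_max_right _ _
  · exact le_mul_of_one_le_left (norm_nonneg _) (le_max_left _ _)

lemma memLp_extend' (q : ℝ≥0∞) (f : Ω.CClosure) :
    MemLp (Function.extend Subtype.val f 0) q Ω.vol := by
  have hc : ContinuousOn (Function.extend Subtype.val f 0) (closure Ω.carrier) := by
    rw [continuousOn_iff_continuous_domRestrict]
    convert f.continuous using 1
    ext x
    exact Subtype.val_injective.extend_apply f 0 x
  refine MemLp.of_bound ((hc.mono subset_closure).aestronglyMeasurable Ω.isOpen.measurableSet) ‖f‖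
    (Eventually.of_forall fun x => ?_)
  by_cases hx : x ∈ closure Ω.carrier
  · rw [show Function.extend Subtype.val f 0 x = f ⟨x, hx⟩ from
      Subtype.val_injective.extend_apply f 0 (⟨x, hx⟩ : closure Ω.carrier)]
    exact f.norm_coe_le_norm _
  · rw [Function.extend_apply' _ _ _ (by rintro ⟨y, rfl⟩; exact hx y.2)]
    simp

lemma extend_apply_mem (f : Ω.CClosure) {x : Plane} (hx : x ∈ closure Ω.carrier) :
    Function.extend Subtype.val f 0 x = f ⟨x, hx⟩ :=
  Subtype.val_injective.extend_apply f 0 (⟨x, hx⟩ : closure Ω.carrier)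

lemma BddOpen.ae_mem (Ω : BddOpen) : ∀ᵐ x ∂Ω.vol, x ∈ Ω.carrier :=
  ae_restrict_mem Ω.isOpen.measurableSet

/-- The embedding of the continuous functions on the closure of `Ω` in `L^q(Ω)`. -/
def extendL (Ω : BddOpen) (q : ℝ≥0∞) [Fact (1 ≤ q)] : Ω.CClosure →L[ℝ] Lp ℝ q Ω.vol :=
  LinearMap.mkContinuous
    { toFun := fun f => (memLp_extend' q f).toLp _
      map_add' := fun f g => by
        rw [← MemLp.toLp_add]
        refine MemLp.toLp_congr _ _ ?_
        filter_upwards [Ω.ae_mem] with x hx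
        have hx := subset_closure hx
        exact (extend_apply_mem (f + g) hx).trans
          (congrArg₂ (· + ·) (extend_apply_mem f hx).symm (extend_apply_mem g hx).symm)
      map_smul' := fun c f => by
        rw [RingHom.id_apply, ← MemLp.toLp_const_smul]
        refine MemLp.toLp_congr _ _ ?_
        filter_upwards [Ω.ae_mem] with x hx
        have hx := subset_closure hx
        exact (extend_apply_mem (c • f) hx).trans
          (congrArg (c • ·) (extend_apply_mem f hx).symm) }
    ((Ω.vol.real univ) ^ (q.toReal)⁻¹) fun f => by
      refine Lp.norm_le_of_ae_bound (norm_nonneg _) ?_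
      filter_upwards [(memLp_extend' q f).coeFn_toLp, Ω.ae_mem] with x h1 hx
      have hx := subset_closure hx
      change ‖(memLp_extend' q f).toLp _ x‖ ≤ _
      rw [h1, extend_apply_mem _ hx]
      exact f.norm_coe_le_norm _

lemma extendL_ae (q : ℝ≥0∞) [Fact (1 ≤ q)] (f : Ω.CClosure) :
    extendL Ω q f =ᵐ[Ω.vol] Function.extend Subtype.val f 0 :=
  (memLp_extend' q f).coeFn_toLp

/-- **Rellich's theorem**: bounded subsets of `W₀^{1,p}(Ω)` are relatively compact in `L^p(Ω)`. -/
theorem W0.exists_compact (Ω : BddOpen) (p : GlenExp) (R : ℝ) :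
    ∃ K : Set (Lp ℝ p.pE Ω.vol), IsCompact K ∧ ∀ u : W0 Ω p, ‖u‖ ≤ R → u.fn ∈ K := by
  obtain ⟨C, hC, hb⟩ := exists_sup_bound Ω p
  have : CompactSpace (closure Ω.carrier) :=
    isCompact_iff_compactSpace.1 Ω.isBounded.isCompact_closure
  have hM := morreyConst_nonneg p.two_lt
  set A : Set Ω.CClosure := {f | ∃ φ z, Represents Ω p φ z ∧ ‖z‖ ≤ R + 1 ∧ ∀ x, f x = φ x}
  have hA : IsCompact (closure A) := by
    refine BoundedContinuousFunction.arzela_ascoli (Icc (-(C * (R + 1))) (C * (R + 1)))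
      isCompact_Icc A ?_ ?_
    · rintro f x ⟨φ, z, hz, hR, hf⟩
      refine mem_Icc.2 (abs_le.1 ?_)
      rw [hf]
      refine (hb φ z hz x).trans ?_
      gcongr
      exact (le_max_right _ _).trans hR
    · refine Metric.equicontinuous_of_continuity_modulus
        (fun r => morreyConst p.val * (R + 1) * r ^ (1 - 2 / p.val)) ?_ _ ?_
      · have h0 : Tendsto (fun r : ℝ => r ^ (1 - 2 / p.val)) (𝓝 0) (𝓝 (0 ^ (1 - 2 / p.val))) :=
          (Real.continuousAt_rpow_const _ _ (Or.inr p.morrey_exp_pos.le)).tendsto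
        rw [Real.zero_rpow p.morrey_exp_pos.ne'] at h0
        simpa using h0.const_mul (morreyConst p.val * (R + 1))
      · rintro x y ⟨f, φ, z, hz, hR, hf⟩
        change dist (f x) (f y) ≤ _
        rw [Real.dist_eq, hf, hf, Subtype.dist_eq]
        refine (hz.abs_sub_le x y).trans ?_
        have := (le_max_right ‖z.1‖ ‖z.2‖).trans hR
        gcongr
  have hK := hA.image (extendL Ω p.pE).continuous
  refine ⟨_, hK, fun u hu => ?_⟩
  rw [W0.fn]
  have hu2 := u.2
  have hmem : u.1 ∈ closure (Metric.ball u.1 1 ∩ (Submodule.span ℝ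
      {z : Lp ℝ p.pE Ω.vol × Lp Plane p.pE Ω.vol |
      ∃ φ : Plane → ℝ, ContDiff ℝ ∞ φ ∧ HasCompactSupport φ ∧ tsupport φ ⊆ Ω.carrier ∧
      z.1 =ᵐ[Ω.vol] φ ∧ z.2 =ᵐ[Ω.vol] gradient φ} : Set _)) :=
    Metric.isOpen_ball.inter_closure ⟨Metric.mem_ball_self one_pos, hu2⟩
  have hcl : IsClosed {z : Lp ℝ p.pE Ω.vol × Lp Plane p.pE Ω.vol |
      z.1 ∈ extendL Ω p.pE '' closure A} := hK.isClosed.preimage continuous_fst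
  refine hcl.closure_subset_iff.2 ?_ hmem
  rintro z ⟨hz1, hz2⟩
  obtain ⟨φ, hφ⟩ := represents_of_mem_span hz2
  have hzR : ‖z‖ ≤ R + 1 := by
    have h1 := norm_le_norm_add_norm_sub' z u.1
    rw [← dist_eq_norm] at h1
    have h2 : ‖u.1‖ ≤ R := hu
    linarith [Metric.mem_ball.1 hz1]
  refine ⟨BoundedContinuousFunction.mkOfCompact
    ⟨fun x => φ x, hφ.1.contDiff.continuous.comp continuous_subtype_val⟩,
    subset_closure ⟨φ, z, hφ, hzR, fun x => rfl⟩, ?_⟩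
  refine Lp.ext ((extendL_ae _ _).trans ?_)
  filter_upwards [Ω.ae_mem, hφ.2.1] with x hx hz
  rw [extend_apply_mem _ (subset_closure hx), hz]
  rfl

/-! ### Elements of the dual -/

/-- `L^{p'}(Ω) → W^{-1,p'}(Ω)`. -/
def toDualL (Ω : BddOpen) (p : GlenExp) : Lp ℝ p.conjE Ω.vol →L[ℝ] WDual Ω p :=
  (ContinuousLinearMap.compL ℝ (W0 Ω p) (Lp ℝ p.pE Ω.vol) ℝ).flip W0.fnL ∘L
    ((ContinuousLinearMap.mul ℝ ℝ).lpPairing Ω.vol p.conjE p.pE)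

lemma toDual_eq (f : Plane → ℝ) (hf : MemLp f p.conjE Ω.vol) :
    toDual f hf = toDualL Ω p (hf.toLp f) := rfl

/-- `L^{p'}(Ω; ℝ²) → W^{-1,p'}(Ω)`. -/
def negDivL (Ω : BddOpen) (p : GlenExp) : Lp Plane p.conjE Ω.vol →L[ℝ] WDual Ω p :=
  (ContinuousLinearMap.compL ℝ (W0 Ω p) (Lp Plane p.pE Ω.vol) ℝ).flip W0.gradL ∘L
    ((innerSL ℝ (E := Plane)).lpPairing Ω.vol p.conjE p.pE)

lemma negDiv_eq (F : Plane → Plane) (hF : MemLp F p.conjE Ω.vol) :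
    negDiv F hF = negDivL Ω p (hF.toLp F) := rfl

/-- `contToDual` as a continuous linear map. -/
def contToDualL (Ω : BddOpen) (p : GlenExp) : Ω.CClosure →L[ℝ] WDual Ω p :=
  toDualL Ω p ∘L extendL Ω p.conjE

lemma alphaConjToDual_apply (w : Lp ℝ p.alphaConjE Ω.vol) (v : W0 Ω p) :
    alphaConjToDual w v = ∫ x, w x * v.fn x ∂Ω.vol := toDual_apply _ _ _

/-- The embedding of `L^q(Ω)` in `L^{q'}(Ω)` for `q' ≤ q`. -/
def inclL (Ω : BddOpen) {q q' : ℝ≥0∞} [Fact (1 ≤ q)] [Fact (1 ≤ q')] (h : q' ≤ q)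
    (hq : q ≠ ⊤) : Lp ℝ q Ω.vol →L[ℝ] Lp ℝ q' Ω.vol :=
  LinearMap.mkContinuous
    { toFun := fun w => ((Lp.memLp w).mono_exponent h).toLp _
      map_add' := fun f g => by
        rw [← MemLp.toLp_add]
        exact MemLp.toLp_congr _ _ (Lp.coeFn_add f g)
      map_smul' := fun c f => by
        rw [RingHom.id_apply, ← MemLp.toLp_const_smul]
        exact MemLp.toLp_congr _ _ (Lp.coeFn_smul c f) }
    ((Ω.vol univ ^ (1 / q'.toReal - 1 / q.toReal)).toReal) fun w => by
      change ‖((Lp.memLp w).mono_exponent h).toLp _‖ ≤ _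
      rw [Lp.norm_toLp, Lp.norm_def, mul_comm, ← ENNReal.toReal_mul]
      refine ENNReal.toReal_mono ?_
        (eLpNorm_le_eLpNorm_mul_rpow_measure_univ h (Lp.aestronglyMeasurable w))
      refine ENNReal.mul_ne_top (Lp.eLpNorm_ne_top w)
        (ENNReal.rpow_ne_top_of_nonneg ?_ (measure_ne_top _ _))
      rw [sub_nonneg]
      refine one_div_le_one_div_of_le ?_ (ENNReal.toReal_mono hq h)
      have h1 : (1 : ℝ≥0∞) ≤ q' := Fact.out
      exact ENNReal.toReal_pos (zero_lt_one.trans_le h1).ne' (ne_top_of_le_ne_top hq h)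

lemma inclL_ae {q q' : ℝ≥0∞} [Fact (1 ≤ q)] [Fact (1 ≤ q')] (h : q' ≤ q)
    (hq : q ≠ ⊤) (w : Lp ℝ q Ω.vol) : inclL Ω h hq w =ᵐ[Ω.vol] w :=
  ((Lp.memLp w).mono_exponent h).coeFn_toLp

/-- `alphaConjToDual` as a continuous linear map. -/
def alphaConjToDualL (Ω : BddOpen) (p : GlenExp) :
    Lp ℝ p.alphaConjE Ω.vol →L[ℝ] WDual Ω p :=
  toDualL Ω p ∘L inclL Ω p.conjE_le_alphaConjE ENNReal.ofReal_ne_top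

/-! ### Injectivity of the embedding in `L^p(Ω)` -/

lemma integral_mul_inner_gradient {φ g : Plane → ℝ} (hφ : IsTest Ω φ) (hg : IsTest Ω g)
    (e : Plane) :
    ∫ x, fderiv ℝ g x e * φ x ∂Ω.vol + ∫ x, inner ℝ (g x • e) (gradient φ x) ∂Ω.vol = 0 := by
  have hcg := hg.contDiff_one.continuous_fderiv one_ne_zero
  have hcφ := hφ.contDiff_one.continuous_fderiv one_ne_zero
  have h := integral_mul_fderiv_eq_neg_fderiv_mul_of_integrable (μ := volume) (f := g) (g := φ)
    (v := e)
    (((hcg.clm_apply continuous_const).mul hφ.contDiff.continuous).integrable_of_hasCompactSupport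
      hφ.compact.mul_left)
    ((hg.contDiff.continuous.mul (hcφ.clm_apply continuous_const)).integrable_of_hasCompactSupport
      hg.compact.mul_right)
    ((hg.contDiff.continuous.mul hφ.contDiff.continuous).integrable_of_hasCompactSupport
      hφ.compact.mul_left)
    (fun x _ => hg.differentiable x) (fun x _ => hφ.differentiable x)
  have h1 : ∫ x, fderiv ℝ g x e * φ x ∂Ω.vol = ∫ x, fderiv ℝ g x e * φ x := by
    refine setIntegral_eq_integral_of_forall_compl_eq_zero fun x hx => ?_
    rw [hφ.eq_zero hx, mul_zero]
  have h2 : ∫ x, inner ℝ (g x • e) (gradient φ x) ∂Ω.vol = ∫ x, g x * fderiv ℝ φ x e := by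
    have : ∀ x, inner ℝ (g x • e) (gradient φ x) = g x * fderiv ℝ φ x e := fun x => by
      rw [real_inner_smul_left, real_inner_comm, gradient, InnerProductSpace.toDual_symm_apply]
    simp_rw [this]
    refine setIntegral_eq_integral_of_forall_compl_eq_zero fun x hx => ?_
    rw [hg.eq_zero hx, zero_mul]
  rw [h1, h2, h, add_neg_cancel]

lemma W0.integral_by_parts (u : W0 Ω p) {g : Plane → ℝ} (hg : IsTest Ω g) (e : Plane) :
    ∫ x, fderiv ℝ g x e * u.fn x ∂Ω.vol + ∫ x, inner ℝ (g x • e) (u.grad x) ∂Ω.vol = 0 := by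
  have hcg := hg.contDiff_one.continuous_fderiv one_ne_zero
  have m1 : MemLp (fun x => fderiv ℝ g x e) p.conjE Ω.vol :=
    ((hcg.clm_apply continuous_const).memLp_of_hasCompactSupport
      (hg.compact.fderiv_apply ℝ e)).restrict _
  have m2 : MemLp (fun x => g x • e) p.conjE Ω.vol :=
    ((hg.contDiff.continuous.smul continuous_const).memLp_of_hasCompactSupport
      hg.compact.smul_right).restrict _
  have key := W0.induction_closed (Ω := Ω) (p := p)
    (S := {z | (ContinuousLinearMap.mul ℝ ℝ).lpPairing Ω.vol p.conjE p.pE (m1.toLp _) z.1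
      + (innerSL ℝ (E := Plane)).lpPairing Ω.vol p.conjE p.pE (m2.toLp _) z.2 = 0})
    (isClosed_eq (by fun_prop) continuous_const) (fun φ z hz => ?_) u
  · change _ + _ = _ at key
    rw [ContinuousLinearMap.lpPairing_eq_integral, ContinuousLinearMap.lpPairing_eq_integral]
      at key
    rw [← key]
    congr 1
    · refine integral_congr_ae ?_
      filter_upwards [m1.coeFn_toLp] with x hx
      rw [hx]
      rfl
    · refine integral_congr_ae ?_
      filter_upwards [m2.coeFn_toLp] with x hx
      rw [hx]
      rfl
  · change _ + _ = _
    rw [ContinuousLinearMap.lpPairing_eq_integral, ContinuousLinearMap.lpPairing_eq_integral,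
      ← integral_mul_inner_gradient hz.1 hg e]
    congr 1
    · refine integral_congr_ae ?_
      filter_upwards [m1.coeFn_toLp, hz.2.1] with x hx h2
      rw [hx, h2]
      rfl
    · refine integral_congr_ae ?_
      filter_upwards [m2.coeFn_toLp, hz.2.2] with x hx h2
      rw [hx, h2]
      rfl

/-- The weak gradient is determined by the function. -/
theorem W0.fnL_injective : Function.Injective (W0.fnL : W0 Ω p → _) := by
  refine (injective_iff_map_eq_zero _).2 fun u hu => ?_
  have hu' : u.fn = 0 := hu
  suffices h : u.grad = 0 from Subtype.ext (Prod.ext hu' h)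
  have hli : LocallyIntegrableOn (fun x => u.grad x) Ω.carrier volume := by
    have : IntegrableOn (fun x => u.grad x) Ω.carrier volume :=
      (Lp.memLp u.grad).integrable (Fact.out : 1 ≤ p.pE)
    exact this.locallyIntegrableOn
  have h0 := Ω.isOpen.ae_eq_zero_of_integral_contDiff_smul_eq_zero hli fun g h1 h2 h3 => by
    have hg : IsTest Ω g := ⟨h1, h2, h3⟩
    have hint : Integrable (fun x => g x • u.grad x) Ω.vol := by
      obtain ⟨C, hC⟩ := h2.exists_bound_of_continuous h1.continuous
      exact ((Lp.memLp u.grad).integrable (Fact.out : 1 ≤ p.pE)).bdd_smul C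
        h1.continuous.aestronglyMeasurable (Eventually.of_forall hC)
    have hz : ∫ x, g x • u.grad x ∂Ω.vol = 0 := by
      refine ext_inner_left ℝ fun e => ?_
      rw [inner_zero_right, ← integral_inner hint]
      have := u.integral_by_parts hg e
      have hz : ∫ x, fderiv ℝ g x e * u.fn x ∂Ω.vol = 0 := by
        rw [hu']
        refine integral_eq_zero_of_ae ?_
        filter_upwards [Lp.coeFn_zero ℝ p.pE Ω.vol] with x hx
        rw [hx]
        simp
      rw [hz, zero_add] at this
      rw [← this]
      refine integral_congr_ae (Eventually.of_forall fun x => ?_)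
      simp only [real_inner_smul_left, real_inner_smul_right]
    rw [← hz]
    refine (setIntegral_eq_integral_of_forall_compl_eq_zero fun x hx => ?_).symm
    rw [hg.eq_zero hx, zero_smul]
  refine Lp.ext ?_
  filter_upwards [Lp.coeFn_zero Plane p.pE Ω.vol, ae_restrict_of_ae h0, Ω.ae_mem] with x a b c
  rw [a, b c]
  rfl

lemma W0.ext_fn {u v : W0 Ω p} (h : u.fn = v.fn) : u = v := W0.fnL_injective h

/-! ### Weak compactness -/

lemma norm_half_add_rpow {E : Type*} [NormedAddCommGroup E] [InnerProductSpace ℝ E] {q : ℝ}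
    (hq : 2 ≤ q) (a b : E) :
    ‖(1 / 2 : ℝ) • (a + b)‖ ^ q + ‖(1 / 2 : ℝ) • (a - b)‖ ^ q ≤ (‖a‖ ^ q + ‖b‖ ^ q) / 2 := by
  have hr : 1 ≤ q / 2 := by linarith
  have hsq : ∀ c : E, ‖c‖ ^ q = (‖c‖ ^ 2) ^ (q / 2) := fun c => by
    rw [← Real.rpow_natCast, ← Real.rpow_mul (norm_nonneg _)]
    congr 1
    push_cast
    ring
  rw [hsq, hsq, hsq, hsq]
  have h1 : (‖(1 / 2 : ℝ) • (a + b)‖ ^ 2) ^ (q / 2) + (‖(1 / 2 : ℝ) • (a - b)‖ ^ 2) ^ (q / 2) ≤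
      (‖(1 / 2 : ℝ) • (a + b)‖ ^ 2 + ‖(1 / 2 : ℝ) • (a - b)‖ ^ 2) ^ (q / 2) := by
    have := NNReal.add_rpow_le_rpow_add (⟨‖(1 / 2 : ℝ) • (a + b)‖ ^ 2, by positivity⟩ : NNReal)
      ⟨‖(1 / 2 : ℝ) • (a - b)‖ ^ 2, by positivity⟩ hr
    exact_mod_cast this
  refine h1.trans ?_
  have h2 : ‖(1 / 2 : ℝ) • (a + b)‖ ^ 2 + ‖(1 / 2 : ℝ) • (a - b)‖ ^ 2 =
      1 / 2 * ‖a‖ ^ 2 + 1 / 2 * ‖b‖ ^ 2 := by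
    have := parallelogram_law_with_norm ℝ a b
    rw [norm_smul, norm_smul, mul_pow, mul_pow]
    norm_num
    linarith
  rw [h2]
  have h3 := (convexOn_rpow hr).2 (mem_Ici.2 (sq_nonneg ‖a‖)) (mem_Ici.2 (sq_nonneg ‖b‖))
    (show (0 : ℝ) ≤ 1 / 2 by norm_num) (show (0 : ℝ) ≤ 1 / 2 by norm_num) (by norm_num)
  simp only [smul_eq_mul] at h3
  linarith

/-- In a Banach space with a uniformly convex functional `E`, any sequence on which `E` is bounded
has convergent convex combinations of its tails. -/
lemma exists_tendsto_convexHull {X : Type*} [NormedAddCommGroup X] [NormedSpace ℝ X]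
    [CompleteSpace X] (E : X → ℝ) (h0 : ∀ x, 0 ≤ E x)
    (hE : ∀ a b, E ((1 / 2 : ℝ) • (a + b)) + E ((1 / 2 : ℝ) • (a - b)) ≤ (E a + E b) / 2)
    (hc : ∀ ε > 0, ∃ δ > 0, ∀ x, E x < δ → ‖x‖ < ε) (z : ℕ → X) (M : ℝ) (hM : ∀ k, E (z k) ≤ M) :
    ∃ (y : ℕ → X) (x : X), (∀ n, y n ∈ convexHull ℝ (z '' Ici n)) ∧ Tendsto y atTop (𝓝 x) := by
  set C : ℕ → Set X := fun n => convexHull ℝ (z '' Ici n)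
  have hCne : ∀ n, (E '' C n).Nonempty := fun n =>
    ⟨E (z n), z n, subset_convexHull ℝ _ ⟨n, mem_Ici.2 le_rfl, rfl⟩, rfl⟩
  have hbdd : ∀ n, BddBelow (E '' C n) := fun n => ⟨0, by rintro _ ⟨x, -, rfl⟩; exact h0 x⟩
  set d : ℕ → ℝ := fun n => sInf (E '' C n)
  have hanti : ∀ m n, m ≤ n → C n ⊆ C m := fun m n h =>
    convexHull_mono (image_mono (Ici_subset_Ici.2 h))
  have hmono : Monotone d := fun m n h => csInf_le_csInf (hbdd m) (hCne n)
    (image_mono (hanti m n h))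
  have hdM : ∀ n, d n ≤ M := fun n => (csInf_le (hbdd n)
    ⟨z n, subset_convexHull ℝ _ ⟨n, mem_Ici.2 le_rfl, rfl⟩, rfl⟩).trans (hM n)
  obtain ⟨D, hD⟩ : ∃ D, Tendsto d atTop (𝓝 D) :=
    ⟨_, tendsto_atTop_ciSup hmono ⟨M, by rintro _ ⟨n, rfl⟩; exact hdM n⟩⟩
  have hdD : ∀ n, d n ≤ D := fun n => hmono.ge_of_tendsto hD n
  have hex : ∀ n : ℕ, ∃ x ∈ C n, E x < d n + 1 / ((n : ℝ) + 1) := fun n => by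
    obtain ⟨_, ⟨x, hx, rfl⟩, hlt⟩ := exists_lt_of_csInf_lt (hCne n)
      (show d n < d n + 1 / ((n : ℝ) + 1) by linarith [Nat.one_div_pos_of_nat (α := ℝ) (n := n)])
    exact ⟨x, hx, hlt⟩
  choose y hy hyE using hex
  have hsmall : Tendsto (fun n : ℕ => (D - d n) + 1 / ((n : ℝ) + 1)) atTop (𝓝 0) := by
    have := (tendsto_const_nhds (x := D)).sub hD |>.add tendsto_one_div_add_atTop_nhds_zero_nat
    simpa using this
  have hcau : CauchySeq y := by
    refine Metric.cauchySeq_iff.2 fun ε hε => ?_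
    obtain ⟨δ, hδ, hδ'⟩ := hc (ε / 2) (by positivity)
    obtain ⟨K, hK⟩ := eventually_atTop.1 (hsmall.eventually (gt_mem_nhds (show 0 < δ by exact hδ)))
    have key : ∀ m n, K ≤ m → m ≤ n → dist (y m) (y n) < ε := fun m n hm hmn => by
      have hmem : (1 / 2 : ℝ) • (y m + y n) ∈ C m := by
        rw [smul_add]
        exact convex_convexHull ℝ _ (hy m) (hanti m n hmn (hy n)) (by norm_num) (by norm_num)
          (by norm_num)
      have h1 : d m ≤ E ((1 / 2 : ℝ) • (y m + y n)) := csInf_le (hbdd m) ⟨_, hmem, rfl⟩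
      have h2 := hE (y m) (y n)
      have h3 := hK m hm
      have h4 := hK n (hm.trans hmn)
      have h5 := hyE m
      have h6 := hyE n
      have h7 := hdD m
      have h8 := hdD n
      have := hδ' ((1 / 2 : ℝ) • (y m - y n)) (by
        have h9 := hmono hmn
        linarith)
      rw [norm_smul] at this
      rw [dist_eq_norm]
      norm_num at this
      linarith
    refine ⟨K, fun m hm n hn => ?_⟩
    rcases le_total m n with h | h
    · exact key m n hm h
    · rw [dist_comm]
      exact key n m hn h
  obtain ⟨x, hx⟩ := cauchySeq_tendsto_of_complete hcau
  exact ⟨y, x, hy, hx⟩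

lemma W0.exists_tendsto_convexHull (z : ℕ → W0 Ω p) (R : ℝ) (hR : ∀ k, ‖z k‖ ≤ R) :
    ∃ (y : ℕ → W0 Ω p) (x : W0 Ω p),
      (∀ n, y n ∈ convexHull ℝ (z '' Ici n)) ∧ Tendsto y atTop (𝓝 x) := by
  obtain ⟨C, hC, hP⟩ := W0.poincare Ω p
  refine IceSheet.exists_tendsto_convexHull (fun u => ‖u.grad‖ ^ p.val)
    (fun x => by positivity) (fun a b => ?_) (fun ε hε => ?_) z (R ^ p.val) (fun k => ?_)
  · have hi := fun f : Lp Plane p.pE Ω.vol => integrable_Lp_norm_rpow p.pos p.pE_eq f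
    simp only [Lp_norm_rpow p.pos p.pE_eq]
    rw [← integral_add (hi _) (hi _), ← integral_add (hi _) (hi _), ← integral_div]
    refine integral_mono_ae ((hi _).add (hi _)) (((hi _).add (hi _)).div_const _) ?_
    have e1 : ((1 / 2 : ℝ) • (a + b)).grad = (1 / 2 : ℝ) • (a.grad + b.grad) := rfl
    have e2 : ((1 / 2 : ℝ) • (a - b)).grad = (1 / 2 : ℝ) • (a.grad - b.grad) := rfl
    rw [e1, e2]
    filter_upwards [Lp.coeFn_smul (1 / 2 : ℝ) (a.grad + b.grad), Lp.coeFn_add a.grad b.grad,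
      Lp.coeFn_smul (1 / 2 : ℝ) (a.grad - b.grad), Lp.coeFn_sub a.grad b.grad] with x h1 h2 h3 h4
    rw [h1, h3, Pi.smul_apply, Pi.smul_apply, h2, h4]
    exact norm_half_add_rpow p.two_lt.le _ _
  · have hC0 : 0 < C := by linarith
    refine ⟨(ε / C) ^ p.val, by positivity, fun x hx => ?_⟩
    have := (Real.rpow_lt_rpow_iff (norm_nonneg _) (by positivity) p.pos).1 hx
    rw [lt_div_iff₀ hC0] at this
    linarith [hP x]
  · exact Real.rpow_le_rpow (norm_nonneg _) ((W0.norm_grad_le _).trans (hR k)) p.pos.le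

/-- A bounded sequence of `W₀^{1,p}(Ω)` that converges in `L^p(Ω)` has its limit in
`W₀^{1,p}(Ω)`. -/
lemma W0.exists_limit (z : ℕ → W0 Ω p) (R : ℝ) (hR : ∀ k, ‖z k‖ ≤ R) (y : Lp ℝ p.pE Ω.vol)
    (hy : Tendsto (fun k => (z k).fn) atTop (𝓝 y)) :
    ∃ x : W0 Ω p, x.fn = y ∧ ‖x‖ ≤ R ∧
      ∀ (f : WDual Ω p) (c : ℝ), (∀ k, c ≤ f (z k)) → c ≤ f x := by
  obtain ⟨w, x, hw, hx⟩ := W0.exists_tendsto_convexHull z R hR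
  refine ⟨x, ?_, ?_, fun f c hc => ?_⟩
  · have h1 : Tendsto (fun n => W0.fnL (w n)) atTop (𝓝 (W0.fnL x)) :=
      (W0.fnL.continuous.tendsto x).comp hx
    have h2 : Tendsto (fun n => W0.fnL (w n)) atTop (𝓝 y) := by
      refine Metric.tendsto_atTop.2 fun ε hε => ?_
      obtain ⟨K, hK⟩ := Metric.tendsto_atTop.1 hy ε hε
      refine ⟨K, fun n hn => ?_⟩
      have hconv : Convex ℝ {v : W0 Ω p | W0.fnL v ∈ Metric.ball y ε} :=
        (convex_ball y ε).is_linear_preimage W0.fnL.isLinear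
      have hz : z '' Ici n ⊆ {v : W0 Ω p | W0.fnL v ∈ Metric.ball y ε} := by
        rintro _ ⟨k, hk, rfl⟩
        exact hK k (hn.trans hk)
      exact convexHull_min hz hconv (hw n)
    exact tendsto_nhds_unique h1 h2
  · have hsub : ∀ n, w n ∈ Metric.closedBall (0 : W0 Ω p) R := fun n => by
      refine convexHull_min ?_ (convex_closedBall 0 R) (hw n)
      rintro _ ⟨k, -, rfl⟩
      simpa using hR k
    simpa using Metric.isClosed_closedBall.mem_of_tendsto hx (Eventually.of_forall hsub)
  · have hsub : ∀ n, w n ∈ {v | c ≤ f v} := fun n => by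
      refine convexHull_min ?_ (convex_halfSpace_ge f.isLinear c) (hw n)
      rintro _ ⟨k, -, rfl⟩
      exact hc k
    exact ge_of_tendsto ((f.continuous.tendsto x).comp hx) (Eventually.of_forall hsub)

/-- Weak sequential compactness of bounded sequences of `W₀^{1,p}(Ω)` that converge in `L^p(Ω)`. -/
theorem W0.exists_weak_limit (z : ℕ → W0 Ω p) (R : ℝ) (hR : ∀ k, ‖z k‖ ≤ R)
    (y : Lp ℝ p.pE Ω.vol) (hy : Tendsto (fun k => (z k).fn) atTop (𝓝 y)) :
    ∃ x : W0 Ω p, x.fn = y ∧ ‖x‖ ≤ R ∧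
      ∀ f : WDual Ω p, Tendsto (fun k => f (z k)) atTop (𝓝 (f x)) := by
  obtain ⟨x, hx1, hx2, -⟩ := W0.exists_limit z R hR y hy
  refine ⟨x, hx1, hx2, ?_⟩
  have key : ∀ (f : WDual Ω p) (c : ℝ), f x < c → ∀ᶠ k in atTop, f (z k) < c := fun f c hc => by
    by_contra hcon
    obtain ⟨ns, hns, hns'⟩ := extraction_of_frequently_atTop (not_eventually.1 hcon)
    obtain ⟨x', h1, -, h3⟩ := W0.exists_limit (z ∘ ns) R (fun k => hR _) y
      (hy.comp hns.tendsto_atTop)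
    have := h3 f c fun k => not_lt.1 (hns' k)
    rw [W0.ext_fn (h1.trans hx1.symm)] at this
    exact absurd hc (not_lt.2 this)
  intro f
  refine tendsto_order.2 ⟨fun c hc => ?_, fun c hc => key f c hc⟩
  filter_upwards [key (-f) (-c) (by simpa using hc)] with k hk
  simpa using hk

/-! ### Elementary inequalities -/

lemma spow_of_nonneg {r x : ℝ} (hr : 0 < r) (hx : 0 ≤ x) : spow (r - 1) x = x ^ r := by
  rcases hx.eq_or_lt with rfl | h
  · simp [spow, Real.zero_rpow hr.ne']
  · rw [spow, abs_of_pos h, ← Real.rpow_add_one h.ne', sub_add_cancel]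

lemma spow_neg (s x : ℝ) : spow s (-x) = -spow s x := by simp [spow]

/-- Reduction of a symmetric and even relation between real numbers to nonnegative ones. -/
lemma sign_cases {P : ℝ → ℝ → Prop} (hsymm : ∀ x y, P x y → P y x)
    (hneg : ∀ x y, P x y → P (-x) (-y)) (h1 : ∀ x y, 0 ≤ y → y ≤ x → P x y)
    (h2 : ∀ x y, 0 ≤ x → 0 ≤ y → P x (-y)) (x y : ℝ) : P x y := by
  have h1' : ∀ x y, 0 ≤ x → 0 ≤ y → P x y := fun x y hx hy => by
    rcases le_total y x with h | h
    · exact h1 x y hy h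
    · exact hsymm _ _ (h1 y x hx h)
  rcases le_total 0 x with hx | hx <;> rcases le_total 0 y with hy | hy
  · exact h1' x y hx hy
  · simpa using h2 x (-y) hx (neg_nonneg.2 hy)
  · simpa using hsymm _ _ (h2 y (-x) hy (neg_nonneg.2 hx))
  · simpa using hneg _ _ (h1' (-x) (-y) (neg_nonneg.2 hx) (neg_nonneg.2 hy))

lemma add_rpow_le {r x y : ℝ} (hr : 0 < r) (hr1 : r ≤ 1) (hx : 0 ≤ x) (hy : 0 ≤ y) :
    (x + y) ^ r ≤ x ^ r + y ^ r := by
  have := NNReal.rpow_add_le_add_rpow ⟨x, hx⟩ ⟨y, hy⟩ hr.le hr1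
  exact_mod_cast this

lemma abs_spow_sub_le {r : ℝ} (hr : 0 < r) (hr1 : r ≤ 1) (x y : ℝ) :
    |spow (r - 1) x - spow (r - 1) y| ≤ 2 * |x - y| ^ r := by
  refine sign_cases (P := fun x y => |spow (r - 1) x - spow (r - 1) y| ≤ 2 * |x - y| ^ r)
    (fun x y h => ?_) (fun x y h => ?_) (fun x y hy hxy => ?_) (fun x y hx hy => ?_) x y
  · rwa [abs_sub_comm, abs_sub_comm y x]
  · rw [spow_neg, spow_neg, ← neg_sub', abs_neg, ← neg_sub', abs_neg]
    exact h
  · have hx := hy.trans hxy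
    rw [spow_of_nonneg hr hx, spow_of_nonneg hr hy,
      abs_of_nonneg (sub_nonneg.2 (Real.rpow_le_rpow hy hxy hr.le)),
      abs_of_nonneg (sub_nonneg.2 hxy)]
    have := add_rpow_le hr hr1 (sub_nonneg.2 hxy) hy
    rw [sub_add_cancel] at this
    linarith [Real.rpow_nonneg (sub_nonneg.2 hxy) r]
  · rw [spow_neg, spow_of_nonneg hr hx, spow_of_nonneg hr hy, sub_neg_eq_add, sub_neg_eq_add,
      abs_of_nonneg (by positivity), abs_of_nonneg (by positivity)]
    have h1 := Real.rpow_le_rpow hx (le_add_of_nonneg_right hy) hr.le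
    have h2 := Real.rpow_le_rpow hy (le_add_of_nonneg_left hx) hr.le
    linarith

lemma spow_injective {r : ℝ} (hr : 0 < r) : Function.Injective (spow (r - 1)) := by
  intro x y h
  have h1 : |x| = |y| := by
    have h2 := abs_spow hr x
    rw [h, abs_spow hr y] at h2
    exact ((Real.rpow_left_inj (abs_nonneg _) (abs_nonneg _) hr.ne').1 h2).symm
  rcases abs_eq_abs.1 h1 with h2 | h2
  · exact h2
  · rw [h2, spow_neg] at h
    have h3 : spow (r - 1) y = 0 := by linarith
    have h4 := abs_spow hr y
    rw [h3, abs_zero, eq_comm, Real.rpow_eq_zero (abs_nonneg _) hr.ne', abs_eq_zero] at h4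
    rw [h2, h4, neg_zero]

/-- `(x^{a/2} - y^{a/2})² ≤ C (x^{a-1} - y^{a-1}) (x - y)` for nonnegative numbers. -/
lemma rpow_half_sub_sq_le {a x y : ℝ} (h1 : 1 < a) (h2 : a ≤ 2) (hy : 0 ≤ y) (hxy : y ≤ x) :
    (x ^ (a / 2) - y ^ (a / 2)) ^ 2 ≤
      a / (2 * (a - 1)) * ((x ^ (a - 1) - y ^ (a - 1)) * (x - y)) := by
  have ha1 : 0 < a - 1 := by linarith
  rcases hy.eq_or_lt with rfl | hy0
  · rw [Real.zero_rpow (by linarith), Real.zero_rpow ha1.ne', sub_zero, sub_zero, sub_zero]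
    rcases hxy.eq_or_lt with rfl | hx
    · rw [Real.zero_rpow (by linarith)]; simp
    · rw [← Real.rpow_add_one hx.ne', ← Real.rpow_natCast, ← Real.rpow_mul hx.le]
      have e : a / 2 * ((2 : ℕ) : ℝ) = a - 1 + 1 := by push_cast; ring
      rw [e]
      refine le_mul_of_one_le_left (Real.rpow_nonneg hx.le _) ?_
      rw [one_le_div (by linarith)]
      linarith
  have hx0 : 0 < x := hy0.trans_le hxy
  set q := a / (2 * (a - 1))
  have hq : 1 ≤ q := by rw [one_le_div (by linarith)]; linarith
  set θ := y / x
  have hθ0 : 0 < θ := by positivity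
  have hθ1 : θ ≤ 1 := (div_le_one hx0).2 hxy
  have hyθ : y = x * θ := by simp only [θ]; field_simp
  have e1 : 1 - θ ^ (a / 2) ≤ 1 - θ := by
    have := Real.rpow_le_rpow_of_exponent_ge hθ0 hθ1 (show a / 2 ≤ 1 by linarith)
    rw [Real.rpow_one] at this
    linarith
  have e2 : 1 - θ ^ (a / 2) ≤ q * (1 - θ ^ (a - 1)) := by
    have ht : 0 ≤ θ ^ (a - 1) := by positivity
    have := one_add_mul_self_le_rpow_one_add (s := θ ^ (a - 1) - 1) (by linarith) hq
    rw [add_sub_cancel, ← Real.rpow_mul hθ0.le] at this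
    have e : (a - 1) * q = a / 2 := by
      simp only [q]; field_simp
    rw [e] at this
    linarith
  have e0 : 0 ≤ 1 - θ ^ (a / 2) := by
    have := Real.rpow_le_one hθ0.le hθ1 (show 0 ≤ a / 2 by linarith)
    linarith
  have e3 : (1 - θ ^ (a / 2)) ^ 2 ≤ q * ((1 - θ ^ (a - 1)) * (1 - θ)) := by
    nlinarith [mul_le_mul e1 e2 e0 (sub_nonneg.2 hθ1)]
  rw [hyθ, Real.mul_rpow hx0.le hθ0.le, Real.mul_rpow hx0.le hθ0.le]
  have hxx : (x ^ (a / 2)) ^ 2 = x ^ a := by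
    rw [← Real.rpow_natCast, ← Real.rpow_mul hx0.le]
    congr 1; push_cast; ring
  have hxy' : x ^ (a - 1) * x = x ^ a := by rw [← Real.rpow_add_one hx0.ne', sub_add_cancel]
  calc _ = (x ^ (a / 2)) ^ 2 * (1 - θ ^ (a / 2)) ^ 2 := by ring
    _ ≤ (x ^ (a / 2)) ^ 2 * (q * ((1 - θ ^ (a - 1)) * (1 - θ))) := by gcongr
    _ = (x ^ (a - 1) * x) * (q * ((1 - θ ^ (a - 1)) * (1 - θ))) := by rw [hxx, hxy']
    _ = _ := by ring

lemma spow_half_sub_sq_le {a : ℝ} (h1 : 1 < a) (h2 : a ≤ 2) (x y : ℝ) :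
    (spow ((a - 2) / 2) x - spow ((a - 2) / 2) y) ^ 2 ≤
      (a / (2 * (a - 1)) + 2) * ((spow (a - 2) x - spow (a - 2) y) * (x - y)) := by
  have e1 : (a - 2) / 2 = a / 2 - 1 := by ring
  have e2 : a - 2 = (a - 1) - 1 := by ring
  have ha : 0 < a / 2 := by linarith
  have ha1 : 0 < a - 1 := by linarith
  rw [e1, e2]
  have hq : 0 ≤ a / (2 * (a - 1)) := by positivity
  refine sign_cases (P := fun x y => (spow (a / 2 - 1) x - spow (a / 2 - 1) y) ^ 2 ≤
      (a / (2 * (a - 1)) + 2) * ((spow (a - 1 - 1) x - spow (a - 1 - 1) y) * (x - y)))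
    (fun x y h => ?_) (fun x y h => ?_) (fun x y hy hxy => ?_) (fun x y hx hy => ?_) x y
  · convert h using 1 <;> ring
  · simp only [spow_neg]
    convert h using 1 <;> ring
  · have hx := hy.trans hxy
    rw [spow_of_nonneg ha hx, spow_of_nonneg ha hy, spow_of_nonneg ha1 hx, spow_of_nonneg ha1 hy]
    refine (rpow_half_sub_sq_le h1 h2 hy hxy).trans ?_
    refine mul_le_mul_of_nonneg_right (by linarith) (mul_nonneg ?_ (by linarith))
    linarith [Real.rpow_le_rpow hy hxy ha1.le]
  · simp only [spow_neg]
    rw [spow_of_nonneg ha hx, spow_of_nonneg ha hy, spow_of_nonneg ha1 hx, spow_of_nonneg ha1 hy]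
    have hs : ∀ z : ℝ, 0 ≤ z → (z ^ (a / 2)) ^ 2 = z ^ (a - 1) * z := fun z hz => by
      rw [← Real.rpow_natCast, ← Real.rpow_mul hz, ← Real.rpow_add_one' hz (by linarith)]
      congr 1; push_cast; ring
    have hX := hs x hx
    have hY := hs y hy
    have b1 : 0 ≤ x ^ (a - 1) := by positivity
    have b2 : 0 ≤ y ^ (a - 1) := by positivity
    have b3 : 0 ≤ (x ^ (a - 1) + y ^ (a - 1)) * (x + y) := by positivity
    nlinarith [mul_nonneg b1 hy, mul_nonneg b2 hx, sq_nonneg (x ^ (a / 2) - y ^ (a / 2)),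
      mul_nonneg hq b3]

lemma spow_mul_self {a : ℝ} (h1 : 1 < a) (x : ℝ) : spow (a - 2) x * x = |x| ^ a := by
  rw [spow, mul_assoc, ← abs_mul_abs_self, ← mul_assoc,
    ← Real.rpow_add_one' (abs_nonneg _) (by linarith),
    ← Real.rpow_add_one' (abs_nonneg _) (by linarith)]
  congr 1; ring

/-- Young's inequality in the form used for power functions. -/
lemma rpow_sub_one_mul_le {a x y : ℝ} (h1 : 1 < a) (hx : 0 ≤ x) (hy : 0 ≤ y) :
    x ^ (a - 1) * y ≤ (a - 1) / a * x ^ a + 1 / a * y ^ a := by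
  have hc : (a / (a - 1)).HolderConjugate a := (Real.HolderConjugate.conjExponent h1).symm
  have := Real.young_inequality_of_nonneg (Real.rpow_nonneg hx (a - 1)) hy hc
  rw [← Real.rpow_mul hx] at this
  have ha1 : a - 1 ≠ 0 := by linarith
  have ha : a ≠ 0 := by linarith
  have e : (a - 1) * (a / (a - 1)) = a := by field_simp
  rw [e] at this
  refine this.trans (le_of_eq ?_)
  field_simp

lemma spow_sub_mul_ge {a : ℝ} (h1 : 1 < a) (x y : ℝ) :
    (a - 1) / a * (|x| ^ a - |y| ^ a) ≤ (spow (a - 2) x - spow (a - 2) y) * x := by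
  have h2 := rpow_sub_one_mul_le h1 (abs_nonneg y) (abs_nonneg x)
  have h3 : spow (a - 2) y * x ≤ |y| ^ (a - 1) * |x| := by
    refine (le_abs_self _).trans (le_of_eq ?_)
    rw [abs_mul, show a - 2 = (a - 1) - 1 by ring, abs_spow (by linarith)]
  rw [sub_mul, spow_mul_self h1]
  have e : (a - 1) / a = 1 - 1 / a := by field_simp
  rw [e] at h2 ⊢
  linarith

lemma rpow_sub_rpow_mul_le {s x y : ℝ} (hs : 0 < s) (hy : 0 ≤ y) (hyx : y ≤ x) :
    (x ^ s - y ^ s) * y ≤ s * x ^ s * (x - y) := by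
  have hx := hy.trans hyx
  have h := rpow_sub_one_mul_le (a := s + 1) (by linarith) hx hy
  rw [add_sub_cancel_right] at h
  have e1 : x ^ (s + 1) = x ^ s * x := Real.rpow_add_one' hx (by linarith)
  have e2 : y ^ (s + 1) = y ^ s * y := Real.rpow_add_one' hy (by linarith)
  rw [e1, e2] at h
  have h' : (s + 1) * (x ^ s * y) ≤ s * (x ^ s * x) + y ^ s * y := by
    calc _ ≤ (s + 1) * (s / (s + 1) * (x ^ s * x) + 1 / (s + 1) * (y ^ s * y)) := by gcongr
      _ = _ := by field_simp
  linarith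

section Vector

variable {E : Type*} [NormedAddCommGroup E] [InnerProductSpace ℝ E]

lemma norm_rpow_smul_sub_le {s : ℝ} (hs : 0 < s) (a b : E) :
    ‖‖a‖ ^ s • a - ‖b‖ ^ s • b‖ ≤ (1 + s) * (‖a‖ + ‖b‖) ^ s * ‖a - b‖ := by
  wlog h : ‖b‖ ≤ ‖a‖ generalizing a b
  · have := this b a (le_of_not_ge h)
    rwa [norm_sub_rev, add_comm ‖a‖, norm_sub_rev a]
  have e : ‖a‖ ^ s • a - ‖b‖ ^ s • b = ‖a‖ ^ s • (a - b) + (‖a‖ ^ s - ‖b‖ ^ s) • b := by module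
  have h0 : 0 ≤ ‖a‖ ^ s - ‖b‖ ^ s :=
    sub_nonneg.2 (Real.rpow_le_rpow (norm_nonneg _) h hs.le)
  have h1 := rpow_sub_rpow_mul_le hs (norm_nonneg b) h
  have h2 : ‖a‖ ^ s ≤ (‖a‖ + ‖b‖) ^ s :=
    Real.rpow_le_rpow (norm_nonneg _) (le_add_of_nonneg_right (norm_nonneg _)) hs.le
  calc _ ≤ ‖a‖ ^ s * ‖a - b‖ + (‖a‖ ^ s - ‖b‖ ^ s) * ‖b‖ := by
        rw [e]
        refine (norm_add_le _ _).trans (le_of_eq ?_)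
        rw [norm_smul, norm_smul, Real.norm_of_nonneg h0, Real.norm_of_nonneg (by positivity)]
    _ ≤ ‖a‖ ^ s * ‖a - b‖ + s * ‖a‖ ^ s * ‖a - b‖ := by
        refine add_le_add le_rfl ?_
        exact h1.trans (mul_le_mul_of_nonneg_left (norm_sub_norm_le a b) (by positivity))
    _ = (1 + s) * ‖a‖ ^ s * ‖a - b‖ := by ring
    _ ≤ _ := by gcongr

/-- Strong monotonicity of `ξ ↦ |ξ|^s ξ`. -/
lemma inner_rpow_smul_sub_ge {s : ℝ} (hs : 0 < s) (a b : E) :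
    (1 / 2) ^ (s + 1) * ‖a - b‖ ^ (s + 2) ≤ inner ℝ (‖a‖ ^ s • a - ‖b‖ ^ s • b) (a - b) := by
  set x := ‖a‖ ^ s
  set y := ‖b‖ ^ s
  have hx : 0 ≤ x := by positivity
  have hy : 0 ≤ y := by positivity
  have e1 : inner ℝ (x • a - y • b) (a - b) =
      1 / 2 * (x + y) * ‖a - b‖ ^ 2 + 1 / 2 * ((x - y) * (‖a‖ ^ 2 - ‖b‖ ^ 2)) := by
    rw [norm_sub_sq_real, inner_sub_left, inner_sub_right, inner_sub_right, real_inner_smul_left,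
      real_inner_smul_left, real_inner_smul_left, real_inner_smul_left,
      real_inner_self_eq_norm_sq, real_inner_self_eq_norm_sq, real_inner_comm a b]
    ring
  have h1 : 0 ≤ (x - y) * (‖a‖ ^ 2 - ‖b‖ ^ 2) := by
    rcases le_total ‖a‖ ‖b‖ with h | h
    · exact mul_nonneg_of_nonpos_of_nonpos
        (sub_nonpos.2 (Real.rpow_le_rpow (norm_nonneg _) h hs.le))
        (sub_nonpos.2 (pow_le_pow_left₀ (norm_nonneg _) h 2))
    · exact mul_nonneg (sub_nonneg.2 (Real.rpow_le_rpow (norm_nonneg _) h hs.le))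
        (sub_nonneg.2 (pow_le_pow_left₀ (norm_nonneg _) h 2))
  have h2 : (1 / 2) ^ s * ‖a - b‖ ^ s ≤ x + y := by
    rw [← Real.mul_rpow (by norm_num) (norm_nonneg _)]
    have h3 := norm_sub_le a b
    rcases le_total ‖a‖ ‖b‖ with h | h
    · have := Real.rpow_le_rpow (z := s) (by positivity)
        (show 1 / 2 * ‖a - b‖ ≤ ‖b‖ by linarith) hs.le
      linarith
    · have := Real.rpow_le_rpow (z := s) (by positivity)
        (show 1 / 2 * ‖a - b‖ ≤ ‖a‖ by linarith) hs.le
      linarith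
  have e2 : ‖a - b‖ ^ (s + 2) = ‖a - b‖ ^ s * ‖a - b‖ ^ 2 := by
    rw [Real.rpow_add' (norm_nonneg _) (by linarith)]
    norm_num
  rw [e1, e2, Real.rpow_add_one (by norm_num)]
  have := mul_le_mul_of_nonneg_right h2 (sq_nonneg ‖a - b‖)
  linarith

lemma inner_rpow_smul_sub_self_ge {q : ℝ} (hq : 2 < q) (a b : E) :
    1 / q * (‖a‖ ^ q - ‖b‖ ^ q) ≤ inner ℝ (‖a‖ ^ (q - 2) • a) (a - b) := by
  have h1 := rpow_sub_one_mul_le (a := q) (by linarith) (norm_nonneg a) (norm_nonneg b)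
  have h2 : inner ℝ (‖a‖ ^ (q - 2) • a) b ≤ ‖a‖ ^ (q - 1) * ‖b‖ := by
    refine (real_inner_le_norm _ _).trans (le_of_eq ?_)
    rw [norm_smul, Real.norm_of_nonneg (by positivity),
      ← Real.rpow_add_one' (norm_nonneg _) (by linarith)]
    congr 2; ring
  have h3 : inner ℝ (‖a‖ ^ (q - 2) • a) a = ‖a‖ ^ q := by
    rw [real_inner_smul_left, real_inner_self_eq_norm_sq, ← Real.rpow_natCast,
      ← Real.rpow_add' (norm_nonneg _) (by push_cast; linarith)]
    congr 1; push_cast; ring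
  rw [inner_sub_right, h3]
  have hq0 : q ≠ 0 := by linarith
  have e : (q - 1) / q = 1 - 1 / q := by field_simp
  rw [e] at h1
  linarith

end Vector

lemma negPart_mul_sub_ge (x y : ℝ) :
    1 / 2 * (max (-x) 0 ^ 2 - max (-y) 0 ^ 2) ≤ -(max (-x) 0 * (x - y)) := by
  rcases max_cases (-x) 0 with ⟨h1, h1'⟩ | ⟨h1, h1'⟩ <;>
  rcases max_cases (-y) 0 with ⟨h2, h2'⟩ | ⟨h2, h2'⟩ <;> rw [h1, h2] <;>
  nlinarith [sq_nonneg (x - y), sq_nonneg x, sq_nonneg y]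

/-! ### Continuity of the nonlinear terms -/

lemma halfPow_ae (u : W0 Ω p) :
    halfPow u =ᵐ[Ω.vol] fun x => spow ((p.alpha - 2) / 2) (u.fn x) :=
  MemLp.coeFn_toLp _

lemma fullPow_ae (u : W0 Ω p) :
    fullPow u =ᵐ[Ω.vol] fun x => spow (p.alpha - 2) (u.fn x) :=
  MemLp.coeFn_toLp _

/-- The embedding of `L^p(Ω)` in `L^α(Ω)`. -/
def inclAlpha (Ω : BddOpen) (p : GlenExp) : Lp ℝ p.pE Ω.vol →L[ℝ] Lp ℝ p.alphaE Ω.vol :=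
  inclL Ω p.alphaE_le_pE ENNReal.ofReal_ne_top

lemma norm_sub_le_of_spow {q r : ℝ} {s s' : ℝ≥0∞} (hr : 0 < r) (hr1 : r ≤ 1)
    (hs' : s' = ENNReal.ofReal q) (hs : s = ENNReal.ofReal (q / r))
    (f g : Lp ℝ s' Ω.vol) (F G : Lp ℝ s Ω.vol)
    (hF : F =ᵐ[Ω.vol] fun x => spow (r - 1) (f x))
    (hG : G =ᵐ[Ω.vol] fun x => spow (r - 1) (g x)) : ‖F - G‖ ≤ 2 * ‖f - g‖ ^ r := by
  subst hs hs'
  have h1 : eLpNorm (F - G : Lp ℝ (ENNReal.ofReal (q / r)) Ω.vol) (ENNReal.ofReal (q / r)) Ω.vol ≤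
      ENNReal.ofReal 2 * eLpNorm (f - g : Lp ℝ (ENNReal.ofReal q) Ω.vol) (ENNReal.ofReal q) Ω.vol ^ r := by
    have e1 := eLpNorm_norm_rpow (q := r) (p := ENNReal.ofReal (q / r)) (μ := Ω.vol)
      (f - g : Lp ℝ (ENNReal.ofReal q) Ω.vol) hr
    rw [← ENNReal.ofReal_mul' hr.le, div_mul_cancel₀ _ hr.ne'] at e1
    rw [← e1]
    refine eLpNorm_le_mul_eLpNorm_of_ae_le_mul ?_ _
    filter_upwards [hF, hG, Lp.coeFn_sub F G, Lp.coeFn_sub f g] with x a b c d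
    rw [c, Pi.sub_apply, a, b, d, Pi.sub_apply, Real.norm_eq_abs, Real.norm_eq_abs,
      Real.norm_eq_abs, abs_of_nonneg (a := |f x - g x| ^ r) (Real.rpow_nonneg (abs_nonneg _) _)]
    exact abs_spow_sub_le hr hr1 _ _
  rw [Lp.norm_def, Lp.norm_def]
  refine (ENNReal.toReal_mono ?_ h1).trans (le_of_eq ?_)
  · exact ENNReal.mul_ne_top ENNReal.ofReal_ne_top
      (ENNReal.rpow_ne_top_of_nonneg hr.le (Lp.eLpNorm_ne_top _))
  · rw [ENNReal.toReal_mul, ← ENNReal.toReal_rpow, ENNReal.toReal_ofReal (by norm_num)]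

lemma norm_halfPow_sub_le (u v : W0 Ω p) :
    ‖halfPow u - halfPow v‖ ≤ 2 * ‖inclAlpha Ω p (u.fn - v.fn)‖ ^ (p.alpha / 2) := by
  have h1 := p.one_lt_alpha
  have h2 := p.alpha_lt_two
  rw [map_sub]
  refine norm_sub_le_of_spow (q := p.alpha) (r := p.alpha / 2) (by linarith) (by linarith)
    rfl ?_ _ _ _ _ ?_ ?_
  · have : p.alpha / (p.alpha / 2) = 2 := by field_simp
    rw [this]
    norm_num
  · filter_upwards [halfPow_ae u, inclL_ae p.alphaE_le_pE ENNReal.ofReal_ne_top u.fn] with x a b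
    rw [a, inclAlpha, b]
    congr 1; ring
  · filter_upwards [halfPow_ae v, inclL_ae p.alphaE_le_pE ENNReal.ofReal_ne_top v.fn] with x a b
    rw [a, inclAlpha, b]
    congr 1; ring

lemma norm_fullPow_sub_le (u v : W0 Ω p) :
    ‖fullPow u - fullPow v‖ ≤ 2 * ‖inclAlpha Ω p (u.fn - v.fn)‖ ^ (p.alpha - 1) := by
  have h1 := p.one_lt_alpha
  have h2 := p.alpha_lt_two
  rw [map_sub]
  refine norm_sub_le_of_spow (q := p.alpha) (r := p.alpha - 1) (by linarith) (by linarith)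
    rfl rfl _ _ _ _ ?_ ?_
  · filter_upwards [fullPow_ae u, inclL_ae p.alphaE_le_pE ENNReal.ofReal_ne_top u.fn] with x a b
    rw [a, inclAlpha, b]
    congr 1; ring
  · filter_upwards [fullPow_ae v, inclL_ae p.alphaE_le_pE ENNReal.ofReal_ne_top v.fn] with x a b
    rw [a, inclAlpha, b]
    congr 1; ring

lemma tendsto_inclAlpha_rpow {ι : Type*} {l : Filter ι} {z : ι → W0 Ω p} {x : W0 Ω p} {r : ℝ}
    (hr : 0 < r) (h : Tendsto (fun i => (z i).fn) l (𝓝 x.fn)) :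
    Tendsto (fun i => 2 * ‖inclAlpha Ω p ((z i).fn - x.fn)‖ ^ r) l (𝓝 0) := by
  have h1 : Tendsto (fun i => ‖inclAlpha Ω p ((z i).fn - x.fn)‖) l (𝓝 0) := by
    have := ((inclAlpha Ω p).continuous.tendsto _).comp (h.sub_const x.fn)
    rw [sub_self, map_zero] at this
    simpa using this.norm
  have h2 := ((Real.continuousAt_rpow_const 0 r (Or.inr hr.le)).tendsto.comp h1).const_mul 2
  rwa [Real.zero_rpow hr.ne', mul_zero] at h2

lemma tendsto_halfPow {ι : Type*} {l : Filter ι} {z : ι → W0 Ω p} {x : W0 Ω p}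
    (h : Tendsto (fun i => (z i).fn) l (𝓝 x.fn)) :
    Tendsto (fun i => halfPow (z i)) l (𝓝 (halfPow x)) := by
  rw [tendsto_iff_norm_sub_tendsto_zero]
  refine squeeze_zero (fun _ => norm_nonneg _) (fun i => norm_halfPow_sub_le (z i) x)
    (tendsto_inclAlpha_rpow ?_ h)
  linarith [p.one_lt_alpha]

lemma tendsto_fullPow {ι : Type*} {l : Filter ι} {z : ι → W0 Ω p} {x : W0 Ω p}
    (h : Tendsto (fun i => (z i).fn) l (𝓝 x.fn)) :
    Tendsto (fun i => fullPow (z i)) l (𝓝 (fullPow x)) := by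
  rw [tendsto_iff_norm_sub_tendsto_zero]
  refine squeeze_zero (fun _ => norm_nonneg _) (fun i => norm_fullPow_sub_le (z i) x)
    (tendsto_inclAlpha_rpow ?_ h)
  linarith [p.one_lt_alpha]

lemma W0.tendsto_fn {ι : Type*} {l : Filter ι} {z : ι → W0 Ω p} {x : W0 Ω p}
    (h : Tendsto z l (𝓝 x)) : Tendsto (fun i => (z i).fn) l (𝓝 x.fn) :=
  (W0.fnL.continuous.tendsto x).comp h

lemma continuous_halfPow : Continuous (halfPow : W0 Ω p → _) :=
  continuous_iff_continuousAt.2 fun _ => tendsto_halfPow (W0.tendsto_fn tendsto_id)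

lemma continuous_fullPow : Continuous (fullPow : W0 Ω p → _) :=
  continuous_iff_continuousAt.2 fun _ => tendsto_fullPow (W0.tendsto_fn tendsto_id)

lemma halfPow_injective : Function.Injective (halfPow : W0 Ω p → _) := by
  intro u v h
  refine W0.ext_fn (Lp.ext ?_)
  have hv := halfPow_ae v
  rw [← h] at hv
  filter_upwards [halfPow_ae u, hv] with x a b
  rw [a] at b
  have e : (p.alpha - 2) / 2 = p.alpha / 2 - 1 := by ring
  rw [e] at b
  exact spow_injective (by linarith [p.one_lt_alpha]) b

/-- Compactness: a bounded sequence of `W₀^{1,p}(Ω)` whose half powers converge in `L²(Ω)`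
converges, strongly in `L^p(Ω)` and weakly in `W₀^{1,p}(Ω)`. -/
theorem W0.exists_limit_of_halfPow (z : ℕ → W0 Ω p) (R : ℝ) (hR : ∀ k, ‖z k‖ ≤ R)
    (V : Lp ℝ 2 Ω.vol) (hV : Tendsto (fun k => halfPow (z k)) atTop (𝓝 V)) :
    ∃ x : W0 Ω p, ‖x‖ ≤ R ∧ halfPow x = V ∧ Tendsto (fun k => (z k).fn) atTop (𝓝 x.fn) ∧
      ∀ f : WDual Ω p, Tendsto (fun k => f (z k)) atTop (𝓝 (f x)) := by
  obtain ⟨K, hK, hKmem⟩ := W0.exists_compact Ω p R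
  have key : ∀ ns : ℕ → ℕ, Tendsto ns atTop atTop → ∃ ms : ℕ → ℕ, ∃ x : W0 Ω p,
      ‖x‖ ≤ R ∧ halfPow x = V ∧ Tendsto (fun k => (z (ns (ms k))).fn) atTop (𝓝 x.fn) := by
    intro ns hns
    obtain ⟨y, -, ms, hms, hy⟩ := hK.tendsto_subseq (fun k => hKmem _ (hR (ns k)))
    obtain ⟨x, hx1, hx2, -⟩ := W0.exists_weak_limit (fun k => z (ns (ms k))) R (fun k => hR _) y hy
    have hy' : Tendsto (fun k => (z (ns (ms k))).fn) atTop (𝓝 x.fn) := by rw [hx1]; exact hy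
    exact ⟨ms, x, hx2, tendsto_nhds_unique (tendsto_halfPow hy')
      (hV.comp (hns.comp hms.tendsto_atTop)), hy'⟩
  obtain ⟨-, x, hx1, hx2, -⟩ := key id tendsto_id
  have hx3 : Tendsto (fun k => (z k).fn) atTop (𝓝 x.fn) := by
    refine tendsto_of_subseq_tendsto fun ns hns => ?_
    obtain ⟨ms, x', -, h2, h3⟩ := key ns hns
    rw [halfPow_injective (h2.trans hx2.symm)] at h3
    exact ⟨ms, h3⟩
  refine ⟨x, hx1, hx2, hx3, ?_⟩
  obtain ⟨x', h1, -, h3⟩ := W0.exists_weak_limit z R hR _ hx3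
  rwa [W0.ext_fn h1] at h3

/-! ### Inequalities for the power functions -/

lemma GlenExp.alphaConj_inv (p : GlenExp) : 1 / p.alphaConj = (p.alpha - 1) / p.alpha := by
  rw [GlenExp.alphaConj, one_div_div]

lemma norm_halfPow_sq (u : W0 Ω p) : ‖halfPow u‖ ^ 2 = ∫ x, |u.fn x| ^ p.alpha ∂Ω.vol := by
  rw [← real_inner_self_eq_norm_sq, L2.inner_def]
  refine integral_congr_ae ?_
  filter_upwards [halfPow_ae u] with x hx
  have h1 := p.one_lt_alpha
  rw [hx, real_inner_self_eq_norm_sq, Real.norm_eq_abs,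
    show (p.alpha - 2) / 2 = p.alpha / 2 - 1 by ring, abs_spow (by linarith),
    ← Real.rpow_natCast, ← Real.rpow_mul (abs_nonneg _)]
  congr 1; push_cast; ring

lemma integrable_abs_rpow_alpha (u : W0 Ω p) : Integrable (fun x => |u.fn x| ^ p.alpha) Ω.vol := by
  have h1 := p.one_lt_alpha
  have := u.memLp_alpha.integrable_norm_rpow (by simp [GlenExp.alphaE]; linarith)
    ENNReal.ofReal_ne_top
  rwa [GlenExp.alphaE, ENNReal.toReal_ofReal (by linarith)] at this

lemma integrable_fullPow_mul (u v : W0 Ω p) :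
    Integrable (fun x => fullPow u x * v.fn x) Ω.vol :=
  MemLp.integrable_mul (p := p.conjE) (q := p.pE)
    ((Lp.memLp (fullPow u)).mono_exponent p.conjE_le_alphaConjE) (Lp.memLp v.fn)

lemma alphaConjToDual_sub_apply (u v z : W0 Ω p) :
    (alphaConjToDual (fullPow u) - alphaConjToDual (fullPow v)) z =
      ∫ x, (spow (p.alpha - 2) (u.fn x) - spow (p.alpha - 2) (v.fn x)) * z.fn x ∂Ω.vol := by
  rw [sub_apply, alphaConjToDual_apply, alphaConjToDual_apply,
    ← integral_sub (integrable_fullPow_mul u z) (integrable_fullPow_mul v z)]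
  refine integral_congr_ae ?_
  filter_upwards [fullPow_ae u, fullPow_ae v] with x a b
  rw [a, b, sub_mul]

lemma integrable_spow_sub_mul (u v z : W0 Ω p) :
    Integrable (fun x => (spow (p.alpha - 2) (u.fn x) - spow (p.alpha - 2) (v.fn x)) * z.fn x)
      Ω.vol := by
  refine ((integrable_fullPow_mul u z).sub (integrable_fullPow_mul v z)).congr ?_
  filter_upwards [fullPow_ae u, fullPow_ae v] with x a b
  rw [Pi.sub_apply, a, b, sub_mul]

lemma alphaConjToDual_sub_apply_ge (u v : W0 Ω p) :
    1 / p.alphaConj * (‖halfPow u‖ ^ 2 - ‖halfPow v‖ ^ 2) ≤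
      (alphaConjToDual (fullPow u) - alphaConjToDual (fullPow v)) u := by
  rw [alphaConjToDual_sub_apply, norm_halfPow_sq, norm_halfPow_sq,
    ← integral_sub (integrable_abs_rpow_alpha u) (integrable_abs_rpow_alpha v),
    ← integral_const_mul, p.alphaConj_inv]
  exact integral_mono (((integrable_abs_rpow_alpha u).sub
    (integrable_abs_rpow_alpha v)).const_mul _) (integrable_spow_sub_mul u v u)
    fun x => spow_sub_mul_ge p.one_lt_alpha _ _

/-- The constant in `norm_halfPow_sub_sq_le`. -/
def GlenExp.monoConst (p : GlenExp) : ℝ := p.alpha / (2 * (p.alpha - 1)) + 2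

lemma GlenExp.monoConst_pos (p : GlenExp) : 0 < p.monoConst := by
  have h1 := p.one_lt_alpha
  have : 0 < p.alpha - 1 := by linarith
  unfold GlenExp.monoConst
  positivity

lemma norm_halfPow_sub_sq_le (u v : W0 Ω p) :
    ‖halfPow u - halfPow v‖ ^ 2 ≤
      p.monoConst * (alphaConjToDual (fullPow u) - alphaConjToDual (fullPow v)) (u - v) := by
  rw [alphaConjToDual_sub_apply, ← integral_const_mul, ← real_inner_self_eq_norm_sq,
    L2.inner_def]
  refine integral_mono_ae (L2.integrable_inner _ _)
    ((integrable_spow_sub_mul u v (u - v)).const_mul _) ?_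
  have e : (u - v).fn = u.fn - v.fn := rfl
  rw [e]
  filter_upwards [halfPow_ae u, halfPow_ae v, Lp.coeFn_sub (halfPow u) (halfPow v),
    Lp.coeFn_sub u.fn v.fn] with x a b c d
  rw [c, d, Pi.sub_apply, Pi.sub_apply, a, b, real_inner_self_eq_norm_sq, Real.norm_eq_abs, sq_abs]
  exact spow_half_sub_sq_le p.one_lt_alpha p.alpha_lt_two.le _ _

local instance : SeminormedAddCommGroup (WDual Ω p) := ContinuousLinearMap.toSeminormedAddCommGroup

local instance : NormedAddCommGroup (WDual Ω p) := ContinuousLinearMap.toNormedAddCommGroup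

local instance : NormedSpace ℝ (WDual Ω p) := ContinuousLinearMap.toNormedSpace

local instance : IsTopologicalAddGroup (WDual Ω p) := ContinuousLinearMap.topologicalAddGroup

lemma tendsto_dual_iff {X : Type*} [NormedAddCommGroup X] [NormedSpace ℝ X] {ι : Type*}
    {l : Filter ι} {f : ι → X →L[ℝ] ℝ} {g : X →L[ℝ] ℝ} :
    Tendsto f l (𝓝 g) ↔ Tendsto (fun i => ‖f i - g‖) l (𝓝 0) :=
  tendsto_iff_norm_sub_tendsto_zero

/-! ### The operator `B_κ` -/

/-- The flux `μ |∇u|^{p-2} ∇u`. -/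
def flux (μ : Coefficient Ω) (u : W0 Ω p) (x : Plane) : Plane :=
  (μ.toFun x * ‖u.grad x‖ ^ (p.val - 2)) • u.grad x

lemma memLp_flux' (μ : Coefficient Ω) (u : W0 Ω p) : MemLp (flux μ u) p.conjE Ω.vol :=
  memLp_flux μ u

/-- The principal part of `B_κ`. -/
def opA (μ : Coefficient Ω) (u : W0 Ω p) : WDual Ω p := negDiv (flux μ u) (memLp_flux' μ u)

/-- The function `{u}⁻` as an element of the dual. -/
def opN (u : W0 Ω p) : WDual Ω p := toDual (fun x => max (-(u.fn x)) 0) (memLp_negPart u)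

lemma opB_eq (μ : Coefficient Ω) (κ : ℝ) (u : W0 Ω p) : opB μ κ u = opA μ u - κ⁻¹ • opN u := rfl

lemma opN_apply (u v : W0 Ω p) : opN u v = ∫ x, max (-(u.fn x)) 0 * v.fn x ∂Ω.vol :=
  toDual_apply _ _ _

lemma opA_apply (μ : Coefficient Ω) (u v : W0 Ω p) :
    opA μ u v = ∫ x, inner ℝ (flux μ u x) (v.grad x) ∂Ω.vol := negDiv_apply _ _ _

lemma norm_opN_sub_le (Ω : BddOpen) (p : GlenExp) :
    ∃ C : ℝ, 0 ≤ C ∧ ∀ u v : W0 Ω p, ‖opN u - opN v‖ ≤ C * ‖u.fn - v.fn‖ := by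
  set I := inclL Ω p.conjE_le_pE ENNReal.ofReal_ne_top
  refine ⟨‖toDualL Ω p‖ * ‖I‖, by positivity, fun u v => ?_⟩
  rw [opN, opN, toDual_eq, toDual_eq, ← map_sub, mul_assoc]
  refine (ContinuousLinearMap.le_opNorm _ _).trans
    (mul_le_mul_of_nonneg_left ?_ (norm_nonneg _))
  refine le_trans ?_ (ContinuousLinearMap.le_opNorm _ _)
  refine Lp.norm_le_norm_of_ae_le ?_
  rw [← MemLp.toLp_sub]
  filter_upwards [MemLp.coeFn_toLp ((memLp_negPart u).sub (memLp_negPart v)),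
    inclL_ae p.conjE_le_pE ENNReal.ofReal_ne_top (u.fn - v.fn), Lp.coeFn_sub u.fn v.fn]
    with x a b c
  rw [a, b, c, Pi.sub_apply, Pi.sub_apply, Real.norm_eq_abs, Real.norm_eq_abs]
  refine (abs_max_sub_max_le_abs _ _ _).trans (le_of_eq ?_)
  rw [← neg_sub', abs_neg]

instance holderTripleFlux : ENNReal.HolderTriple (ENNReal.ofReal (p.val / (p.val - 2))) p.pE
    p.conjE := by
  refine Real.HolderTriple.ennrealOfReal ⟨?_, ?_, p.pos⟩
  · have h := p.two_lt
    rw [GlenExp.conj, inv_div, inv_div]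
    field_simp
    ring
  · exact div_pos p.pos (by linarith [p.two_lt])

lemma eLpNorm_add_norm_rpow_le (f g : Lp Plane p.pE Ω.vol) :
    eLpNorm (fun x => (‖f x‖ + ‖g x‖) ^ (p.val - 2)) (ENNReal.ofReal (p.val / (p.val - 2))) Ω.vol
      ≤ ENNReal.ofReal ((‖f‖ + ‖g‖) ^ (p.val - 2)) := by
  have hp : 0 < p.val - 2 := by linarith [p.two_lt]
  have e1 := eLpNorm_norm_rpow (q := p.val - 2) (p := ENNReal.ofReal (p.val / (p.val - 2)))
    (μ := Ω.vol) (fun x => ‖f x‖ + ‖g x‖) hp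
  rw [← ENNReal.ofReal_mul' hp.le, div_mul_cancel₀ _ hp.ne'] at e1
  have e2 : (fun x => ‖‖f x‖ + ‖g x‖‖ ^ (p.val - 2)) =
      fun x => (‖f x‖ + ‖g x‖) ^ (p.val - 2) := by
    funext x
    rw [Real.norm_of_nonneg (by positivity)]
  rw [e2] at e1
  rw [e1, ← ENNReal.ofReal_rpow_of_nonneg (by positivity) hp.le]
  refine ENNReal.rpow_le_rpow ?_ hp.le
  have h1 : AEStronglyMeasurable (fun x => ‖f x‖) Ω.vol := (Lp.aestronglyMeasurable f).norm
  have h2 : AEStronglyMeasurable (fun x => ‖g x‖) Ω.vol := (Lp.aestronglyMeasurable g).norm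
  refine (eLpNorm_add_le h1 h2 (Fact.out : 1 ≤ p.pE)).trans (le_of_eq ?_)
  rw [eLpNorm_norm, eLpNorm_norm, ENNReal.ofReal_add (norm_nonneg _) (norm_nonneg _),
    ← Lp.enorm_def, ← Lp.enorm_def, ofReal_norm, ofReal_norm]

lemma norm_opA_sub_le (μ : Coefficient Ω) (p : GlenExp) :
    ∃ C : ℝ, 0 ≤ C ∧ ∀ u v : W0 Ω p,
      ‖opA μ u - opA μ v‖ ≤ C * ((‖u‖ + ‖v‖) ^ (p.val - 2) * ‖u - v‖) := by
  obtain ⟨μ₁, μ₂, h1, h2, hb⟩ := μ.bounds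
  have hp : 0 < p.val - 2 := by linarith [p.two_lt]
  refine ⟨‖negDivL Ω p‖ * (μ₂ * (1 + (p.val - 2))), by positivity, fun u v => ?_⟩
  rw [opA, opA, negDiv_eq, negDiv_eq, ← map_sub, mul_assoc]
  refine (ContinuousLinearMap.le_opNorm _ _).trans
    (mul_le_mul_of_nonneg_left ?_ (norm_nonneg _))
  have hX : 0 ≤ (‖u.grad‖ + ‖v.grad‖) ^ (p.val - 2) := by positivity
  have key : ‖(memLp_flux' μ u).toLp (flux μ u) - (memLp_flux' μ v).toLp (flux μ v)‖ ≤
      μ₂ * (1 + (p.val - 2)) * ((‖u.grad‖ + ‖v.grad‖) ^ (p.val - 2) * ‖u.grad - v.grad‖) := by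
    rw [← MemLp.toLp_sub, Lp.norm_toLp]
    refine ENNReal.toReal_le_of_le_ofReal (by positivity) ?_
    have s1 : eLpNorm (flux μ u - flux μ v) p.conjE Ω.vol ≤
        ENNReal.ofReal (μ₂ * (1 + (p.val - 2))) *
          eLpNorm ((fun x => (‖u.grad x‖ + ‖v.grad x‖) ^ (p.val - 2)) •
            ((u.grad - v.grad : Lp Plane p.pE Ω.vol) : Plane → Plane)) p.conjE Ω.vol := by
      refine eLpNorm_le_mul_eLpNorm_of_ae_le_mul ?_ _
      filter_upwards [Ω.ae_mem, Lp.coeFn_sub u.grad v.grad] with x hx hsub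
      obtain ⟨hl, hu⟩ := hb x (subset_closure hx)
      have hμ : 0 ≤ μ.toFun x := h1.le.trans hl
      rw [Pi.sub_apply, Pi.smul_apply', hsub, Pi.sub_apply, flux, flux, mul_smul, mul_smul,
        ← smul_sub, norm_smul, norm_smul, Real.norm_of_nonneg hμ,
        Real.norm_of_nonneg (Real.rpow_nonneg (by positivity) _)]
      calc _ ≤ μ₂ * ((1 + (p.val - 2)) * (‖u.grad x‖ + ‖v.grad x‖) ^ (p.val - 2) *
            ‖u.grad x - v.grad x‖) := by
            gcongr
            exact norm_rpow_smul_sub_le hp _ _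
        _ = _ := by ring
    refine s1.trans ?_
    have hY : 0 ≤ μ₂ * (1 + (p.val - 2)) := by positivity
    rw [ENNReal.ofReal_mul (p := μ₂ * (1 + (p.val - 2))) hY, ENNReal.ofReal_mul hX]
    refine mul_le_mul_right ?_ _
    have hm : AEStronglyMeasurable (fun x => (‖u.grad x‖ + ‖v.grad x‖) ^ (p.val - 2)) Ω.vol :=
      (((Lp.aestronglyMeasurable u.grad).norm.aemeasurable.add
        (Lp.aestronglyMeasurable v.grad).norm.aemeasurable).pow_const _).aestronglyMeasurable
    refine (eLpNorm_smul_le_mul_eLpNorm (p := ENNReal.ofReal (p.val / (p.val - 2))) (q := p.pE)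
      (Lp.aestronglyMeasurable _) hm).trans ?_
    refine mul_le_mul' (eLpNorm_add_norm_rpow_le _ _) (le_of_eq ?_)
    rw [← Lp.enorm_def, ofReal_norm]
  refine key.trans ?_
  have g1 : ‖u.grad - v.grad‖ ≤ ‖u - v‖ := W0.norm_grad_le (u - v)
  have g2 := u.norm_grad_le
  have g3 := v.norm_grad_le
  gcongr

lemma continuous_opA (μ : Coefficient Ω) : Continuous (opA μ : W0 Ω p → _) := by
  obtain ⟨C, hC, h⟩ := norm_opA_sub_le μ p
  refine continuous_iff_continuousAt.2 fun v => ?_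
  refine tendsto_dual_iff.2 (squeeze_zero (fun _ => norm_nonneg _) (fun u => h u v) ?_)
  have hc : Continuous fun u : W0 Ω p => C * ((‖u‖ + ‖v‖) ^ (p.val - 2) * ‖u - v‖) := by
    refine continuous_const.mul (Continuous.mul ?_ (by fun_prop))
    exact (by fun_prop : Continuous fun u : W0 Ω p => ‖u‖ + ‖v‖).rpow_const
      fun _ => Or.inr (by linarith [p.two_lt])
  have := hc.tendsto v
  simpa using this

lemma tendsto_opN {ι : Type*} {l : Filter ι} {z : ι → W0 Ω p} {x : W0 Ω p}
    (h : Tendsto (fun i => (z i).fn) l (𝓝 x.fn)) : Tendsto (fun i => opN (z i)) l (𝓝 (opN x)) := by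
  obtain ⟨C, hC, hb⟩ := norm_opN_sub_le Ω p
  rw [tendsto_iff_norm_sub_tendsto_zero] at h
  refine tendsto_dual_iff.2 (squeeze_zero (fun _ => norm_nonneg _) (fun i => hb (z i) x) ?_)
  simpa using h.const_mul C

lemma continuous_opB (μ : Coefficient Ω) (κ : ℝ) : Continuous (opB μ κ : W0 Ω p → _) := by
  have h : Continuous (opN : W0 Ω p → _) :=
    continuous_iff_continuousAt.2 fun _ => tendsto_opN (W0.tendsto_fn tendsto_id)
  exact (continuous_opA μ).sub (h.const_smul κ⁻¹)

lemma exists_norm_opA_le (μ : Coefficient Ω) (p : GlenExp) (R : ℝ) :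
    ∃ M : ℝ, ∀ u : W0 Ω p, ‖u‖ ≤ R → ‖opA μ u‖ ≤ M := by
  obtain ⟨C, hC, h⟩ := norm_opA_sub_le μ p
  refine ⟨‖opA μ (0 : W0 Ω p)‖ + C * (R ^ (p.val - 2) * R), fun u hu => ?_⟩
  have h1 := h u 0
  rw [norm_zero, add_zero, sub_zero] at h1
  have h2 := norm_le_norm_add_norm_sub' (opA μ u) (opA μ (0 : W0 Ω p))
  have h3 : ‖u‖ ^ (p.val - 2) * ‖u‖ ≤ R ^ (p.val - 2) * R := by
    have hR : 0 ≤ R := (norm_nonneg _).trans hu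
    have := Real.rpow_le_rpow (norm_nonneg _) hu (show 0 ≤ p.val - 2 by linarith [p.two_lt])
    gcongr
  have := mul_le_mul_of_nonneg_left h3 hC
  linarith

lemma exists_norm_opN_le (Ω : BddOpen) (p : GlenExp) (R : ℝ) :
    ∃ M : ℝ, ∀ u : W0 Ω p, ‖u‖ ≤ R → ‖opN u‖ ≤ M := by
  obtain ⟨C, hC, h⟩ := norm_opN_sub_le Ω p
  refine ⟨‖opN (0 : W0 Ω p)‖ + C * R, fun u hu => ?_⟩
  have h1 := h u 0
  have h0 : (0 : W0 Ω p).fn = 0 := rfl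
  rw [h0, sub_zero] at h1
  have h2 := norm_le_norm_add_norm_sub' (opN u) (opN (0 : W0 Ω p))
  have := mul_le_mul_of_nonneg_left (u.norm_fn_le.trans hu) hC
  linarith

lemma exists_norm_opB_le (μ : Coefficient Ω) (p : GlenExp) (κ R : ℝ) :
    ∃ M : ℝ, ∀ u : W0 Ω p, ‖u‖ ≤ R → ‖opB μ κ u‖ ≤ M := by
  obtain ⟨M₁, h1⟩ := exists_norm_opA_le μ p R
  obtain ⟨M₂, h2⟩ := exists_norm_opN_le Ω p R
  refine ⟨M₁ + |κ⁻¹| * M₂, fun u hu => ?_⟩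
  rw [opB_eq]
  have e1 := norm_sub_le (opA μ u) (κ⁻¹ • opN u)
  have e2 := norm_smul κ⁻¹ (opN u)
  rw [Real.norm_eq_abs] at e2
  have e3 := mul_le_mul_of_nonneg_left (h2 u hu) (abs_nonneg κ⁻¹)
  have e4 := h1 u hu
  linarith

lemma integrable_inner_flux (μ : Coefficient Ω) (u v : W0 Ω p) :
    Integrable (fun x => inner ℝ (flux μ u x) (v.grad x)) Ω.vol := by
  refine (MemLp.integrable_mul (p := p.conjE) (q := p.pE) (memLp_flux' μ u).norm
    (Lp.memLp v.grad).norm).mono'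
    ((memLp_flux' μ u).1.inner (Lp.aestronglyMeasurable v.grad)) (Eventually.of_forall fun x => ?_)
  exact norm_inner_le_norm _ _

/-- Strong monotonicity of the principal part. -/
lemma exists_opA_mono (μ : Coefficient Ω) (p : GlenExp) : ∃ c : ℝ, 0 < c ∧ ∀ u v : W0 Ω p,
    c * ‖u - v‖ ^ p.val ≤ (opA μ u - opA μ v) (u - v) := by
  obtain ⟨μ₁, μ₂, h1, h2, hb⟩ := μ.bounds
  obtain ⟨C, hC, hP⟩ := W0.poincare Ω p
  have hp : 0 < p.val - 2 := by linarith [p.two_lt]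
  have hC0 : 0 < C := by linarith
  refine ⟨μ₁ * (1 / 2) ^ (p.val - 2 + 1) * (1 / C) ^ p.val, by positivity, fun u v => ?_⟩
  have e : (u - v).grad = u.grad - v.grad := rfl
  have h3 : (1 / C) ^ p.val * ‖u - v‖ ^ p.val ≤ ‖(u - v).grad‖ ^ p.val := by
    rw [← Real.mul_rpow (by positivity) (norm_nonneg _)]
    refine Real.rpow_le_rpow (by positivity) ?_ p.pos.le
    rw [one_div, inv_mul_le_iff₀ hC0]
    exact hP _
  rw [mul_assoc]
  refine (mul_le_mul_of_nonneg_left h3 (by positivity)).trans ?_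
  rw [sub_apply, opA_apply, opA_apply,
    ← integral_sub (integrable_inner_flux μ u _) (integrable_inner_flux μ v _),
    Lp_norm_rpow p.pos p.pE_eq, ← integral_const_mul]
  refine integral_mono_ae ((integrable_Lp_norm_rpow p.pos p.pE_eq _).const_mul _)
    ((integrable_inner_flux μ u _).sub (integrable_inner_flux μ v _)) ?_
  rw [e]
  filter_upwards [Ω.ae_mem, Lp.coeFn_sub u.grad v.grad] with x hx hsub
  obtain ⟨hl, hu⟩ := hb x (subset_closure hx)
  have h4 := inner_rpow_smul_sub_ge hp (u.grad x) (v.grad x)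
  rw [sub_add_cancel] at h4
  rw [hsub, Pi.sub_apply, ← inner_sub_left, flux, flux, mul_smul, mul_smul,
    ← smul_sub, real_inner_smul_left, mul_assoc]
  exact (mul_le_mul_of_nonneg_left h4 h1.le).trans
    (mul_le_mul_of_nonneg_right hl (le_trans (by positivity) h4))

/-! ### The energy -/

/-- The energy, of which `B_κ` is the gradient. -/
def energy (μ : Coefficient Ω) (κ : ℝ) (u : W0 Ω p) : ℝ :=
  ∫ x, μ.toFun x * (1 / p.val * ‖u.grad x‖ ^ p.val) ∂Ω.vol
    + κ⁻¹ * ∫ x, 1 / 2 * max (-(u.fn x)) 0 ^ 2 ∂Ω.vol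

lemma integrable_energy_grad (μ : Coefficient Ω) (u : W0 Ω p) :
    Integrable (fun x => μ.toFun x * (1 / p.val * ‖u.grad x‖ ^ p.val)) Ω.vol := by
  obtain ⟨μ₁, μ₂, h1, h2, hb⟩ := μ.bounds
  refine ((integrable_Lp_norm_rpow p.pos p.pE_eq u.grad).const_mul _).bdd_mul
    μ.aestronglyMeasurable (c := μ₂) ?_
  filter_upwards [Ω.ae_mem] with x hx
  obtain ⟨hl, hu⟩ := hb x (subset_closure hx)
  rwa [Real.norm_of_nonneg (h1.le.trans hl)]

lemma integrable_energy_neg (u : W0 Ω p) :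
    Integrable (fun x => 1 / 2 * max (-(u.fn x)) 0 ^ 2) Ω.vol := by
  have h : MemLp (fun x => u.fn x) 2 Ω.vol := by
    refine (Lp.memLp u.fn).mono_exponent ?_
    rw [GlenExp.pE, show (2 : ℝ≥0∞) = ENNReal.ofReal 2 by norm_num]
    exact ENNReal.ofReal_le_ofReal p.two_lt.le
  have h' : MemLp (fun x => max (-(u.fn x)) 0) 2 Ω.vol :=
    h.of_le (memLp_negPart u).1 (Eventually.of_forall fun x => by
      rw [Real.norm_eq_abs, Real.norm_eq_abs, abs_of_nonneg (le_max_right _ _)]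
      exact max_le (neg_le_abs _) (abs_nonneg _))
  exact h'.integrable_sq.const_mul _

lemma energy_nonneg_aux (μ : Coefficient Ω) (p : GlenExp) {κ : ℝ} (hκ : 0 < κ) :
    ∃ c : ℝ, 0 < c ∧ ∀ u : W0 Ω p, c * ‖u‖ ^ p.val ≤ energy μ κ u := by
  obtain ⟨μ₁, μ₂, h1, h2, hb⟩ := μ.bounds
  obtain ⟨C, hC, hP⟩ := W0.poincare Ω p
  have hC0 : 0 < C := by linarith
  have hp := p.pos
  refine ⟨μ₁ * (1 / p.val) * (1 / C) ^ p.val, by positivity, fun u => ?_⟩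
  have h3 : (1 / C) ^ p.val * ‖u‖ ^ p.val ≤ ‖u.grad‖ ^ p.val := by
    rw [← Real.mul_rpow (by positivity) (norm_nonneg _)]
    refine Real.rpow_le_rpow (by positivity) ?_ p.pos.le
    rw [one_div, inv_mul_le_iff₀ hC0]
    exact hP _
  rw [mul_assoc]
  refine (mul_le_mul_of_nonneg_left h3 (by positivity)).trans ?_
  refine le_add_of_le_of_nonneg ?_ (mul_nonneg (by positivity)
    (integral_nonneg fun x => by positivity))
  rw [Lp_norm_rpow p.pos p.pE_eq, ← integral_const_mul]
  refine integral_mono_ae ((integrable_Lp_norm_rpow p.pos p.pE_eq _).const_mul _)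
    (integrable_energy_grad μ u) ?_
  filter_upwards [Ω.ae_mem] with x hx
  obtain ⟨hl, hu⟩ := hb x (subset_closure hx)
  rw [mul_assoc]
  gcongr

lemma integrable_negPart_mul (u v : W0 Ω p) :
    Integrable (fun x => max (-(u.fn x)) 0 * v.fn x) Ω.vol :=
  MemLp.integrable_mul (p := p.conjE) (q := p.pE) (memLp_negPart u) (Lp.memLp v.fn)

/-- Convexity of the energy. -/
lemma energy_sub_le (μ : Coefficient Ω) {κ : ℝ} (hκ : 0 < κ) (u v : W0 Ω p) :
    energy μ κ u - energy μ κ v ≤ opB μ κ u (u - v) := by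
  obtain ⟨μ₁, μ₂, h1, h2, hb⟩ := μ.bounds
  have e1 : (u - v).grad = u.grad - v.grad := rfl
  have e2 : (u - v).fn = u.fn - v.fn := rfl
  have hA : ∫ x, μ.toFun x * (1 / p.val * ‖u.grad x‖ ^ p.val) ∂Ω.vol
      - ∫ x, μ.toFun x * (1 / p.val * ‖v.grad x‖ ^ p.val) ∂Ω.vol ≤ opA μ u (u - v) := by
    rw [opA_apply, ← integral_sub (integrable_energy_grad μ u) (integrable_energy_grad μ v)]
    refine integral_mono_ae ((integrable_energy_grad μ u).sub (integrable_energy_grad μ v))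
      (integrable_inner_flux μ u _) ?_
    rw [e1]
    filter_upwards [Ω.ae_mem, Lp.coeFn_sub u.grad v.grad] with x hx hsub
    obtain ⟨hl, hu⟩ := hb x (subset_closure hx)
    rw [hsub, Pi.sub_apply, flux, mul_smul, real_inner_smul_left, ← mul_sub, ← mul_sub]
    exact mul_le_mul_of_nonneg_left (inner_rpow_smul_sub_self_ge p.two_lt _ _) (h1.le.trans hl)
  have hN : ∫ x, 1 / 2 * max (-(u.fn x)) 0 ^ 2 ∂Ω.vol
      - ∫ x, 1 / 2 * max (-(v.fn x)) 0 ^ 2 ∂Ω.vol ≤ -opN u (u - v) := by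
    rw [opN_apply, ← integral_neg,
      ← integral_sub (integrable_energy_neg u) (integrable_energy_neg v)]
    refine integral_mono_ae ((integrable_energy_neg u).sub (integrable_energy_neg v))
      (integrable_negPart_mul u _).neg ?_
    rw [e2]
    filter_upwards [Lp.coeFn_sub u.fn v.fn] with x hsub
    rw [hsub, Pi.sub_apply, ← mul_sub]
    exact negPart_mul_sub_ge _ _
  have := mul_le_mul_of_nonneg_left hN (inv_pos.2 hκ).le
  rw [opB_eq, sub_apply, smul_apply, smul_eq_mul, energy, energy]
  linarith

/-! ### Functions of time with values in a Banach space -/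

section TimeGeneral

variable {X : Type*} [NormedAddCommGroup X] [NormedSpace ℝ X] {T : ℝ}

instance (T : ℝ) : IsFiniteMeasure (timeVol T) := by
  unfold timeVol
  infer_instance

lemma ae_timeVol_mem (T : ℝ) : ∀ᵐ t ∂timeVol T, t ∈ Ioo 0 T := ae_restrict_mem measurableSet_Ioo

lemma stronglyMeasurable_comp_ceil {V : Type*} [TopologicalSpace V] (l : ℝ) (v : ℕ → V) :
    StronglyMeasurable fun t : ℝ => v ⌈t / l⌉₊ :=
  (StronglyMeasurable.of_discrete (f := v)).comp_measurable
    (Nat.measurable_ceil.comp (measurable_id.div_const l))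

lemma stronglyMeasurable_interp {V : Type*} [TopologicalSpace V] (l : ℝ) (v : ℕ → V) :
    StronglyMeasurable (interp l v) :=
  stronglyMeasurable_comp_ceil l v

lemma stronglyMeasurable_diffQuot (l : ℝ) (v : ℕ → X) : StronglyMeasurable (diffQuot l v) :=
  stronglyMeasurable_comp_ceil l fun n => l⁻¹ • (v n - v (n - 1))

lemma ceil_le_of_mem {N : ℕ} (hT : 0 < T) (hN : 1 ≤ N) {t : ℝ} (ht : t ≤ T) :
    ⌈t / (T / N)⌉₊ ≤ N := by
  have hN' : (0 : ℝ) < N := by exact_mod_cast hN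
  rw [Nat.ceil_le, div_le_iff₀ (by positivity), mul_div_cancel₀ _ hN'.ne']
  exact ht

lemma ceil_pos_of_mem {N : ℕ} (hT : 0 < T) (hN : 1 ≤ N) {t : ℝ} (ht : 0 < t) :
    0 < ⌈t / (T / N)⌉₊ := by
  have hN' : (0 : ℝ) < N := by exact_mod_cast hN
  rw [Nat.ceil_pos]
  positivity

/-- Bounded sequences that converge weakly at almost every time converge weakly-star. -/
lemma weakTendsto_of_ae_tendsto {X Y : Type*} [NormedAddCommGroup X] [NormedSpace ℝ X]
    [NormedAddCommGroup Y] [NormedSpace ℝ Y] {B : Y → X → ℝ} {C R : ℝ}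
    (hBc : Continuous fun q : Y × X => B q.1 q.2) (hB : ∀ y x, |B y x| ≤ C * ‖y‖ * ‖x‖)
    {U : ℕ → ℝ → X} {u : ℝ → X} (hC : 0 ≤ C)
    (hU : ∀ k, AEStronglyMeasurable (U k) (timeVol T)) (hu : AEStronglyMeasurable u (timeVol T))
    (hUR : ∀ k, ∀ᵐ t ∂timeVol T, ‖U k t‖ ≤ R) (huR : ∀ᵐ t ∂timeVol T, ‖u t‖ ≤ R)
    (h : ∀ᵐ t ∂timeVol T, ∀ y, Tendsto (fun k => B y (U k t)) atTop (𝓝 (B y (u t)))) :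
    WeakTendsto ⊤ 1 T B U u := by
  refine ⟨fun k => memLp_top_of_bound (hU k) R (hUR k), memLp_top_of_bound hu R huR,
    fun f hf => ?_⟩
  refine tendsto_integral_of_dominated_convergence (fun t => C * ‖f t‖ * R) (fun k => ?_) ?_
    (fun k => ?_) ?_
  · exact hBc.comp_aestronglyMeasurable (hf.1.prodMk (hU k))
  · exact ((hf.integrable le_rfl).norm.const_mul C).mul_const R
  · filter_upwards [hUR k] with t ht
    rw [Real.norm_eq_abs]
    exact (hB _ _).trans (mul_le_mul_of_nonneg_left ht (by positivity))
  · filter_upwards [h] with t ht using ht _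

/-! ### Primitives and weak derivatives -/

lemma intervalIntegrable_of_timeVol {X : Type*} [NormedAddCommGroup X] {b : ℝ → X}
    (hb : Integrable b (timeVol T)) {s t : ℝ}
    (hs : s ∈ Icc 0 T) (ht : t ∈ Icc 0 T) : IntervalIntegrable b volume s t := by
  have hb' : IntegrableOn b (Icc 0 T) := (integrableOn_Icc_iff_integrableOn_Ioo (by simp)
    (by simp)).2 hb
  exact (hb'.mono_set (uIcc_subset_Icc hs ht)).intervalIntegrable

lemma intervalIntegral_eq_timeVol (b : ℝ → X) (hT : 0 ≤ T) :
    ∫ t in (0:ℝ)..T, b t = ∫ t, b t ∂timeVol T := by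
  rw [intervalIntegral.integral_of_le hT, integral_Ioc_eq_integral_Ioo]
  rfl

lemma integral_timeVol_indicator (b : ℝ → X) {t : ℝ} (ht : t ∈ Ioo 0 T) :
    ∫ s, (Iic t).indicator b s ∂timeVol T = ∫ s in (0:ℝ)..t, b s := by
  rw [timeVol, setIntegral_indicator measurableSet_Iic, intervalIntegral.integral_of_le ht.1.le]
  congr 2
  ext s
  simp only [mem_inter_iff, mem_Ioo, mem_Iic, mem_Ioc]
  exact ⟨fun h => ⟨h.1.1, h.2⟩, fun h => ⟨⟨h.1, h.2.trans_lt ht.2⟩, h.2⟩⟩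

lemma integral_deriv_test {ψ : ℝ → ℝ} (hψ : ContDiff ℝ ∞ ψ) (hsub : tsupport ψ ⊆ Ioo 0 T)
    (s : ℝ) : ∫ t in s..T, deriv ψ t = -ψ s := by
  have hψ1 : ContDiff ℝ 1 ψ := hψ.of_le (by exact_mod_cast le_top)
  rw [intervalIntegral.integral_deriv_eq_sub
    (fun x _ => (hψ1.differentiable one_ne_zero) x)
    ((hψ1.continuous_deriv le_rfl).intervalIntegrable _ _)]
  have : ψ T = 0 := image_eq_zero_of_notMem_tsupport fun h => by simpa using hsub h
  rw [this, zero_sub]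

lemma integral_deriv_smul_primitive [CompleteSpace X] {b : ℝ → X} (hb : Integrable b (timeVol T))
    {ψ : ℝ → ℝ} (hψ : ContDiff ℝ ∞ ψ) (hc : HasCompactSupport ψ) (hsub : tsupport ψ ⊆ Ioo 0 T) :
    ∫ t, deriv ψ t • (∫ s in (0:ℝ)..t, b s) ∂timeVol T = -∫ t, ψ t • b t ∂timeVol T := by
  have hψ1 : ContDiff ℝ 1 ψ := hψ.of_le (by exact_mod_cast le_top)
  have hdc := hψ1.continuous_deriv le_rfl
  have hprod : Integrable (fun z : ℝ × ℝ => deriv ψ z.1 • b z.2) ((timeVol T).prod (timeVol T)) :=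
    Integrable.smul_prod
      ((hdc.integrable_of_hasCompactSupport hc.deriv).integrableOn) hb
  have hmeas : MeasurableSet {z : ℝ × ℝ | z.2 ≤ z.1} :=
    measurableSet_le measurable_snd measurable_fst
  have hint : Integrable (fun z : ℝ × ℝ => deriv ψ z.1 • (Iic z.1).indicator b z.2)
      ((timeVol T).prod (timeVol T)) := by
    refine (hprod.indicator hmeas).congr (Eventually.of_forall fun z => ?_)
    by_cases hz : z.2 ≤ z.1
    · simp [indicator, hz]
    · simp [indicator, hz]
  calc ∫ t, deriv ψ t • (∫ s in (0:ℝ)..t, b s) ∂timeVol T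
      = ∫ t, ∫ s, deriv ψ t • (Iic t).indicator b s ∂timeVol T ∂timeVol T := by
        refine integral_congr_ae ?_
        filter_upwards [ae_timeVol_mem T] with t ht
        rw [integral_smul, integral_timeVol_indicator b ht]
    _ = ∫ s, ∫ t, deriv ψ t • (Iic t).indicator b s ∂timeVol T ∂timeVol T :=
        integral_integral_swap hint
    _ = ∫ s, -(ψ s • b s) ∂timeVol T := by
        refine integral_congr_ae ?_
        filter_upwards [ae_timeVol_mem T] with s hs
        have e : (fun t => deriv ψ t • (Iic t).indicator b s) =
            (Ici s).indicator fun t => deriv ψ t • b s := by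
          funext t
          by_cases h : s ≤ t <;> simp [indicator, h]
        rw [e, timeVol, setIntegral_indicator measurableSet_Ici]
        have e2 : Ioo 0 T ∩ Ici s = Ico s T := by
          ext t
          simp only [mem_inter_iff, mem_Ioo, mem_Ici, mem_Ico]
          exact ⟨fun h => ⟨h.2, h.1.2⟩, fun h => ⟨⟨hs.1.trans_le h.1, h.2⟩, h.1⟩⟩
        rw [e2, integral_smul_const, integral_Ico_eq_integral_Ioo, ← integral_Ioc_eq_integral_Ioo,
          ← intervalIntegral.integral_of_le hs.2.le, integral_deriv_test hψ hsub, neg_smul]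
    _ = _ := integral_neg _

lemma integrable_deriv_smul {v : ℝ → X} (hv : Integrable v (timeVol T)) {ψ : ℝ → ℝ}
    (hψ : Continuous ψ) (hc : HasCompactSupport ψ) :
    Integrable (fun t => ψ t • v t) (timeVol T) := by
  obtain ⟨C, hC⟩ := hc.exists_bound_of_continuous hψ
  exact hv.bdd_smul C hψ.aestronglyMeasurable (Eventually.of_forall hC)

lemma continuousOn_primitive_timeVol {b : ℝ → X} (hb : Integrable b (timeVol T)) :
    ContinuousOn (fun t => ∫ s in (0:ℝ)..t, b s) (Icc 0 T) := by
  have hb' : IntegrableOn b (Icc 0 T) := (integrableOn_Icc_iff_integrableOn_Ioo (by simp)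
    (by simp)).2 hb
  rcases le_or_gt 0 T with h | h
  · have := intervalIntegral.continuousOn_primitive_interval (μ := volume) (f := b) (a := 0) (b := T)
      (by rwa [uIcc_of_le h])
    rwa [uIcc_of_le h] at this
  · simp [Icc_eq_empty (not_le.2 h)]

lemma integrable_primitive {b : ℝ → X} (hb : Integrable b (timeVol T)) :
    Integrable (fun t => ∫ s in (0:ℝ)..t, b s) (timeVol T) :=
  ((continuousOn_primitive_timeVol hb).integrableOn_compact isCompact_Icc).mono_set
    Ioo_subset_Icc_self

/-- Primitives are weakly differentiable. -/
lemma hasWeakTimeDeriv_of_eq_primitive [CompleteSpace X] (hT : 0 ≤ T) {v b : ℝ → X}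
    (hb : Integrable b (timeVol T)) (c : X)
    (h : ∀ᵐ t ∂timeVol T, v t = c + ∫ s in (0:ℝ)..t, b s) : HasWeakTimeDeriv T v b := by
  refine ⟨((integrable_const c).add (integrable_primitive hb)).congr ?_, hb,
    fun ψ hψ hc hsub => ?_⟩
  · filter_upwards [h] with t ht
    exact ht.symm
  · have hψ1 : ContDiff ℝ 1 ψ := hψ.of_le (by exact_mod_cast le_top)
    have hdc := hψ1.continuous_deriv le_rfl
    have e : ∫ t, deriv ψ t • v t ∂timeVol T =
        ∫ t, (deriv ψ t • c + deriv ψ t • ∫ s in (0:ℝ)..t, b s) ∂timeVol T := by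
      refine integral_congr_ae ?_
      filter_upwards [h] with t ht
      rw [ht, smul_add]
    rw [e, integral_add (integrable_deriv_smul (integrable_const c) hdc hc.deriv)
      (integrable_deriv_smul (integrable_primitive hb) hdc hc.deriv),
      integral_deriv_smul_primitive hb hψ hc hsub, integral_smul_const,
      ← intervalIntegral_eq_timeVol _ hT, integral_deriv_test hψ hsub]
    have : ψ 0 = 0 := image_eq_zero_of_notMem_tsupport fun h => by simpa using hsub h
    rw [this, neg_zero, zero_smul, zero_add]

lemma exists_Icc_of_compact {K : Set ℝ} (hK : IsCompact K) (hT : 0 < T) (h : K ⊆ Ioo 0 T) :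
    ∃ a b, 0 < a ∧ b < T ∧ K ⊆ Icc a b := by
  have hK' : IsCompact (insert (T / 2) K) := hK.insert _
  have hne : (insert (T / 2) K).Nonempty := insert_nonempty _ _
  have hsub : insert (T / 2) K ⊆ Ioo 0 T :=
    insert_subset ⟨by linarith, by linarith⟩ h
  refine ⟨sInf (insert (T / 2) K), sSup (insert (T / 2) K), (hsub (hK'.sInf_mem hne)).1,
    (hsub (hK'.sSup_mem hne)).2, fun x hx => ⟨?_, ?_⟩⟩
  · exact csInf_le hK'.bddBelow (mem_insert_of_mem _ hx)
  · exact le_csSup hK'.bddAbove (mem_insert_of_mem _ hx)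

lemma exists_test_primitive (hT : 0 < T) {φ : ℝ → ℝ} (hφ : ContDiff ℝ ∞ φ)
    (hc : HasCompactSupport φ) (hsub : tsupport φ ⊆ Ioo 0 T) (h0 : ∫ t, φ t = 0) :
    ∃ ψ : ℝ → ℝ, ContDiff ℝ ∞ ψ ∧ HasCompactSupport ψ ∧ tsupport ψ ⊆ Ioo 0 T ∧ deriv ψ = φ := by
  obtain ⟨a, b, ha, hb, hab⟩ := exists_Icc_of_compact hc hT hsub
  have hz : ∀ t, t ∉ Icc a b → φ t = 0 := fun t ht =>
    image_eq_zero_of_notMem_tsupport fun h => ht (hab h)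
  set ψ : ℝ → ℝ := fun t => ∫ s in a..t, φ s
  have hd : ∀ t, HasDerivAt ψ (φ t) t := fun t =>
    intervalIntegral.integral_hasDerivAt_right (hφ.continuous.intervalIntegrable _ _)
      (hφ.continuous.stronglyMeasurableAtFilter _ _) hφ.continuous.continuousAt
  have hderiv : deriv ψ = φ := funext fun t => (hd t).deriv
  have hsupp : Function.support ψ ⊆ Icc a b := by
    intro t ht
    by_contra hcon
    refine ht ?_
    rcases lt_or_ge t a with h | h
    · simp only [ψ]
      rw [intervalIntegral.integral_symm, intervalIntegral.integral_of_le h.le, neg_eq_zero,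
        integral_Ioc_eq_integral_Ioo]
      refine setIntegral_eq_zero_of_forall_eq_zero fun s hs => hz s fun h' => ?_
      exact absurd hs.2 (not_lt.2 h'.1)
    · have hbt : b < t := by
        by_contra h'
        exact hcon ⟨h, not_lt.1 h'⟩
      simp only [ψ]
      rw [intervalIntegral.integral_of_le h, ← integral_Icc_eq_integral_Ioc, ← h0]
      refine setIntegral_eq_integral_of_forall_compl_eq_zero fun s hs => hz s fun h' => ?_
      exact hs ⟨h'.1, h'.2.trans hbt.le⟩
  have hts : tsupport ψ ⊆ Icc a b := closure_minimal hsupp isClosed_Icc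
  refine ⟨ψ, ?_, isCompact_Icc.of_isClosed_subset (isClosed_tsupport _) hts,
    hts.trans fun t ht => ⟨ha.trans_le ht.1, ht.2.trans_lt hb⟩, hderiv⟩
  rw [contDiff_infty_iff_deriv, hderiv]
  exact ⟨fun t => (hd t).differentiableAt, hφ⟩

/-- **Du Bois-Reymond lemma.** -/
lemma ae_eq_const_of_integral_deriv_eq_zero [CompleteSpace X] (hT : 0 < T) {D : ℝ → X}
    (hD : Integrable D (timeVol T))
    (h : ∀ ψ : ℝ → ℝ, ContDiff ℝ ∞ ψ → HasCompactSupport ψ → tsupport ψ ⊆ Ioo 0 T →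
      ∫ t, deriv ψ t • D t ∂timeVol T = 0) : ∃ c, ∀ᵐ t ∂timeVol T, D t = c := by
  let f : ContDiffBump (T / 2) := ⟨T / 8, T / 4, by positivity, by linarith⟩
  set χ := f.normed volume
  have hχc : HasCompactSupport χ := f.hasCompactSupport_normed
  have hχ : ContDiff ℝ ∞ χ := f.contDiff_normed
  have hχs : tsupport χ ⊆ Ioo 0 T := by
    rw [f.tsupport_normed_eq, Real.closedBall_eq_Icc]
    intro t ht
    have h1 : T / 2 - T / 4 ≤ t := ht.1
    have h2 : t ≤ T / 2 + T / 4 := ht.2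
    exact ⟨by linarith, by linarith⟩
  set c := ∫ t, χ t • D t ∂timeVol T
  refine ⟨c, ?_⟩
  have hDc : IntegrableOn (fun t => D t - c) (Ioo 0 T) := hD.sub (integrable_const c)
  have h0 := isOpen_Ioo.ae_eq_zero_of_integral_contDiff_smul_eq_zero (μ := volume)
    hDc.locallyIntegrableOn fun g hg hgc hgs => by
      have hgi : Integrable g := hg.continuous.integrable_of_hasCompactSupport hgc
      have hχi : Integrable χ := hχ.continuous.integrable_of_hasCompactSupport hχc
      set m := ∫ t, g t
      have hφ0 : ∫ t, (g - m • χ) t = 0 := by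
        simp only [Pi.sub_apply, Pi.smul_apply, smul_eq_mul]
        rw [integral_sub hgi (hχi.const_mul m), integral_const_mul, f.integral_normed, mul_one,
          sub_self]
      have hφc : HasCompactSupport (g - m • χ) := hgc.sub (hχc.smul_left (f := fun _ => m))
      have hsub : tsupport (g - m • χ) ⊆ Ioo 0 T :=
        (tsupport_sub g (m • χ)).trans (union_subset hgs
          ((closure_mono (Function.support_const_smul_subset m χ)).trans hχs))
      obtain ⟨ψ, h1, h2, h3, h4⟩ := exists_test_primitive hT (φ := g - m • χ)
        (hg.sub (hχ.const_smul m)) hφc hsub hφ0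
      have h5 := h ψ h1 h2 h3
      rw [h4] at h5
      have i1 := integrable_deriv_smul hD hg.continuous hgc
      have i2 := integrable_deriv_smul hD hχ.continuous hχc
      have e : ∫ t, (g - m • χ) t • D t ∂timeVol T = ∫ t, g t • D t ∂timeVol T - m • c := by
        have i3 : Integrable (fun t => m • χ t • D t) (timeVol T) := i2.smul m
        rw [← integral_smul, ← integral_sub i1 i3]
        refine integral_congr_ae (Eventually.of_forall fun t => ?_)
        simp only [Pi.sub_apply, Pi.smul_apply, sub_smul, smul_assoc]
      rw [e, sub_eq_zero] at h5
      have h6 : ∫ t, g t • (D t - c) = ∫ t, g t • (D t - c) ∂timeVol T := by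
        refine (setIntegral_eq_integral_of_forall_compl_eq_zero fun t ht => ?_).symm
        rw [image_eq_zero_of_notMem_tsupport fun h' => ht (hgs h'), zero_smul]
      have h7 : ∫ t, g t ∂timeVol T = m := by
        refine setIntegral_eq_integral_of_forall_compl_eq_zero fun t ht => ?_
        exact image_eq_zero_of_notMem_tsupport fun h' => ht (hgs h')
      rw [h6]
      simp only [smul_sub]
      rw [integral_sub i1 (integrable_deriv_smul (integrable_const c) hg.continuous hgc), h5,
        integral_smul_const, h7, sub_self]
  filter_upwards [ae_restrict_of_ae h0, ae_timeVol_mem T] with t h1 h2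
  exact sub_eq_zero.1 (h1 h2)

/-- A weakly differentiable function is a primitive of its weak derivative. -/
lemma HasWeakTimeDeriv.eq_primitive [CompleteSpace X] (hT : 0 < T) {v b : ℝ → X}
    (h : HasWeakTimeDeriv T v b) : ∃ c, ∀ᵐ t ∂timeVol T, v t = c + ∫ s in (0:ℝ)..t, b s := by
  obtain ⟨hv, hb, hw⟩ := h
  obtain ⟨c, hc⟩ := ae_eq_const_of_integral_deriv_eq_zero hT
    (D := fun t => v t - ∫ s in (0:ℝ)..t, b s) (hv.sub (integrable_primitive hb))
    fun ψ h1 h2 h3 => by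
      have hψ1 : ContDiff ℝ 1 ψ := h1.of_le (by exact_mod_cast le_top)
      have hdc := hψ1.continuous_deriv le_rfl
      simp only [smul_sub]
      rw [integral_sub (integrable_deriv_smul hv hdc h2.deriv)
        (integrable_deriv_smul (integrable_primitive hb) hdc h2.deriv), hw ψ h1 h2 h3,
        integral_deriv_smul_primitive hb h1 h2 h3, sub_self]
  refine ⟨c, ?_⟩
  filter_upwards [hc] with t ht
  rw [← ht, sub_add_cancel]

/-! ### Difference quotients -/

lemma diffQuot_integral_step {l : ℝ} (hl : 0 < l) (v : ℕ → X) (n : ℕ) {t : ℝ} (h1 : n * l ≤ t)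
    (h2 : t ≤ (n + 1) * l) [CompleteSpace X] :
    IntervalIntegrable (diffQuot l v) volume (n * l) t ∧
      ∫ s in (n * l)..t, diffQuot l v s = ((t - n * l) / l) • (v (n + 1) - v n) := by
  have e : EqOn (diffQuot l v) (fun _ => l⁻¹ • (v (n + 1) - v n)) (Ioc (n * l) t) := fun s hs =>
    diffQuot_eq hl v n hs.1 (hs.2.trans h2)
  constructor
  · rw [intervalIntegrable_iff_integrableOn_Ioc_of_le h1]
    exact (integrableOn_const (by simp)).congr_fun e.symm measurableSet_Ioc
  · rw [intervalIntegral.integral_of_le h1, setIntegral_congr_fun measurableSet_Ioc e,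
      ← intervalIntegral.integral_of_le h1, intervalIntegral.integral_const, smul_smul,
      div_eq_mul_inv]

lemma diffQuot_integral_grid {l : ℝ} (hl : 0 < l) (v : ℕ → X) [CompleteSpace X] (n : ℕ) :
    IntervalIntegrable (diffQuot l v) volume 0 (n * l) ∧
      ∫ s in (0:ℝ)..(n * l), diffQuot l v s = v n - v 0 := by
  induction n with
  | zero => simp
  | succ n ih =>
    have h := diffQuot_integral_step hl v n (t := (n + 1) * l) (by nlinarith) le_rfl
    push_cast
    refine ⟨ih.1.trans h.1, ?_⟩
    rw [← intervalIntegral.integral_add_adjacent_intervals ih.1 h.1, ih.2, h.2]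
    have e : ((n + 1) * l - n * l) / l = 1 := by field_simp; ring
    rw [e, one_smul]
    abel

/-- The primitive of the difference quotient is close to the piecewise constant interpolant. -/
lemma norm_primitive_diffQuot_sub_le {l : ℝ} (hl : 0 < l) (v : ℕ → X) [CompleteSpace X] {t : ℝ}
    (ht : 0 ≤ t) : ‖v 0 + (∫ s in (0:ℝ)..t, diffQuot l v s) - v ⌈t / l⌉₊‖ ≤
      ‖v ⌈t / l⌉₊ - v (⌈t / l⌉₊ - 1)‖ := by
  rcases ht.eq_or_lt with rfl | ht
  · simp
  obtain ⟨n, hn⟩ : ∃ n, ⌈t / l⌉₊ = n + 1 :=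
    Nat.exists_eq_succ_of_ne_zero (Nat.ceil_pos.2 (by positivity)).ne'
  have h12 := (Nat.ceil_eq_iff (Nat.succ_ne_zero n)).1 hn
  have h1 : n * l < t := by
    have := h12.1
    rwa [lt_div_iff₀ hl, Nat.succ_sub_one] at this
  have h2 : t ≤ (n + 1) * l := by
    have := h12.2
    rw [div_le_iff₀ hl] at this
    exact_mod_cast this
  have hg := diffQuot_integral_grid hl v n
  have hs := diffQuot_integral_step hl v n h1.le h2
  rw [hn, Nat.add_sub_cancel, ← intervalIntegral.integral_add_adjacent_intervals hg.1 hs.1, hg.2,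
    hs.2]
  set θ := (t - n * l) / l
  have hθ0 : 0 ≤ θ := div_nonneg (by linarith) hl.le
  have hθ1 : θ ≤ 1 := by rw [div_le_one hl]; linarith
  have e : v 0 + (v n - v 0 + θ • (v (n + 1) - v n)) - v (n + 1) =
      (θ - 1) • (v (n + 1) - v n) := by module
  rw [e, norm_smul, Real.norm_eq_abs]
  refine mul_le_of_le_one_left (norm_nonneg _) ?_
  rw [abs_le]
  constructor <;> linarith

end TimeGeneral

/-! ### A chain rule inequality by averaging in time -/

section Steklov

variable {X : Type*} [NormedAddCommGroup X] [NormedSpace ℝ X] {T : ℝ}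

lemma continuous_dual_apply : Continuous fun q : (X →L[ℝ] ℝ) × X => q.1 q.2 :=
  (isBoundedBilinearMap_apply (𝕜 := ℝ) (E := X) (F := ℝ)).continuous

/-- Projection of the real line on `[0, T]`. -/
def clamp (T s : ℝ) : ℝ := max 0 (min s T)

lemma continuous_clamp (T : ℝ) : Continuous (clamp T) := by
  unfold clamp
  fun_prop

lemma clamp_mem (hT : 0 ≤ T) (s : ℝ) : clamp T s ∈ Icc 0 T :=
  ⟨le_max_left _ _, max_le hT (min_le_right _ _)⟩

lemma clamp_of_mem {s : ℝ} (hs : s ∈ Icc 0 T) : clamp T s = s := by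
  rw [clamp, min_eq_left hs.2, max_eq_right hs.1]

lemma clamp_of_le {s : ℝ} (hs : s ≤ 0) : clamp T s = 0 :=
  max_eq_left ((min_le_left _ _).trans hs)

lemma clamp_of_ge (hT : 0 ≤ T) {s : ℝ} (hs : T ≤ s) : clamp T s = T := by
  rw [clamp, min_eq_right hs, max_eq_right hT]

/-- The average of `u` over `(t - h, t)`. -/
def steklov (h : ℝ) (u : ℝ → X) (t : ℝ) : X := h⁻¹ • ∫ s in (t - h)..t, u s

lemma norm_steklov_le {h R : ℝ} (hh : 0 < h) {u : ℝ → X} (hR : ∀ s, ‖u s‖ ≤ R) (t : ℝ) :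
    ‖steklov h u t‖ ≤ R := by
  rw [steklov, norm_smul, Real.norm_of_nonneg (inv_pos.2 hh).le]
  have := intervalIntegral.norm_integral_le_of_norm_le_const (a := t - h) (b := t)
    (f := u) (C := R) fun s _ => hR s
  rw [sub_sub_cancel, abs_of_pos hh] at this
  rw [inv_mul_le_iff₀ hh]
  linarith

lemma locallyIntegrable_of_bounded {X : Type*} [NormedAddCommGroup X] {R : ℝ} {u : ℝ → X}
    (hu : StronglyMeasurable u)
    (hR : ∀ s, ‖u s‖ ≤ R) : LocallyIntegrable u volume := by
  refine (locallyIntegrable_const R).mono hu.aestronglyMeasurable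
    (Eventually.of_forall fun s => ?_)
  exact (hR s).trans (le_abs_self R)

lemma intervalIntegrable_of_bounded {X : Type*} [NormedAddCommGroup X] {R : ℝ} {u : ℝ → X}
    (hu : StronglyMeasurable u)
    (hR : ∀ s, ‖u s‖ ≤ R) (a b : ℝ) : IntervalIntegrable u volume a b :=
  intervalIntegrable_iff.2 ((LocallyIntegrable.integrableOn_isCompact
    (locallyIntegrable_of_bounded hu hR) isCompact_uIcc).mono_set uIoc_subset_uIcc)

lemma steklov_eq {h R : ℝ} {u : ℝ → X} (hu : StronglyMeasurable u) (hR : ∀ s, ‖u s‖ ≤ R)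
    (t : ℝ) : steklov h u t = h⁻¹ • ((∫ s in (0:ℝ)..t, u s) - ∫ s in (0:ℝ)..(t - h), u s) := by
  rw [steklov, intervalIntegral.integral_interval_sub_left
    (intervalIntegrable_of_bounded hu hR _ _) (intervalIntegrable_of_bounded hu hR _ _)]

lemma continuous_steklov {h R : ℝ} {u : ℝ → X} (hu : StronglyMeasurable u) (hR : ∀ s, ‖u s‖ ≤ R) :
    Continuous (steklov h u) := by
  have h1 : Continuous fun t => ∫ s in (0:ℝ)..t, u s :=
    intervalIntegral.continuous_primitive (intervalIntegrable_of_bounded hu hR) 0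
  have e : steklov h u = fun t =>
      h⁻¹ • ((∫ s in (0:ℝ)..t, u s) - ∫ s in (0:ℝ)..(t - h), u s) :=
    funext (steklov_eq hu hR)
  rw [e]
  exact (h1.sub (h1.comp (continuous_id.sub continuous_const))).const_smul _

lemma tendsto_integral_norm_sub_steklov [CompleteSpace X] {R : ℝ} {u : ℝ → X}
    (hu : StronglyMeasurable u) (hR : ∀ s, ‖u s‖ ≤ R) (T : ℝ) :
    Tendsto (fun j : ℕ => ∫ t, ‖u t - steklov (1 / ((j : ℝ) + 1)) u t‖ ∂timeVol T) atTop
      (𝓝 0) := by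
  have hpos : ∀ j : ℕ, 0 < 1 / ((j : ℝ) + 1) := fun j => Nat.one_div_pos_of_nat
  have h := tendsto_integral_of_dominated_convergence (μ := timeVol T)
    (F := fun (j : ℕ) t => ‖u t - steklov (1 / ((j : ℝ) + 1)) u t‖) (f := fun _ => (0 : ℝ))
    (fun _ => R + R)
    (fun j => (hu.aestronglyMeasurable.sub
      (continuous_steklov hu hR).aestronglyMeasurable).norm) (integrable_const _)
    (fun j => Eventually.of_forall fun t => ?_) ?_
  · simpa using h
  · rw [norm_norm]
    exact (norm_sub_le _ _).trans (add_le_add (hR t) (norm_steklov_le (hpos j) hR t))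
  · have hae := LocallyIntegrable.ae_hasDerivAt_integral (locallyIntegrable_of_bounded hu hR)
    have hae' : ∀ᵐ t ∂timeVol T, HasDerivAt (fun x => ∫ s in (0:ℝ)..x, u s) (u t) t :=
      ae_restrict_of_ae (hae.mono fun t ht => ht 0)
    filter_upwards [hae'] with t ht
    have hlim : Tendsto (fun j : ℕ => -(1 / ((j : ℝ) + 1))) atTop (𝓝[≠] 0) := by
      refine tendsto_nhdsWithin_iff.2 ⟨?_, Eventually.of_forall fun j => ?_⟩
      · simpa using (tendsto_one_div_add_atTop_nhds_zero_nat (𝕜 := ℝ)).neg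
      · exact (neg_neg_of_pos (hpos j)).ne
    have h2 := (hasDerivAt_iff_tendsto_slope_zero.1 ht).comp hlim
    have h3 : Tendsto (fun j : ℕ => steklov (1 / ((j : ℝ) + 1)) u t) atTop (𝓝 (u t)) := by
      refine h2.congr fun j => ?_
      rw [steklov_eq hu hR, Function.comp_apply, ← sub_eq_add_neg, inv_neg, neg_smul, ← smul_neg,
        neg_sub]
    have h4 := ((tendsto_const_nhds (x := u t)).sub h3).norm
    rwa [sub_self, norm_zero] at h4

lemma integral_timeVol_eq_clamp [CompleteSpace X] (hT : 0 ≤ T) {D : ℝ → X}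
    (hD : Integrable D (timeVol T)) {s h : ℝ} (hh : 0 < h) :
    ∫ t in Ico s (s + h), D t ∂timeVol T =
      (∫ t in (0:ℝ)..(clamp T (s + h)), D t) - ∫ t in (0:ℝ)..(clamp T s), D t := by
  have h0 : (0 : ℝ) ∈ Icc 0 T := ⟨le_rfl, hT⟩
  have hle : clamp T s ≤ clamp T (s + h) :=
    max_le_max le_rfl (min_le_min (by linarith) le_rfl)
  rw [intervalIntegral.integral_interval_sub_left
    (intervalIntegrable_of_timeVol hD h0 (clamp_mem hT _))
    (intervalIntegrable_of_timeVol hD h0 (clamp_mem hT _)), intervalIntegral.integral_of_le hle,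
    timeVol, Measure.restrict_restrict measurableSet_Ico, inter_comm, integral_Ioc_eq_integral_Ioo]
  refine setIntegral_congr_set ?_
  have e1 : (Ioo 0 T ∩ Ico s (s + h) : Set ℝ) =ᵐ[volume] (Ioo 0 T ∩ Ioo s (s + h) : Set ℝ) :=
    (ae_eq_refl (Ioo 0 T : Set ℝ)).inter (Ioo_ae_eq_Ico (a := s) (b := s + h)).symm
  refine e1.trans (Eventually.of_forall fun t => ?_)
  refine propext ?_
  change (t ∈ Ioo 0 T ∩ Ioo s (s + h)) ↔ t ∈ Ioo (clamp T s) (clamp T (s + h))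
  simp only [clamp, mem_inter_iff, mem_Ioo, max_lt_iff, min_lt_iff, lt_max_iff, lt_min_iff]
  constructor
  · rintro ⟨⟨a, b⟩, c, d⟩
    exact ⟨⟨a, Or.inl c⟩, Or.inr ⟨d, b⟩⟩
  · rintro ⟨⟨a, b⟩, c⟩
    rcases c with c | ⟨c, d⟩
    · exact absurd a (not_lt.2 c.le)
    · rcases b with b | b
      · exact ⟨⟨a, d⟩, b, c⟩
      · exact absurd d (not_lt.2 b.le)

/-- Fubini's theorem for Steklov averages. -/
lemma integral_apply_steklov [CompleteSpace X] (hT : 0 < T) {D : ℝ → X →L[ℝ] ℝ}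
    (hD : Integrable D (timeVol T)) {u : ℝ → X} {R : ℝ} (hu : StronglyMeasurable u)
    (hR : ∀ s, ‖u s‖ ≤ R) {h : ℝ} (hh : 0 < h) :
    ∫ t, D t (steklov h u t) ∂timeVol T = h⁻¹ * ∫ s in Ioo (-h) T,
      ((∫ t in (0:ℝ)..(clamp T (s + h)), D t) - ∫ t in (0:ℝ)..(clamp T s), D t) (u s) := by
  set ν := volume.restrict (Ioo (-h) T)
  have hint : Integrable (fun z : ℝ × ℝ => D z.1 (u z.2)) ((timeVol T).prod ν) := by
    refine (hD.norm.mul_prod (integrable_const R)).mono' ?_ (Eventually.of_forall fun z => ?_)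
    · exact continuous_dual_apply.comp_aestronglyMeasurable
        (hD.1.comp_fst.prodMk hu.aestronglyMeasurable.comp_snd)
    · exact (ContinuousLinearMap.le_opNorm _ _).trans
        (mul_le_mul_of_nonneg_left (hR _) (norm_nonneg _))
  obtain ⟨S, hS⟩ : ∃ S : Set (ℝ × ℝ), S = {z | z.2 ≤ z.1 ∧ z.1 < z.2 + h} := ⟨_, rfl⟩
  have hmem : ∀ t s, (t, s) ∈ S ↔ s ≤ t ∧ t < s + h := fun t s => by rw [hS, mem_ofPred_eq]
  have hmeas : MeasurableSet S := by
    rw [hS]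
    exact (measurableSet_le measurable_snd measurable_fst).inter
      (measurableSet_lt measurable_fst (measurable_snd.add_const h))
  have hint2 : Integrable (fun z : ℝ × ℝ => S.indicator (fun z => D z.1 (u z.2)) (z.1, z.2))
      ((timeVol T).prod ν) := hint.indicator hmeas
  have eL : ∀ t ∈ Ioo 0 T, D t (steklov h u t) =
      h⁻¹ * ∫ s, S.indicator (fun z => D z.1 (u z.2)) (t, s) ∂ν := by
    intro t ht
    rw [steklov, map_smul, smul_eq_mul,
      ← ContinuousLinearMap.intervalIntegral_comp_comm _ (intervalIntegrable_of_bounded hu hR _ _),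
      intervalIntegral.integral_of_le (by linarith)]
    congr 1
    have e : (fun s => S.indicator (fun z => D z.1 (u z.2)) (t, s)) =
        (Ioc (t - h) t).indicator fun s => D t (u s) := by
      funext s
      by_cases hs : s ∈ Ioc (t - h) t
      · rw [indicator_of_mem hs, indicator_of_mem ((hmem t s).2 ⟨hs.2, by linarith [hs.1]⟩)]
      · rw [indicator_of_notMem hs, indicator_of_notMem fun hs' => hs
          ⟨by linarith [((hmem t s).1 hs').2], ((hmem t s).1 hs').1⟩]
    rw [e, setIntegral_indicator measurableSet_Ioc, inter_eq_right.2]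
    exact fun s hs => ⟨by linarith [hs.1, ht.1], hs.2.trans_lt ht.2⟩
  have eR : ∀ s, ∫ t, S.indicator (fun z => D z.1 (u z.2)) (t, s) ∂timeVol T =
      ((∫ t in (0:ℝ)..(clamp T (s + h)), D t) - ∫ t in (0:ℝ)..(clamp T s), D t) (u s) := by
    intro s
    have ha := ContinuousLinearMap.integral_apply (hD.integrableOn (s := Ico s (s + h))) (u s)
    rw [← integral_timeVol_eq_clamp hT.le hD hh, ha, ← integral_indicator measurableSet_Ico]
    refine integral_congr_ae (Eventually.of_forall fun t => ?_)
    by_cases ht : t ∈ Ico s (s + h)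
    · simp only [indicator_of_mem ht, indicator_of_mem ((hmem t s).2 ht)]
    · simp only [indicator_of_notMem ht,
        indicator_of_notMem fun h' => ht ((hmem t s).1 h')]
  calc ∫ t, D t (steklov h u t) ∂timeVol T
      = ∫ t, h⁻¹ * ∫ s, S.indicator (fun z => D z.1 (u z.2)) (t, s) ∂ν ∂timeVol T := by
        refine integral_congr_ae ?_
        filter_upwards [ae_timeVol_mem T] with t ht using eL t ht
    _ = h⁻¹ * ∫ s, ∫ t, S.indicator (fun z => D z.1 (u z.2)) (t, s) ∂timeVol T ∂ν := by
        rw [integral_const_mul, integral_integral_swap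
          (f := fun t s => S.indicator (fun z => D z.1 (u z.2)) (t, s)) hint2]
    _ = _ := by rw [integral_congr_ae (Eventually.of_forall eR)]

lemma integral_clamp_shift (hT : 0 < T) {Φ : ℝ → ℝ} (hΦ : ContinuousOn Φ (Icc 0 T)) {h : ℝ}
    (hh : 0 < h) : ∫ s in Ioo (-h) T, (Φ (clamp T (s + h)) - Φ (clamp T s)) = h * (Φ T - Φ 0) := by
  have hc : Continuous fun s => Φ (clamp T s) :=
    hΦ.comp_continuous (continuous_clamp T) (clamp_mem hT.le)
  have hi : ∀ a b, IntervalIntegrable (fun s => Φ (clamp T s)) volume a b := fun a b =>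
    hc.intervalIntegrable a b
  have hs : IntervalIntegrable (fun s => Φ (clamp T (s + h))) volume (-h) T :=
    (hc.comp (continuous_add_const h)).intervalIntegrable _ _
  rw [← integral_Ioc_eq_integral_Ioo, ← intervalIntegral.integral_of_le (by linarith),
    intervalIntegral.integral_sub hs (hi _ _),
    intervalIntegral.integral_comp_add_right (fun s => Φ (clamp T s)), neg_add_cancel,
    ← intervalIntegral.integral_add_adjacent_intervals (hi 0 T) (hi T (T + h)),
    ← intervalIntegral.integral_add_adjacent_intervals (hi (-h) 0) (hi 0 T)]
  have e1 : ∫ s in T..(T + h), Φ (clamp T s) = h * Φ T := by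
    rw [intervalIntegral.integral_congr (g := fun _ => Φ T)]
    · simp
    · intro s hs
      rw [uIcc_of_le (by linarith)] at hs
      simp only [clamp_of_ge hT.le hs.1]
  have e2 : ∫ s in (-h)..0, Φ (clamp T s) = h * Φ 0 := by
    rw [intervalIntegral.integral_congr (g := fun _ => Φ 0)]
    · simp
    · intro s hs
      rw [uIcc_of_le (by linarith)] at hs
      simp only [clamp_of_le hs.2]
  rw [e1, e2]
  ring

/-- Upper bound for the limit of the pairing of `u` with the derivatives `D k`, whose primitives
converge to `W - W 0`, under the subgradient inequality `⟨W t - W s, u s⟩ ≤ Φ t - Φ s`. -/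
theorem eventually_integral_apply_le [CompleteSpace X] (hT : 0 < T) {D : ℕ → ℝ → X →L[ℝ] ℝ}
    {W : ℝ → X →L[ℝ] ℝ} {u : ℝ → X} {Φ : ℝ → ℝ} {M R : ℝ}
    (hD : ∀ k, AEStronglyMeasurable (D k) (timeVol T))
    (hDM : ∀ k, ∀ᵐ t ∂timeVol T, ‖D k t‖ ≤ M)
    (hW : ∀ t ∈ Icc 0 T, Tendsto (fun k => ∫ s in (0:ℝ)..t, D k s) atTop (𝓝 (W t - W 0)))
    (hu : StronglyMeasurable u) (hR : ∀ s, ‖u s‖ ≤ R) (hu0 : ∀ s, u (clamp T s) = u s)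
    (hΦ : ContinuousOn Φ (Icc 0 T))
    (hWΦ : ∀ s ∈ Icc 0 T, ∀ t ∈ Icc 0 T, (W t - W s) (u s) ≤ Φ t - Φ s) {ε : ℝ} (hε : 0 < ε) :
    ∀ᶠ k in atTop, ∫ t, D k t (u t) ∂timeVol T ≤ Φ T - Φ 0 + ε := by
  have hDi : ∀ k, Integrable (D k) (timeVol T) := fun k =>
    (integrable_const M).mono' (hD k) (hDM k)
  have hM : 0 ≤ M := by
    have : (timeVol T) ≠ 0 := by
      rw [timeVol, Ne, Measure.restrict_eq_zero, Real.volume_Ioo]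
      simpa using hT
    have : NeBot (ae (timeVol T)) := ae_neBot.2 this
    obtain ⟨t, ht⟩ := (hDM 0).exists
    exact (norm_nonneg _).trans ht
  have hR0 : 0 ≤ R := (norm_nonneg _).trans (hR 0)
  obtain ⟨j, hj⟩ : ∃ j : ℕ,
      M * ∫ t, ‖u t - steklov (1 / ((j : ℝ) + 1)) u t‖ ∂timeVol T < ε / 2 := by
    have := (tendsto_integral_norm_sub_steklov hu hR T).const_mul M
    rw [mul_zero] at this
    exact (this.eventually (gt_mem_nhds (half_pos hε))).exists
  set h := 1 / ((j : ℝ) + 1)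
  have hh : 0 < h := Nat.one_div_pos_of_nat
  set P : ℕ → ℝ → X →L[ℝ] ℝ := fun k t => ∫ s in (0:ℝ)..t, D k s
  have hPc : ∀ k, Continuous fun s => P k (clamp T s) := fun k =>
    (continuousOn_primitive_timeVol (hDi k)).comp_continuous (continuous_clamp T)
      (clamp_mem hT.le)
  have hPM : ∀ k, ∀ t ∈ Icc 0 T, ‖P k t‖ ≤ M * T := fun k t ht => by
    have h1 : ‖P k t‖ ≤ M * |t - 0| := by
      refine intervalIntegral.norm_integral_le_of_norm_le_const_ae ?_
      have := ae_restrict_iff' (measurableSet_Ioo (a := (0:ℝ)) (b := T)) |>.1 (hDM k)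
      have hne : ∀ᵐ s : ℝ, s ≠ T := by simp [ae_iff, measure_singleton]
      filter_upwards [this, hne] with s hs hsT hs'
      rw [uIoc_of_le ht.1] at hs'
      exact hs ⟨hs'.1, lt_of_le_of_ne (hs'.2.trans ht.2) hsT⟩
    rw [sub_zero, abs_of_nonneg ht.1] at h1
    exact h1.trans (mul_le_mul_of_nonneg_left ht.2 hM)
  set g : ℕ → ℝ → ℝ := fun k s => (P k (clamp T (s + h)) - P k (clamp T s)) (u s)
  set G : ℝ → ℝ := fun s => (W (clamp T (s + h)) - W (clamp T s)) (u s)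
  have hgm : ∀ k, AEStronglyMeasurable (g k) (volume.restrict (Ioo (-h) T)) := fun k =>
    continuous_dual_apply.comp_aestronglyMeasurable
      ((((hPc k).comp (continuous_add_const h)).sub
        (hPc k)).aestronglyMeasurable.prodMk hu.aestronglyMeasurable)
  have hgM : ∀ k s, ‖g k s‖ ≤ (M * T + M * T) * R := fun k s => by
    refine (ContinuousLinearMap.le_opNorm _ _).trans ?_
    have h1 := hPM k _ (clamp_mem hT.le (s + h))
    have h2 := hPM k _ (clamp_mem hT.le s)
    have h3 := norm_sub_le (P k (clamp T (s + h))) (P k (clamp T s))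
    exact mul_le_mul (h3.trans (add_le_add h1 h2)) (hR s) (norm_nonneg _) (by positivity)
  have hgG : ∀ s, Tendsto (fun k => g k s) atTop (𝓝 (G s)) := fun s => by
    have h1 := (hW _ (clamp_mem hT.le (s + h))).sub (hW _ (clamp_mem hT.le s))
    rw [sub_sub_sub_cancel_right] at h1
    exact ((ContinuousLinearMap.apply ℝ ℝ (u s)).continuous.tendsto _).comp h1
  have hGm : AEStronglyMeasurable G (volume.restrict (Ioo (-h) T)) :=
    aestronglyMeasurable_of_tendsto_ae atTop hgm (Eventually.of_forall hgG)
  have hGM : ∀ s, ‖G s‖ ≤ (M * T + M * T) * R := fun s =>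
    le_of_tendsto (hgG s).norm (Eventually.of_forall fun k => hgM k s)
  have hlim : Tendsto (fun k => ∫ t, D k t (steklov h u t) ∂timeVol T) atTop
      (𝓝 (h⁻¹ * ∫ s in Ioo (-h) T, G s)) := by
    have e : (fun k => ∫ t, D k t (steklov h u t) ∂timeVol T) =
        fun k => h⁻¹ * ∫ s in Ioo (-h) T, g k s :=
      funext fun k => integral_apply_steklov hT (hDi k) hu hR hh
    rw [e]
    exact (tendsto_integral_of_dominated_convergence (fun _ => (M * T + M * T) * R) hgm
      (integrable_const _) (fun k => Eventually.of_forall (hgM k))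
      (Eventually.of_forall hgG)).const_mul _
  have hGle : h⁻¹ * ∫ s in Ioo (-h) T, G s ≤ Φ T - Φ 0 := by
    rw [inv_mul_le_iff₀ hh, ← integral_clamp_shift hT hΦ hh]
    have hc : Continuous fun s => Φ (clamp T s) :=
      hΦ.comp_continuous (continuous_clamp T) (clamp_mem hT.le)
    have hc2 : Continuous fun s => Φ (clamp T (s + h)) - Φ (clamp T s) :=
      (hc.comp (continuous_add_const h)).sub hc
    refine integral_mono ((integrable_const ((M * T + M * T) * R)).mono' hGm
      (Eventually.of_forall hGM)) ?_ fun s => ?_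
    · exact (hc2.integrableOn_Icc (a := -h) (b := T)).mono_set Ioo_subset_Icc_self
    · have := hWΦ _ (clamp_mem hT.le s) _ (clamp_mem hT.le (s + h))
      rwa [hu0] at this
  filter_upwards [hlim.eventually (gt_mem_nhds (show h⁻¹ * ∫ s in Ioo (-h) T, G s <
    Φ T - Φ 0 + ε / 2 by linarith))] with k hk
  have hsm : AEStronglyMeasurable (fun t => steklov h u t) (timeVol T) :=
    (continuous_steklov hu hR).aestronglyMeasurable
  have hb : ∀ w : ℝ → X, AEStronglyMeasurable w (timeVol T) → (∀ t, ‖w t‖ ≤ R) →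
      Integrable (fun t => D k t (w t)) (timeVol T) := fun w hw hwR => by
    refine (integrable_const (M * R)).mono' ?_ ?_
    · exact continuous_dual_apply.comp_aestronglyMeasurable ((hD k).prodMk hw)
    · filter_upwards [hDM k] with t ht
      exact (ContinuousLinearMap.le_opNorm _ _).trans
        (mul_le_mul ht (hwR t) (norm_nonneg _) hM)
  have hdiff : ∫ t, D k t (u t) ∂timeVol T - ∫ t, D k t (steklov h u t) ∂timeVol T ≤
      M * ∫ t, ‖u t - steklov h u t‖ ∂timeVol T := by
    rw [← integral_sub (hb u hu.aestronglyMeasurable hR) (hb _ hsm (norm_steklov_le hh hR)),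
      ← integral_const_mul]
    refine integral_mono_ae ((hb u hu.aestronglyMeasurable hR).sub
      (hb _ hsm (norm_steklov_le hh hR))) ?_ ?_
    · refine Integrable.const_mul ?_ _
      refine ((integrable_const (R + R)).mono' (hu.aestronglyMeasurable.sub hsm)
        (Eventually.of_forall fun t => ?_)).norm
      exact (norm_sub_le _ _).trans (add_le_add (hR t) (norm_steklov_le hh hR t))
    · filter_upwards [hDM k] with t ht
      rw [← map_sub]
      refine (le_abs_self _).trans ?_
      exact (ContinuousLinearMap.le_opNorm _ _).trans
        (mul_le_mul_of_nonneg_right ht (norm_nonneg _))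
  linarith

end Steklov

/-! ### Means over the time steps -/

section Means

variable {X : Type*} [NormedAddCommGroup X] [NormedSpace ℝ X] {T : ℝ}

/-- The mean of `a` over the step `(nℓ, (n+1)ℓ)`. -/
def stepMean (l : ℝ) (a : ℝ → X) (n : ℕ) : X := l⁻¹ • ∫ t in (n * l)..((n + 1) * l), a t

lemma grid_mem (hT : 0 < T) {N n : ℕ} (hN : 1 ≤ N) (hn : n ≤ N) :
    (n : ℝ) * (T / N) ∈ Icc 0 T := by
  have hN' : (0 : ℝ) < N := by exact_mod_cast hN
  have hn' : (n : ℝ) ≤ N := by exact_mod_cast hn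
  refine ⟨by positivity, ?_⟩
  rw [mul_div_assoc', div_le_iff₀ hN', mul_comm]
  exact mul_le_mul_of_nonneg_left hn' hT.le

lemma step_pos (hT : 0 < T) {N : ℕ} (hN : 1 ≤ N) : 0 < T / N :=
  div_pos hT (by exact_mod_cast hN)

lemma step_subset (hT : 0 < T) {N n : ℕ} (hN : 1 ≤ N) (hn : n < N) :
    Icc ((n : ℝ) * (T / N)) ((n + 1) * (T / N)) ⊆ Icc 0 T := by
  have h1 := grid_mem hT hN hn.le
  have h2 := grid_mem hT hN (Nat.succ_le_of_lt hn)
  push_cast at h2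
  exact Icc_subset_Icc h1.1 h2.2

lemma step_le (hT : 0 < T) {N : ℕ} (hN : 1 ≤ N) (n : ℕ) :
    (n : ℝ) * (T / N) ≤ (n + 1) * (T / N) :=
  mul_le_mul_of_nonneg_right (by linarith) (step_pos hT hN).le

lemma stepMean_congr (hT : 0 < T) {a A : ℝ → X} (h : ∀ᵐ t ∂timeVol T, a t = A t) {N n : ℕ}
    (hN : 1 ≤ N) (hn : n < N) : stepMean (T / N) a n = stepMean (T / N) A n := by
  have hle := step_le hT hN n
  have hsub := step_subset hT hN hn
  unfold stepMean
  rw [intervalIntegral.integral_of_le hle, intervalIntegral.integral_of_le hle,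
    integral_Ioc_eq_integral_Ioo, integral_Ioc_eq_integral_Ioo]
  congr 1
  refine integral_congr_ae ?_
  refine ae_restrict_of_ae_restrict_of_subset (t := Ioo 0 T) ?_ h
  exact fun s hs => ⟨(hsub ⟨le_rfl, hle⟩).1.trans_lt hs.1, hs.2.trans_le (hsub ⟨hle, le_rfl⟩).2⟩

lemma norm_stepMean_sub_le [CompleteSpace X] (hT : 0 < T) {A : ℝ → X}
    (hA : ContinuousOn A (Icc 0 T)) {N n : ℕ} (hN : 1 ≤ N) (hn : n < N) {x : X} {ε : ℝ}
    (h : ∀ s ∈ Icc ((n : ℝ) * (T / N)) ((n + 1) * (T / N)), ‖A s - x‖ ≤ ε) :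
    ‖stepMean (T / N) A n - x‖ ≤ ε := by
  have hle := step_le hT hN n
  have hl := step_pos hT hN
  have hi : IntervalIntegrable A volume (n * (T / N)) ((n + 1) * (T / N)) :=
    ContinuousOn.intervalIntegrable_of_Icc hle (hA.mono (step_subset hT hN hn))
  have e : stepMean (T / N) A n - x =
      (T / N)⁻¹ • ∫ s in (n * (T / N))..((n + 1) * (T / N)), (A s - x) := by
    have e1 : ((n : ℝ) + 1) * (T / N) - n * (T / N) = T / N := by ring
    rw [intervalIntegral.integral_sub hi (by simp), intervalIntegral.integral_const, e1, smul_sub,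
      smul_smul, inv_mul_cancel₀ hl.ne', one_smul]
    rfl
  have h1 := intervalIntegral.norm_integral_le_of_norm_le_const
    (a := n * (T / N)) (b := (n + 1) * (T / N)) (f := fun s => A s - x) (C := ε) fun s hs => by
      rw [uIoc_of_le hle] at hs
      exact h s ⟨hs.1.le, hs.2⟩
  have e1 : |((n : ℝ) + 1) * (T / N) - n * (T / N)| = T / N := by
    rw [← sub_mul, add_sub_cancel_left, one_mul, abs_of_pos hl]
  rw [e1] at h1
  rw [e, norm_smul, Real.norm_of_nonneg (inv_pos.2 hl).le, inv_mul_le_iff₀ hl]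
  linarith

lemma norm_stepMean_succ_sub_le [CompleteSpace X] (hT : 0 < T) {A : ℝ → X}
    (hA : ContinuousOn A (Icc 0 T)) {B : ℝ → ℝ} (hB : MonotoneOn B (Icc 0 T))
    (hAB : ∀ s ∈ Icc 0 T, ∀ t ∈ Icc 0 T, s ≤ t → ‖A t - A s‖ ≤ B t - B s) {N n : ℕ}
    (hN : 1 ≤ N) (hn : n + 1 < N) :
    ‖stepMean (T / N) A (n + 1) - stepMean (T / N) A n‖ ≤
      B ((n + 2 : ℕ) * (T / N)) - B (n * (T / N)) := by
  have hl := step_pos hT hN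
  have hle := step_le hT hN n
  have hn' : n < N := by omega
  have hm0 := grid_mem hT hN hn'.le
  have hm2 := grid_mem hT hN (Nat.succ_le_of_lt hn)
  have hi : IntervalIntegrable A volume (n * (T / N)) ((n + 1) * (T / N)) :=
    ContinuousOn.intervalIntegrable_of_Icc hle (hA.mono (step_subset hT hN hn'))
  have hi1 : IntervalIntegrable A volume (n * (T / N) + T / N) ((n + 1) * (T / N) + T / N) := by
    refine ContinuousOn.intervalIntegrable_of_Icc (by linarith) (hA.mono ?_)
    have := step_subset hT hN hn
    push_cast at this
    convert this using 2 <;> ring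
  have hi2 : IntervalIntegrable (fun s => A (s + T / N)) volume (n * (T / N))
      ((n + 1) * (T / N)) := by
    have := hi1.comp_add_right (T / N)
    simpa using this
  have e : stepMean (T / N) A (n + 1) - stepMean (T / N) A n =
      (T / N)⁻¹ • ∫ s in (n * (T / N))..((n + 1) * (T / N)), (A (s + T / N) - A s) := by
    rw [intervalIntegral.integral_sub hi2 hi, intervalIntegral.integral_comp_add_right, smul_sub,
      stepMean, stepMean]
    push_cast
    congr 4 <;> ring
  have h1 := intervalIntegral.norm_integral_le_of_norm_le_const
    (a := n * (T / N)) (b := (n + 1) * (T / N)) (f := fun s => A (s + T / N) - A s)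
    (C := B ((n + 2 : ℕ) * (T / N)) - B (n * (T / N))) fun s hs => by
      rw [uIoc_of_le hle] at hs
      have hs1 := step_subset hT hN hn' ⟨hs.1.le, hs.2⟩
      have e2 : ((n + 2 : ℕ) : ℝ) * (T / N) = (n + 1) * (T / N) + T / N := by push_cast; ring
      have hs2 : s + T / N ≤ (n + 2 : ℕ) * (T / N) := by rw [e2]; linarith [hs.2]
      have hs3 : s + T / N ∈ Icc 0 T := ⟨by linarith [hs1.1], hs2.trans hm2.2⟩
      have h2 := hAB s hs1 _ hs3 (by linarith)
      have h3 := hB hm0 hs1 hs.1.le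
      have h4 := hB hs3 hm2 hs2
      linarith
  have e1 : |((n : ℝ) + 1) * (T / N) - n * (T / N)| = T / N := by
    rw [← sub_mul, add_sub_cancel_left, one_mul, abs_of_pos hl]
  rw [e1] at h1
  rw [e, norm_smul, Real.norm_of_nonneg (inv_pos.2 hl).le, inv_mul_le_iff₀ hl]
  linarith

/-- Functions in `W^{1,q}(0,T;X)` have a continuous representative whose step means are of
uniformly bounded variation. -/
lemma MemW1.exists_continuous [CompleteSpace X] (hT : 0 < T) {q : ℝ≥0∞} {a : ℝ → X}
    (ha : MemW1 q T a) :
    ∃ (A : ℝ → X) (M : ℝ), (∀ᵐ t ∂timeVol T, a t = A t) ∧ ContinuousOn A (Icc 0 T) ∧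
      ∀ N : ℕ, 1 ≤ N → (∀ n < N, ‖stepMean (T / N) a n‖ ≤ M) ∧
        ∑ n ∈ Finset.range (N - 1), ‖stepMean (T / N) a (n + 1) - stepMean (T / N) a n‖ ≤ M := by
  obtain ⟨-, b, -, hab⟩ := ha
  obtain ⟨c, hc⟩ := hab.eq_primitive hT
  have hb : Integrable b (timeVol T) := hab.2.1
  set A : ℝ → X := fun t => c + ∫ s in (0:ℝ)..t, b s
  set B : ℝ → ℝ := fun t => ∫ s in (0:ℝ)..t, ‖b s‖
  have h0 : (0 : ℝ) ∈ Icc 0 T := ⟨le_rfl, hT.le⟩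
  have hTT : T ∈ Icc 0 T := ⟨hT.le, le_rfl⟩
  have hBd : ∀ s ∈ Icc 0 T, ∀ t ∈ Icc 0 T, B t - B s = ∫ r in s..t, ‖b r‖ := fun s hs t ht =>
    intervalIntegral.integral_interval_sub_left (intervalIntegrable_of_timeVol hb.norm h0 ht)
      (intervalIntegrable_of_timeVol hb.norm h0 hs)
  have hB : MonotoneOn B (Icc 0 T) := fun s hs t ht hst => by
    rw [← sub_nonneg, hBd s hs t ht]
    exact intervalIntegral.integral_nonneg hst fun _ _ => norm_nonneg _
  have hAB : ∀ s ∈ Icc 0 T, ∀ t ∈ Icc 0 T, s ≤ t → ‖A t - A s‖ ≤ B t - B s := by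
    intro s hs t ht hst
    have e : A t - A s = ∫ r in s..t, b r := by
      simp only [A, add_sub_add_left_eq_sub]
      exact intervalIntegral.integral_interval_sub_left (intervalIntegrable_of_timeVol hb h0 ht)
        (intervalIntegrable_of_timeVol hb h0 hs)
    rw [e, hBd s hs t ht]
    exact intervalIntegral.norm_integral_le_integral_norm hst
  have hA : ContinuousOn A (Icc 0 T) := continuousOn_const.add (continuousOn_primitive_timeVol hb)
  have hA0 : A 0 = c := by simp [A]
  have hB0 : B 0 = 0 := by simp [B]
  have hBT : 0 ≤ B T := hB0 ▸ hB h0 hTT hT.le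
  refine ⟨A, ‖c‖ + 2 * B T, hc, hA, fun N hN => ⟨fun n hn => ?_, ?_⟩⟩
  · rw [stepMean_congr hT hc hN hn]
    have := norm_stepMean_sub_le hT hA hN hn (x := 0) (ε := ‖c‖ + 2 * B T) fun s hs => by
      have hs' := step_subset hT hN hn hs
      have h1 := hAB 0 h0 s hs' hs'.1
      have h2 := hB hs' hTT hs'.2
      rw [hA0, hB0] at h1
      have h3 := norm_le_norm_add_norm_sub' (A s) c
      rw [sub_zero]
      linarith
    rwa [sub_zero] at this
  · set β : ℕ → ℝ := fun n => B (n * (T / N))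
    have h1 : ∀ n ∈ Finset.range (N - 1),
        ‖stepMean (T / N) a (n + 1) - stepMean (T / N) a n‖ ≤
          (β (n + 1 + 1) - β (n + 1)) + (β (n + 1) - β n) := by
      intro n hn
      have hn' : n + 1 < N := by have := Finset.mem_range.1 hn; omega
      rw [stepMean_congr hT hc hN hn', stepMean_congr hT hc hN (by omega : n < N)]
      have := norm_stepMean_succ_sub_le hT hA hB hAB hN hn'
      rw [sub_add_sub_cancel]
      exact this
    refine (Finset.sum_le_sum h1).trans ?_
    rw [Finset.sum_add_distrib, Finset.sum_range_sub (fun n => β (n + 1)), Finset.sum_range_sub]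
    have hβ : ∀ n ≤ N, 0 ≤ β n ∧ β n ≤ B T := fun n hn => by
      have hm := grid_mem hT hN hn
      exact ⟨hB0 ▸ hB h0 hm hm.1, hB hm hTT hm.2⟩
    have g1 := hβ (N - 1 + 1) (by omega)
    have g2 := hβ (N - 1) (by omega)
    have g3 := hβ (0 + 1) (by omega)
    have g4 := hβ 0 (by omega)
    have := norm_nonneg c
    linarith

end Means

/-! ### A priori estimates -/

section Energy

variable {E : Type*} [NormedAddCommGroup E] [NormedSpace ℝ E]

lemma sum_apply_sub (f : ℕ → E →L[ℝ] ℝ) (x : ℕ → E) (m : ℕ) :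
    ∑ n ∈ Finset.range (m + 1), f n (x (n + 1) - x n) =
      f m (x (m + 1)) - f 0 (x 0) - ∑ n ∈ Finset.range m, (f (n + 1) - f n) (x (n + 1)) := by
  induction m with
  | zero => simp
  | succ m ih =>
    rw [Finset.sum_range_succ, ih, Finset.sum_range_succ _ m, sub_apply, map_sub]
    ring

lemma sum_apply_sub_le {f : ℕ → E →L[ℝ] ℝ} {x : ℕ → E} {N m : ℕ} {M R : ℝ} (hm : m ≤ N)
    (hM : ∀ n < N, ‖f n‖ ≤ M) (hM' : ∑ n ∈ Finset.range (N - 1), ‖f (n + 1) - f n‖ ≤ M)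
    (hR : ∀ n ≤ m, ‖x n‖ ≤ R) :
    ∑ n ∈ Finset.range m, f n (x (n + 1) - x n) ≤ 3 * M * R := by
  have hM0 : 0 ≤ M := (Finset.sum_nonneg fun _ _ => norm_nonneg _).trans hM'
  have hR0 : 0 ≤ R := (norm_nonneg _).trans (hR 0 (Nat.zero_le _))
  cases m with
  | zero => simpa using by positivity
  | succ m =>
    rw [sum_apply_sub]
    have hle : ∀ (g : E →L[ℝ] ℝ) (n : ℕ), n ≤ m + 1 → |g (x n)| ≤ ‖g‖ * R := fun g n hn =>
      (g.le_opNorm _).trans (mul_le_mul_of_nonneg_left (hR n hn) (norm_nonneg _))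
    have h1 := (abs_le.1 (hle (f m) (m + 1) le_rfl)).2
    have h2 := (abs_le.1 (hle (f 0) 0 (Nat.zero_le _))).1
    have h3 : -∑ n ∈ Finset.range m, (f (n + 1) - f n) (x (n + 1)) ≤
        (∑ n ∈ Finset.range (N - 1), ‖f (n + 1) - f n‖) * R := by
      rw [← Finset.sum_neg_distrib, Finset.sum_mul]
      refine (Finset.sum_le_sum fun n hn => ?_).trans
        (Finset.sum_le_sum_of_subset_of_nonneg (Finset.range_mono (by omega)) fun n _ _ =>
          mul_nonneg (norm_nonneg _) hR0)
      have := (abs_le.1 (hle (f (n + 1) - f n) (n + 1)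
        (by have := Finset.mem_range.1 hn; omega))).1
      linarith
    have h4 := mul_le_mul_of_nonneg_right (hM m (by omega)) hR0
    have h5 := mul_le_mul_of_nonneg_right (hM 0 (by omega)) hR0
    have h6 := mul_le_mul_of_nonneg_right hM' hR0
    linarith

/-- The energy estimate for implicit schemes. -/
lemma discrete_energy_bound {J : E → ℝ} {r c M : ℝ} (hr : 2 ≤ r) (hc : 0 < c)
    (hJ : ∀ x, c * ‖x‖ ^ r ≤ J x) {N : ℕ} {f : ℕ → E →L[ℝ] ℝ} {x : ℕ → E} {Q : ℕ → ℝ}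
    (hM : ∀ n < N, ‖f n‖ ≤ M) (hM' : ∑ n ∈ Finset.range (N - 1), ‖f (n + 1) - f n‖ ≤ M)
    (hQ : ∀ n < N, 0 ≤ Q n)
    (hstep : ∀ n < N, Q n + J (x (n + 1)) - J (x n) ≤ f n (x (n + 1) - x n)) :
    (∀ n ≤ N, ‖x n‖ ≤ max 1 ((J (x 0) + 3 * M) / c)) ∧
      ∑ n ∈ Finset.range N, Q n ≤ J (x 0) + 3 * M * max 1 ((J (x 0) + 3 * M) / c) := by
  have hM0 : 0 ≤ M := (Finset.sum_nonneg fun _ _ => norm_nonneg _).trans hM'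
  have hJ0 : ∀ y, 0 ≤ J y := fun y =>
    (mul_nonneg hc.le (Real.rpow_nonneg (norm_nonneg _) _)).trans (hJ y)
  have hsum : ∀ m ≤ N, ∑ n ∈ Finset.range m, Q n + J (x m) - J (x 0) ≤
      ∑ n ∈ Finset.range m, f n (x (n + 1) - x n) := by
    intro m hm
    rw [add_sub_assoc, ← Finset.sum_range_sub (fun n => J (x n)) m, ← Finset.sum_add_distrib]
    refine Finset.sum_le_sum fun n hn => ?_
    have := hstep n ((Finset.mem_range.1 hn).trans_le hm)
    linarith
  set R := max 1 ((J (x 0) + 3 * M) / c)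
  have hR : ∀ n ≤ N, ‖x n‖ ≤ R := by
    obtain ⟨k, hk, hmax⟩ := Finset.exists_max_image (Finset.range (N + 1)) (fun n => ‖x n‖)
      ⟨0, by simp⟩
    have hkN : k ≤ N := by have := Finset.mem_range.1 hk; omega
    have hmax' : ∀ n ≤ N, ‖x n‖ ≤ ‖x k‖ := fun n hn => hmax n (by simp; omega)
    refine fun n hn => (hmax' n hn).trans ?_
    rcases le_total ‖x k‖ 1 with h | h
    · exact h.trans (le_max_left _ _)
    · refine le_trans ?_ (le_max_right _ _)
      have h1 := hsum k hkN
      have h2 := sum_apply_sub_le hkN hM hM' fun n hn => hmax' n (hn.trans hkN)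
      have h3 : 0 ≤ ∑ n ∈ Finset.range k, Q n :=
        Finset.sum_nonneg fun n hn => hQ n ((Finset.mem_range.1 hn).trans_le hkN)
      have h4 : ‖x k‖ * ‖x k‖ ≤ ‖x k‖ ^ r := by
        rw [← sq, ← Real.rpow_two]
        exact Real.rpow_le_rpow_of_exponent_le h hr
      have h5 := hJ (x k)
      have h6 := mul_le_mul_of_nonneg_left h4 hc.le
      have h7 : J (x 0) ≤ J (x 0) * ‖x k‖ := le_mul_of_one_le_right (hJ0 _) h
      rw [le_div_iff₀ hc]
      refine le_of_mul_le_mul_right ?_ (zero_lt_one.trans_le h)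
      linarith
  refine ⟨hR, ?_⟩
  have h1 := hsum N le_rfl
  have h2 := sum_apply_sub_le le_rfl hM hM' hR
  have := hJ0 (x N)
  linarith

end Energy

/-- A priori estimates for the semi-discrete scheme. -/
theorem exists_a_priori_bounds {T κ : ℝ} (hT : 0 < T) (hκ : 0 < κ) (μ : Coefficient Ω)
    {a : ℝ → Ω.CClosure} (ha : MemW1 p.pE T a) (u₀ : W0 Ω p) :
    ∃ R C M : ℝ, 0 ≤ C ∧ ∀ (N : ℕ) (u : ℕ → W0 Ω p), 1 ≤ N → IsDiscreteSolution T κ μ a u₀ N u →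
      (∀ n ≤ N, ‖u n‖ ≤ R) ∧
      ∑ n ∈ Finset.range N, ‖halfPow (u (n + 1)) - halfPow (u n)‖ ^ 2 ≤ C * (T / N) ∧
      ∀ n < N, ‖(T / N)⁻¹ •
        (alphaConjToDual (fullPow (u (n + 1))) - alphaConjToDual (fullPow (u n)))‖ ≤ M := by
  obtain ⟨-, Ma, -, -, hMa⟩ := ha.exists_continuous hT
  obtain ⟨c, hc, hJ⟩ := energy_nonneg_aux μ p hκ
  set L := ‖contToDualL Ω p‖
  set M₁ := L * Ma
  set R := max 1 ((energy μ κ u₀ + 3 * M₁) / c)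
  set C₁ := energy μ κ u₀ + 3 * M₁ * R
  obtain ⟨M₂, hM₂⟩ := exists_norm_opB_le μ p κ R
  have hmono := p.monoConst_pos
  have hL : 0 ≤ L := norm_nonneg (contToDualL Ω p)
  have hMa0 : 0 ≤ Ma := (norm_nonneg _).trans ((hMa 1 le_rfl).1 0 one_pos)
  have hE0 : 0 ≤ energy μ κ u₀ :=
    (mul_nonneg hc.le (Real.rpow_nonneg (norm_nonneg _) _)).trans (hJ u₀)
  have hR0 : 0 ≤ R := zero_le_one.trans (le_max_left _ _)
  refine ⟨R, p.monoConst * C₁, M₁ + M₂, by positivity, fun N u hN hu => ?_⟩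
  have hl := step_pos hT hN
  set f : ℕ → WDual Ω p := fun n => contToDualL Ω p (stepMean (T / N) a n)
  set q : ℕ → WDual Ω p := fun n =>
    alphaConjToDual (fullPow (u (n + 1))) - alphaConjToDual (fullPow (u n))
  have heq : ∀ n < N, (T / N)⁻¹ • q n + opB μ κ (u (n + 1)) = f n := fun n hn => hu.2 n hn
  have hf : ∀ n < N, ‖f n‖ ≤ M₁ := fun n hn =>
    ((contToDualL Ω p).le_opNorm _).trans
      (mul_le_mul_of_nonneg_left ((hMa N hN).1 n hn) hL)
  have hf' : ∑ n ∈ Finset.range (N - 1), ‖f (n + 1) - f n‖ ≤ M₁ := by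
    refine le_trans (Finset.sum_le_sum fun n _ => ?_) ((Finset.mul_sum _ _ _).symm.le.trans
      (mul_le_mul_of_nonneg_left (hMa N hN).2 hL))
    have : f (n + 1) - f n =
        contToDualL Ω p (stepMean (T / N) a (n + 1) - stepMean (T / N) a n) :=
      (map_sub _ _ _).symm
    rw [this]
    exact (contToDualL Ω p).le_opNorm _
  set Q : ℕ → ℝ := fun n => (p.monoConst * (T / N))⁻¹ * ‖halfPow (u (n + 1)) - halfPow (u n)‖ ^ 2
  have hstep : ∀ n < N, Q n + energy μ κ (u (n + 1)) - energy μ κ (u n) ≤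
      f n (u (n + 1) - u n) := by
    intro n hn
    have h1 := energy_sub_le μ hκ (u (n + 1)) (u n)
    have h2 := norm_halfPow_sub_sq_le (u (n + 1)) (u n)
    have h3 : f n (u (n + 1) - u n) =
        (T / N)⁻¹ * q n (u (n + 1) - u n) + opB μ κ (u (n + 1)) (u (n + 1) - u n) := by
      rw [← heq n hn]
      rfl
    have h4 : Q n ≤ (T / N)⁻¹ * q n (u (n + 1) - u n) := by
      simp only [Q]
      rw [mul_inv, mul_comm p.monoConst⁻¹, mul_assoc]
      refine mul_le_mul_of_nonneg_left ?_ (inv_pos.2 hl).le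
      rw [inv_mul_le_iff₀ hmono]
      exact h2
    linarith
  have hb := discrete_energy_bound (J := energy μ κ) (by linarith [p.two_lt] : 2 ≤ p.val) hc hJ
    hf hf' (Q := Q) (fun n _ => by positivity) hstep
  rw [hu.1] at hb
  refine ⟨hb.1, ?_, fun n hn => ?_⟩
  · have h1 := hb.2
    simp only [Q] at h1
    rw [← Finset.mul_sum, inv_mul_le_iff₀ (by positivity)] at h1
    refine h1.trans (le_of_eq ?_)
    ring
  · have e : (T / N)⁻¹ • q n = f n - opB μ κ (u (n + 1)) := eq_sub_of_add_eq (heq n hn)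
    change ‖(T / N)⁻¹ • q n‖ ≤ _
    rw [e]
    have h1 := norm_sub_le (f n) (opB μ κ (u (n + 1)))
    have h2 := hM₂ _ (hb.1 (n + 1) hn)
    have h3 := hf n hn
    linarith

/-! ### Extraction of a subsequence converging at every time -/

lemma norm_sub_sq_le_mul_sum {E : Type*} [NormedAddCommGroup E] (v : ℕ → E) {n m N : ℕ}
    (hnm : n ≤ m) (hmN : m ≤ N) :
    ‖v m - v n‖ ^ 2 ≤ ((m : ℝ) - n) * ∑ j ∈ Finset.range N, ‖v (j + 1) - v j‖ ^ 2 := by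
  have e : v m - v n = ∑ j ∈ Finset.Ico n m, (v (j + 1) - v j) :=
    (Finset.sum_Ico_sub v hnm).symm
  have h1 : ‖v m - v n‖ ≤ ∑ j ∈ Finset.Ico n m, ‖v (j + 1) - v j‖ := by
    rw [e]
    exact norm_sum_le _ _
  have h2 := sq_sum_le_card_mul_sum_sq (s := Finset.Ico n m) (f := fun j => ‖v (j + 1) - v j‖)
  rw [Nat.card_Ico, Nat.cast_sub hnm] at h2
  have h3 : ∑ j ∈ Finset.Ico n m, ‖v (j + 1) - v j‖ ^ 2 ≤
      ∑ j ∈ Finset.range N, ‖v (j + 1) - v j‖ ^ 2 := by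
    refine Finset.sum_le_sum_of_subset_of_nonneg (fun j hj => ?_) fun _ _ _ => by positivity
    have := Finset.mem_Ico.1 hj
    exact Finset.mem_range.2 (by omega)
  have h4 : (0 : ℝ) ≤ (m : ℝ) - n := sub_nonneg.2 (by exact_mod_cast hnm)
  exact (pow_le_pow_left₀ (norm_nonneg _) h1 2).trans
    (h2.trans (mul_le_mul_of_nonneg_left h3 h4))

lemma norm_interp_sub_sq_le {E : Type*} [NormedAddCommGroup E] {T C : ℝ} (hT : 0 < T)
    {N : ℕ} (hN : 1 ≤ N) {v : ℕ → E}
    (hv : ∑ j ∈ Finset.range N, ‖v (j + 1) - v j‖ ^ 2 ≤ C * (T / N)) {s t : ℝ}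
    (hs : s ∈ Icc 0 T) (ht : t ∈ Icc 0 T) :
    ‖interp (T / N) v t - interp (T / N) v s‖ ^ 2 ≤ C * (|t - s| + T / N) := by
  have hl := step_pos hT hN
  have key : ∀ s ∈ Icc 0 T, ∀ t ∈ Icc 0 T, s ≤ t →
      ‖interp (T / N) v t - interp (T / N) v s‖ ^ 2 ≤ C * (t - s + T / N) := by
    intro s hs t ht hst
    have h1 : s / (T / N) ≤ ⌈s / (T / N)⌉₊ := Nat.le_ceil _
    have h2 : (⌈t / (T / N)⌉₊ : ℝ) < t / (T / N) + 1 :=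
      Nat.ceil_lt_add_one (div_nonneg ht.1 hl.le)
    have hle : ⌈s / (T / N)⌉₊ ≤ ⌈t / (T / N)⌉₊ :=
      Nat.ceil_mono (div_le_div_of_nonneg_right hst hl.le)
    have h3 := norm_sub_sq_le_mul_sum v hle (ceil_le_of_mem hT hN ht.2)
    have h4 : (⌈t / (T / N)⌉₊ : ℝ) - ⌈s / (T / N)⌉₊ ≤ (t - s) / (T / N) + 1 := by
      rw [sub_div]
      linarith
    have h5 : (0 : ℝ) ≤ (t - s) / (T / N) + 1 :=
      add_nonneg (div_nonneg (sub_nonneg.2 hst) hl.le) zero_le_one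
    calc ‖interp (T / N) v t - interp (T / N) v s‖ ^ 2
        ≤ ((t - s) / (T / N) + 1) * (C * (T / N)) :=
          h3.trans (mul_le_mul h4 hv (Finset.sum_nonneg fun _ _ => by positivity) h5)
      _ = C * (((t - s) / (T / N)) * (T / N) + T / N) := by ring
      _ = C * (t - s + T / N) := by rw [div_mul_cancel₀ _ hl.ne']
  rcases le_total s t with h | h
  · rw [abs_of_nonneg (sub_nonneg.2 h)]
    exact key s hs t ht h
  · rw [norm_sub_rev, abs_sub_comm, abs_of_nonneg (sub_nonneg.2 h)]
    exact key t ht s hs h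

lemma cauchySeq_of_approx {E : Type*} [NormedAddCommGroup E] {x : ℕ → E}
    (h : ∀ ε > 0, ∃ y : ℕ → E, CauchySeq y ∧ ∀ᶠ k in atTop, ‖x k - y k‖ ≤ ε) : CauchySeq x := by
  rw [Metric.cauchySeq_iff]
  intro ε hε
  obtain ⟨y, hy, hxy⟩ := h (ε / 4) (by positivity)
  obtain ⟨K, hK⟩ := Metric.cauchySeq_iff.1 hy (ε / 4) (by positivity)
  obtain ⟨K', hK'⟩ := eventually_atTop.1 hxy
  refine ⟨max K K', fun m hm n hn => ?_⟩
  have h1 := hK m (le_of_max_le_left hm) n (le_of_max_le_left hn)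
  have h2 := hK' m (le_of_max_le_right hm)
  have h3 := hK' n (le_of_max_le_right hn)
  rw [dist_eq_norm] at h1 ⊢
  have e : x m - x n = (x m - y m) + (y m - y n) - (x n - y n) := by abel
  have h4 := norm_sub_le ((x m - y m) + (y m - y n)) (x n - y n)
  have h5 := norm_add_le (x m - y m) (y m - y n)
  rw [e]
  linarith

/-- Measurability in `W₀^{1,p}(Ω)` can be checked in `L^p(Ω)`. -/
lemma W0.stronglyMeasurable_of_fn {w : ℝ → W0 Ω p} (h : StronglyMeasurable fun t => (w t).fn) :
    StronglyMeasurable w := by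
  borelize (W0 Ω p)
  let _ : MeasurableSpace (Lp ℝ p.pE Ω.vol) := borel _
  have _ : BorelSpace (Lp ℝ p.pE Ω.vol) := ⟨rfl⟩
  have he : MeasurableEmbedding (W0.fnL : W0 Ω p →L[ℝ] Lp ℝ p.pE Ω.vol) :=
    W0.fnL.continuous.measurableEmbedding W0.fnL_injective
  exact (he.measurable_comp_iff.1 h.measurable).stronglyMeasurable

theorem exists_convergent_subsequence {T R C : ℝ} (hT : 0 < T) (hC : 0 ≤ C) {u : ℕ → ℕ → W0 Ω p}
    {u₀ : W0 Ω p} (h0 : ∀ N, 1 ≤ N → u N 0 = u₀) (hR : ∀ N, 1 ≤ N → ∀ n ≤ N, ‖u N n‖ ≤ R)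
    (hS : ∀ N, 1 ≤ N →
      ∑ n ∈ Finset.range N, ‖halfPow (u N (n + 1)) - halfPow (u N n)‖ ^ 2 ≤ C * (T / N)) :
    ∃ (N : ℕ → ℕ) (w : ℝ → W0 Ω p), StrictMono N ∧ (∀ k, 1 ≤ N k) ∧ (∀ t, ‖w t‖ ≤ R) ∧
      (∀ t, w (clamp T t) = w t) ∧ StronglyMeasurable w ∧ w 0 = u₀ ∧
      (∀ s ∈ Icc 0 T, ∀ t ∈ Icc 0 T, ‖halfPow (w t) - halfPow (w s)‖ ^ 2 ≤ C * |t - s|) ∧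
      ∀ t ∈ Icc 0 T,
        Tendsto (fun k => (interp (T / N k) (u (N k)) t).fn) atTop (𝓝 (w t).fn) ∧
        ∀ f : WDual Ω p,
          Tendsto (fun k => f (interp (T / N k) (u (N k)) t)) atTop (𝓝 (f (w t))) := by
  have hUR : ∀ N : ℕ, 1 ≤ N → ∀ t ∈ Icc 0 T, ‖interp (T / N) (u N) t‖ ≤ R := fun N hN t ht =>
    hR N hN _ (ceil_le_of_mem hT hN ht.2)
  obtain ⟨K, hK, hKR⟩ := W0.exists_compact Ω p R
  obtain ⟨y, -, φ, hφ, hlim⟩ := (isCompact_univ_pi fun _ : ℚ => hK).tendsto_subseq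
    (x := fun k (q : ℚ) => (interp (T / (k + 1 : ℕ)) (u (k + 1)) (clamp T q)).fn)
    fun k q _ => hKR _ (hUR _ (Nat.le_add_left _ _) _ (clamp_mem hT.le _))
  set N : ℕ → ℕ := fun k => φ k + 1
  have hN1 : ∀ k, 1 ≤ N k := fun k => Nat.le_add_left _ _
  have hNm : StrictMono N := fun i j hij => Nat.add_lt_add_right (hφ hij) 1
  have hlz : Tendsto (fun k => T / N k) atTop (𝓝 0) :=
    (tendsto_const_div_atTop_nhds_zero_nat T).comp hNm.tendsto_atTop
  set U : ℕ → ℝ → W0 Ω p := fun k => interp (T / N k) (u (N k))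
  have hUR' : ∀ k, ∀ t ∈ Icc 0 T, ‖U k t‖ ≤ R := fun k t ht => hUR _ (hN1 k) t ht
  have hV : ∀ k, ∀ s ∈ Icc 0 T, ∀ t ∈ Icc 0 T,
      ‖halfPow (U k t) - halfPow (U k s)‖ ^ 2 ≤ C * (|t - s| + T / N k) := fun k s hs t ht =>
    norm_interp_sub_sq_le (v := fun n => halfPow (u (N k) n)) hT (hN1 k) (hS _ (hN1 k)) hs ht
  have hq : ∀ q : ℚ, CauchySeq fun k => halfPow (U k (clamp T q)) := fun q => by
    have h1 : Tendsto (fun k => (U k (clamp T q)).fn) atTop (𝓝 (y q)) := (tendsto_pi_nhds.1 hlim) q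
    obtain ⟨x, hx, -, -⟩ := W0.exists_weak_limit _ R (fun k => hUR' k _ (clamp_mem hT.le _)) _ h1
    rw [← hx] at h1
    exact (tendsto_halfPow h1).cauchySeq
  have hcauchy : ∀ t ∈ Icc 0 T, CauchySeq fun k => halfPow (U k t) := fun t ht => by
    refine cauchySeq_of_approx fun ε hε => ?_
    obtain ⟨δ, hδ, hCδ⟩ : ∃ δ > 0, C * (2 * δ) ≤ ε ^ 2 := by
      refine ⟨ε ^ 2 / (2 * (C + 1)), by positivity, ?_⟩
      rw [mul_div_assoc', mul_div_assoc', div_le_iff₀ (by positivity)]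
      nlinarith [sq_nonneg ε]
    obtain ⟨q, hq1, hq2⟩ := exists_rat_btwn (show t < t + δ by linarith)
    have hqt : |t - clamp T q| ≤ δ := by
      have h1 : t ≤ clamp T q := le_max_of_le_right (le_min hq1.le ht.2)
      have h2 : clamp T q ≤ q := max_le (ht.1.trans hq1.le) (min_le_left _ _)
      rw [abs_sub_comm, abs_of_nonneg (by linarith)]
      linarith
    refine ⟨_, hq q, ?_⟩
    filter_upwards [hlz.eventually (gt_mem_nhds hδ)] with k hk
    have h1 := hV k _ (clamp_mem hT.le q) t ht
    refine le_of_sq_le_sq ?_ hε.le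
    refine h1.trans (le_trans (mul_le_mul_of_nonneg_left ?_ hC) hCδ)
    linarith
  have hex : ∀ t : ℝ, ∃ x : W0 Ω p, ‖x‖ ≤ R ∧
      Tendsto (fun k => (U k (clamp T t)).fn) atTop (𝓝 x.fn) ∧
      ∀ f : WDual Ω p, Tendsto (fun k => f (U k (clamp T t))) atTop (𝓝 (f x)) := fun t => by
    obtain ⟨V, hV⟩ := cauchySeq_tendsto_of_complete (hcauchy _ (clamp_mem hT.le t))
    obtain ⟨x, h1, -, h2, h3⟩ := W0.exists_limit_of_halfPow _ R
      (fun k => hUR' k _ (clamp_mem hT.le t)) V hV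
    exact ⟨x, h1, h2, h3⟩
  choose w hw1 hw2 hw3 using hex
  have hwc : ∀ t, w (clamp T t) = w t := fun t => by
    refine W0.ext_fn (tendsto_nhds_unique (hw2 (clamp T t)) ?_)
    rw [clamp_of_mem (clamp_mem hT.le t)]
    exact hw2 t
  refine ⟨N, w, hNm, hN1, hw1, hwc, ?_, ?_, fun s hs t ht => ?_, fun t ht => ?_⟩
  · refine W0.stronglyMeasurable_of_fn (stronglyMeasurable_of_tendsto atTop (fun k => ?_)
      (tendsto_pi_nhds.2 hw2))
    exact (stronglyMeasurable_comp_ceil (T / N k) fun n => (u (N k) n).fn).comp_measurable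
      (continuous_clamp T).measurable
  · refine W0.ext_fn (tendsto_nhds_unique (hw2 0) ?_)
    have h00 : ∀ k, U k (clamp T 0) = u₀ := fun k => by
      rw [clamp_of_le le_rfl, ← h0 (N k) (hN1 k)]
      simp [U, interp]
    simp only [h00]
    exact tendsto_const_nhds
  · have h1 := tendsto_halfPow (hw2 t)
    have h2 := tendsto_halfPow (hw2 s)
    rw [clamp_of_mem ht] at h1
    rw [clamp_of_mem hs] at h2
    have h3 := ((tendsto_const_nhds (x := |t - s|)).add hlz).const_mul C
    rw [add_zero] at h3
    exact le_of_tendsto_of_tendsto' ((h1.sub h2).norm.pow 2) h3 fun k => hV k s hs t ht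
  · have h2 := hw2 t
    have h3 := hw3 t
    rw [clamp_of_mem ht] at h2 h3
    exact ⟨h2, h3⟩

/-! ### Strong convergence -/

/-- Solutions `u k` of the semi-discrete scheme with `N k` steps, which satisfy uniform bounds and
converge at every time to `w`. -/
structure ConvergentScheme (T κ : ℝ) (μ : Coefficient Ω) (a : ℝ → Ω.CClosure) (u₀ : W0 Ω p)
    (N : ℕ → ℕ) (u : ℕ → ℕ → W0 Ω p) (w : ℝ → W0 Ω p) (A : ℝ → Ω.CClosure)
    (R C M L : ℝ) : Prop where
  pos : 0 < T
  strictMono : StrictMono N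
  one_le : ∀ k, 1 ≤ N k
  sol : ∀ k, IsDiscreteSolution T κ μ a u₀ (N k) (u k)
  norm_le : ∀ k, ∀ n ≤ N k, ‖u k n‖ ≤ R
  sum_le : ∀ k, ∑ n ∈ Finset.range (N k), ‖halfPow (u k (n + 1)) - halfPow (u k n)‖ ^ 2 ≤
    C * (T / N k)
  quot_le : ∀ k, ∀ n < N k, ‖(T / N k)⁻¹ •
    (alphaConjToDual (fullPow (u k (n + 1))) - alphaConjToDual (fullPow (u k n)))‖ ≤ M
  mean_le : ∀ k, ∀ n < N k, ‖stepMean (T / N k) a n‖ ≤ L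
  ae_eq : ∀ᵐ t ∂timeVol T, a t = A t
  continuousOn : ContinuousOn A (Icc 0 T)
  norm_lim_le : ∀ t, ‖w t‖ ≤ R
  clamp_eq : ∀ t, w (clamp T t) = w t
  stronglyMeasurable : StronglyMeasurable w
  zero_eq : w 0 = u₀
  holder : ∀ s ∈ Icc 0 T, ∀ t ∈ Icc 0 T, ‖halfPow (w t) - halfPow (w s)‖ ^ 2 ≤ C * |t - s|
  tendsto_fn : ∀ t ∈ Icc 0 T, Tendsto (fun k => (interp (T / N k) (u k) t).fn) atTop (𝓝 (w t).fn)
  tendsto_weak : ∀ t ∈ Icc 0 T, ∀ f : WDual Ω p,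
    Tendsto (fun k => f (interp (T / N k) (u k) t)) atTop (𝓝 (f (w t)))

namespace ConvergentScheme

variable {T κ : ℝ} {μ : Coefficient Ω} {a : ℝ → Ω.CClosure} {u₀ : W0 Ω p} {N : ℕ → ℕ}
  {u : ℕ → ℕ → W0 Ω p} {w : ℝ → W0 Ω p} {A : ℝ → Ω.CClosure} {R C M L : ℝ}

lemma comp (H : ConvergentScheme T κ μ a u₀ N u w A R C M L) {φ : ℕ → ℕ} (hφ : StrictMono φ) :
    ConvergentScheme T κ μ a u₀ (N ∘ φ) (u ∘ φ) w A R C M L where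
  pos := H.pos
  strictMono := H.strictMono.comp hφ
  one_le _ := H.one_le _
  sol _ := H.sol _
  norm_le _ := H.norm_le _
  sum_le _ := H.sum_le _
  quot_le _ := H.quot_le _
  mean_le _ := H.mean_le _
  ae_eq := H.ae_eq
  continuousOn := H.continuousOn
  norm_lim_le := H.norm_lim_le
  clamp_eq := H.clamp_eq
  stronglyMeasurable := H.stronglyMeasurable
  zero_eq := H.zero_eq
  holder := H.holder
  tendsto_fn t ht := (H.tendsto_fn t ht).comp hφ.tendsto_atTop
  tendsto_weak t ht f := (H.tendsto_weak t ht f).comp hφ.tendsto_atTop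

variable (H : ConvergentScheme T κ μ a u₀ N u w A R C M L)
include H

lemma tendsto_step : Tendsto (fun k => T / N k) atTop (𝓝 0) :=
  (tendsto_const_div_atTop_nhds_zero_nat T).comp H.strictMono.tendsto_atTop

lemma nonneg_M : 0 ≤ M :=
  (norm_nonneg ((T / N 0)⁻¹ • (alphaConjToDual (fullPow (u 0 1)) -
    alphaConjToDual (fullPow (u 0 0))) : WDual Ω p)).trans (H.quot_le 0 0 (H.one_le 0))

lemma norm_interp_le (k : ℕ) {t : ℝ} (ht : t ≤ T) : ‖interp (T / N k) (u k) t‖ ≤ R :=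
  H.norm_le k _ (ceil_le_of_mem H.pos (H.one_le k) ht)

/-- At positive times, the index of the current step. -/
lemma exists_index (k : ℕ) {t : ℝ} (ht : t ∈ Ioc 0 T) :
    ∃ n < N k, ⌈t / (T / N k)⌉₊ = n + 1 ∧ n * (T / N k) < t ∧ t ≤ (n + 1) * (T / N k) := by
  have h1 := ceil_pos_of_mem H.pos (H.one_le k) ht.1
  have h2 := ceil_le_of_mem H.pos (H.one_le k) ht.2
  have hl := step_pos H.pos (H.one_le k)
  obtain ⟨n, hn⟩ := Nat.exists_eq_succ_of_ne_zero h1.ne'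
  have h3 := (Nat.ceil_eq_iff (Nat.succ_ne_zero n)).1 hn
  refine ⟨n, by omega, hn, ?_, ?_⟩
  · have := h3.1
    rwa [lt_div_iff₀ hl, Nat.succ_sub_one] at this
  · have := h3.2
    rw [div_le_iff₀ hl] at this
    exact_mod_cast this

lemma norm_diffQuot_le (k : ℕ) {t : ℝ} (ht : t ∈ Ioc 0 T) :
    ‖diffQuot (T / N k) (fun n => alphaConjToDual (fullPow (u k n))) t‖ ≤ M := by
  obtain ⟨n, hn, e, -, -⟩ := H.exists_index k ht
  rw [diffQuot, e, Nat.add_sub_cancel]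
  exact H.quot_le k n hn

lemma diffQuot_eq_source (k : ℕ) {t : ℝ} (ht : t ∈ Ioc 0 T) :
    diffQuot (T / N k) (fun n => alphaConjToDual (fullPow (u k n))) t =
      contToDualL Ω p (stepMean (T / N k) a (⌈t / (T / N k)⌉₊ - 1))
        - opB μ κ (interp (T / N k) (u k) t) := by
  obtain ⟨n, hn, e, -, -⟩ := H.exists_index k ht
  rw [diffQuot, interp, e, Nat.add_sub_cancel]
  exact eq_sub_of_add_eq ((H.sol k).2 n hn)

lemma norm_source_le (k : ℕ) {t : ℝ} (ht : t ∈ Ioc 0 T) :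
    ‖contToDualL Ω p (stepMean (T / N k) a (⌈t / (T / N k)⌉₊ - 1))‖ ≤ ‖contToDualL Ω p‖ * L := by
  obtain ⟨n, hn, e, -, -⟩ := H.exists_index k ht
  rw [e, Nat.add_sub_cancel]
  exact ((contToDualL Ω p).le_opNorm _).trans
    (mul_le_mul_of_nonneg_left (H.mean_le k n hn) (norm_nonneg (contToDualL Ω p)))

lemma tendsto_source {t : ℝ} (ht : t ∈ Ioc 0 T) :
    Tendsto (fun k => contToDualL Ω p (stepMean (T / N k) a (⌈t / (T / N k)⌉₊ - 1))) atTop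
      (𝓝 (contToDualL Ω p (A t))) := by
  refine ((contToDualL Ω p).continuous.tendsto _).comp ?_
  rw [tendsto_iff_norm_sub_tendsto_zero]
  refine Metric.tendsto_nhds.2 fun ε hε => ?_
  have hc := Metric.continuousWithinAt_iff.1 (H.continuousOn t (Ioc_subset_Icc_self ht))
    (ε / 2) (half_pos hε)
  obtain ⟨δ, hδ, hc⟩ := hc
  filter_upwards [H.tendsto_step.eventually (gt_mem_nhds hδ)] with k hk
  obtain ⟨n, hn, e, h1, h2⟩ := H.exists_index k ht
  rw [e, Nat.add_sub_cancel, stepMean_congr H.pos H.ae_eq (H.one_le k) hn]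
  have := norm_stepMean_sub_le H.pos H.continuousOn (H.one_le k) hn (x := A t) (ε := ε / 2)
    fun s hs => by
      rw [← dist_eq_norm]
      refine (hc (step_subset H.pos (H.one_le k) hn hs) ?_).le
      rw [Real.dist_eq, abs_lt]
      constructor <;> linarith [hs.1, hs.2]
  rw [dist_zero_right, norm_norm]
  linarith

lemma tendsto_primitive {t : ℝ} (ht : t ∈ Icc 0 T) :
    Tendsto (fun k => ∫ s in (0:ℝ)..t,
        diffQuot (T / N k) (fun n => alphaConjToDual (fullPow (u k n))) s) atTop
      (𝓝 ((alphaConjToDual (fullPow (w t)) : WDual Ω p) - alphaConjToDual (fullPow (w 0)))) := by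
  have hM := H.nonneg_M
  set v : ℕ → ℕ → WDual Ω p := fun k n => alphaConjToDual (fullPow (u k n))
  have h1 : Tendsto (fun k => v k ⌈t / (T / N k)⌉₊) atTop
      (𝓝 (alphaConjToDual (fullPow (w t)))) :=
    ((alphaConjToDualL Ω p).continuous.tendsto _).comp (tendsto_fullPow (H.tendsto_fn t ht))
  have h0 : ∀ k, v k 0 = alphaConjToDual (fullPow (w 0)) := fun k => by
    rw [H.zero_eq, ← (H.sol k).1]
  have h2 : Tendsto (fun k => v k 0 + (∫ s in (0:ℝ)..t, diffQuot (T / N k) (v k) s)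
      - v k ⌈t / (T / N k)⌉₊) atTop (𝓝 0) := by
    refine squeeze_zero_norm (a := fun k => M * (T / N k)) (fun k => ?_) ?_
    · have hl := step_pos H.pos (H.one_le k)
      refine (norm_primitive_diffQuot_sub_le hl (v k) ht.1).trans ?_
      rcases ht.1.eq_or_lt with rfl | h
      · simpa using by positivity
      · have := H.norm_diffQuot_le k ⟨h, ht.2⟩
        rw [diffQuot, norm_smul, norm_inv, Real.norm_of_nonneg hl.le,
          inv_mul_le_iff₀ hl, mul_comm] at this
        exact this
    · simpa using H.tendsto_step.const_mul M
  have h3 := (h2.add h1).sub_const (alphaConjToDual (fullPow (w 0)))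
  rw [zero_add] at h3
  refine h3.congr fun k => ?_
  rw [sub_add_cancel, h0, add_sub_cancel_left]

lemma continuousOn_halfPow : ContinuousOn (fun t => halfPow (w t)) (Icc 0 T) := by
  intro s hs
  have h1 : Tendsto (fun t => C * |t - s|) (𝓝[Icc 0 T] s) (𝓝 0) := by
    have : Continuous fun t => C * |t - s| := by fun_prop
    simpa using (this.tendsto s).mono_left nhdsWithin_le_nhds
  have h2 : Tendsto (fun t => ‖halfPow (w t) - halfPow (w s)‖ ^ 2) (𝓝[Icc 0 T] s) (𝓝 0) := by
    refine squeeze_zero' (Eventually.of_forall fun _ => by positivity) ?_ h1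
    filter_upwards [self_mem_nhdsWithin] with t ht using H.holder s hs t ht
  rw [ContinuousWithinAt, tendsto_iff_norm_sub_tendsto_zero]
  have h3 := h2.sqrt
  simpa [Real.sqrt_sq] using h3

lemma mul_T (k : ℕ) : (N k : ℝ) * (T / N k) = T := by
  have : (0 : ℝ) < N k := by exact_mod_cast H.one_le k
  field_simp

lemma interp_T (k : ℕ) : interp (T / N k) (u k) T = u k (N k) := by
  have : (0 : ℝ) < N k := by exact_mod_cast H.one_le k
  have hT := H.pos
  rw [interp, div_div_cancel₀ hT.ne', Nat.ceil_natCast]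

/-- Lower bound for the pairing of the solution with its discrete time derivative. -/
lemma le_integral_diffQuot_apply (k : ℕ)
    (hint : Integrable (fun t => diffQuot (T / N k) (fun n => alphaConjToDual (fullPow (u k n))) t
      (interp (T / N k) (u k) t)) (timeVol T)) :
    1 / p.alphaConj * (‖halfPow (interp (T / N k) (u k) T)‖ ^ 2 - ‖halfPow u₀‖ ^ 2) ≤
      ∫ t, diffQuot (T / N k) (fun n => alphaConjToDual (fullPow (u k n))) t
        (interp (T / N k) (u k) t) ∂timeVol T := by
  have hl := step_pos H.pos (H.one_le k)
  have hg := diffQuot_integral_grid hl (fun n => 1 / p.alphaConj * ‖halfPow (u k n)‖ ^ 2) (N k)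
  rw [H.mul_T] at hg
  rw [H.interp_T, mul_sub, ← (H.sol k).1, ← hg.2, intervalIntegral_eq_timeVol _ H.pos.le]
  refine integral_mono_ae ?_ hint (Eventually.of_forall fun t => ?_)
  · have := hg.1
    rw [intervalIntegrable_iff_integrableOn_Ioo_of_le H.pos.le] at this
    exact this
  · have := alphaConjToDual_sub_apply_ge (u k ⌈t / (T / N k)⌉₊) (u k (⌈t / (T / N k)⌉₊ - 1))
    simp only [diffQuot, interp]
    rw [smul_apply, smul_eq_mul, smul_eq_mul, ← mul_sub]
    exact mul_le_mul_of_nonneg_left this (inv_pos.2 hl).le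

lemma integrable_apply {f : ℝ → WDual Ω p} {z : ℝ → W0 Ω p} {K K' : ℝ}
    (hf : AEStronglyMeasurable f (timeVol T)) (hz : AEStronglyMeasurable z (timeVol T))
    (hfK : ∀ t ∈ Ioc 0 T, ‖f t‖ ≤ K) (hzK : ∀ t ∈ Ioc 0 T, ‖z t‖ ≤ K') :
    Integrable (fun t => f t (z t)) (timeVol T) := by
  have hTT : T ∈ Ioc 0 T := ⟨H.pos, le_rfl⟩
  refine (integrable_const (K * K')).mono'
    (continuous_dual_apply.comp_aestronglyMeasurable (hf.prodMk hz)) ?_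
  filter_upwards [ae_timeVol_mem T] with t ht
  have ht' := Ioo_subset_Ioc_self ht
  exact ((f t).le_opNorm _).trans
    (mul_le_mul (hfK t ht') (hzK t ht') (norm_nonneg _) ((norm_nonneg (f T)).trans (hfK T hTT)))

theorem tendsto_integral_opA :
    Tendsto (fun k => ∫ t, (opA μ (interp (T / N k) (u k) t) - opA μ (w t) : WDual Ω p)
      (interp (T / N k) (u k) t - w t) ∂timeVol T) atTop (𝓝 0) := by
  obtain ⟨M₁, hM₁⟩ := exists_norm_opA_le μ p R
  obtain ⟨M₂, hM₂⟩ := exists_norm_opN_le Ω p R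
  obtain ⟨c, hc, hmono⟩ := exists_opA_mono μ p
  set U : ℕ → ℝ → W0 Ω p := fun k => interp (T / N k) (u k)
  set D : ℕ → ℝ → WDual Ω p := fun k =>
    diffQuot (T / N k) (fun n => alphaConjToDual (fullPow (u k n)))
  set F : ℕ → ℝ → WDual Ω p := fun k t =>
    contToDualL Ω p (stepMean (T / N k) a (⌈t / (T / N k)⌉₊ - 1))
  set G : ℕ → ℝ → WDual Ω p := fun k t => F k t + κ⁻¹ • opN (U k t) - opA μ (w t)
  have hUm : ∀ k, StronglyMeasurable (U k) := fun k => stronglyMeasurable_interp _ _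
  have hDm : ∀ k, StronglyMeasurable (D k) := fun k => stronglyMeasurable_diffQuot _ _
  have hwm := H.stronglyMeasurable
  have hGm : ∀ k, StronglyMeasurable (G k) := fun k => by
    have h1 : StronglyMeasurable (F k) := stronglyMeasurable_comp_ceil (T / N k) fun n =>
      contToDualL Ω p (stepMean (T / N k) a (n - 1))
    have h2 : StronglyMeasurable fun t => opN (U k t) :=
      stronglyMeasurable_comp_ceil (T / N k) fun n => opN (u k n)
    exact (h1.add (h2.const_smul κ⁻¹)).sub ((continuous_opA μ).comp_stronglyMeasurable hwm)
  have hUR : ∀ k, ∀ t ∈ Ioc 0 T, ‖U k t‖ ≤ R := fun k t ht => H.norm_interp_le k ht.2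
  have hURw : ∀ k, ∀ t ∈ Ioc 0 T, ‖U k t - w t‖ ≤ R + R := fun k t ht =>
    (norm_sub_le _ _).trans (add_le_add (hUR k t ht) (H.norm_lim_le t))
  have hDM : ∀ k, ∀ t ∈ Ioc 0 T, ‖D k t‖ ≤ M := fun k t ht => H.norm_diffQuot_le k ht
  set K := ‖contToDualL Ω p‖ * L + |κ⁻¹| * M₂ + M₁
  have hGK : ∀ k, ∀ t ∈ Ioc 0 T, ‖G k t‖ ≤ K := fun k t ht => by
    have h1 := H.norm_source_le k ht
    have h2 := norm_smul κ⁻¹ (opN (U k t))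
    rw [Real.norm_eq_abs] at h2
    have h3 := mul_le_mul_of_nonneg_left (hM₂ _ (hUR k t ht)) (abs_nonneg κ⁻¹)
    have h4 := hM₁ _ (H.norm_lim_le t)
    have h5 := norm_sub_le (F k t + κ⁻¹ • opN (U k t)) (opA μ (w t))
    have h6 := norm_add_le (F k t) (κ⁻¹ • opN (U k t))
    change ‖F k t‖ ≤ _ at h1
    change ‖F k t + κ⁻¹ • opN (U k t) - opA μ (w t)‖ ≤ _
    linarith
  have hiD : ∀ k, Integrable (fun t => D k t (U k t)) (timeVol T) := fun k =>
    H.integrable_apply (hDm k).aestronglyMeasurable (hUm k).aestronglyMeasurable (hDM k) (hUR k)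
  have hiDw : ∀ k, Integrable (fun t => D k t (w t)) (timeVol T) := fun k =>
    H.integrable_apply (hDm k).aestronglyMeasurable hwm.aestronglyMeasurable (hDM k)
      fun t _ => H.norm_lim_le t
  have hiG : ∀ k, Integrable (fun t => G k t (U k t - w t)) (timeVol T) := fun k =>
    H.integrable_apply (hGm k).aestronglyMeasurable ((hUm k).sub hwm).aestronglyMeasurable (hGK k)
      (hURw k)
  have hsplit : ∀ k, ∫ t, (opA μ (U k t) - opA μ (w t) : WDual Ω p) (U k t - w t) ∂timeVol T =
      (∫ t, G k t (U k t - w t) ∂timeVol T) - (∫ t, D k t (U k t) ∂timeVol T) +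
        ∫ t, D k t (w t) ∂timeVol T := fun k => by
    have hi : Integrable (fun t => G k t (U k t - w t) - D k t (U k t)) (timeVol T) :=
      (hiG k).sub (hiD k)
    rw [← integral_sub (hiG k) (hiD k), ← integral_add hi (hiDw k)]
    refine integral_congr_ae ?_
    filter_upwards [ae_timeVol_mem T] with t ht
    have h1 : D k t = F k t - opB μ κ (U k t) := H.diffQuot_eq_source k (Ioo_subset_Ioc_self ht)
    have h2 : opA μ (U k t) = G k t + opA μ (w t) - D k t := by
      rw [h1, opB_eq]
      simp only [G]
      abel
    have h3 : (opA μ (U k t) - opA μ (w t) : WDual Ω p) = G k t - D k t := by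
      rw [h2]
      abel
    rw [h3, sub_apply, map_sub (D k t)]
    ring
  have hG0 : Tendsto (fun k => ∫ t, G k t (U k t - w t) ∂timeVol T) atTop (𝓝 0) := by
    have := tendsto_integral_of_dominated_convergence (μ := timeVol T)
      (F := fun k t => G k t (U k t - w t)) (f := fun _ => (0 : ℝ)) (fun _ => K * (R + R))
      (fun k => (hiG k).1) (integrable_const _) (fun k => ?_) ?_
    · simpa using this
    · filter_upwards [ae_timeVol_mem T] with t ht
      have ht' := Ioo_subset_Ioc_self ht
      exact ((G k t).le_opNorm _).trans (mul_le_mul (hGK k t ht') (hURw k t ht')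
        (norm_nonneg _) ((norm_nonneg (G k t)).trans (hGK k t ht')))
    · filter_upwards [ae_timeVol_mem T] with t ht
      have ht' := Ioo_subset_Ioc_self ht
      set G' : WDual Ω p := contToDualL Ω p (A t) + κ⁻¹ • opN (w t) - opA μ (w t)
      have h1 : Tendsto (fun k => G k t) atTop (𝓝 G') :=
        ((H.tendsto_source ht').add
          ((tendsto_opN (H.tendsto_fn t (Ioo_subset_Icc_self ht))).const_smul κ⁻¹)).sub_const _
      have h2 := tendsto_dual_iff.1 h1
      have h3 : Tendsto (fun k => G' (U k t) - G' (w t)) atTop (𝓝 0) := by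
        have := (H.tendsto_weak t (Ioo_subset_Icc_self ht) G').sub_const (G' (w t))
        rwa [sub_self] at this
      have h4 : Tendsto (fun k => (G k t - G') (U k t - w t)) atTop (𝓝 0) := by
        refine squeeze_zero_norm (a := fun k => ‖G k t - G'‖ * (R + R)) (fun k => ?_) ?_
        · exact ((G k t - G').le_opNorm _).trans
            (mul_le_mul_of_nonneg_left (hURw k t ht') (norm_nonneg (G k t - G')))
        · simpa using h2.mul_const (R + R)
      have h5 := h4.add h3
      rw [add_zero] at h5
      refine h5.congr fun k => ?_
      rw [sub_apply, ← map_sub]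
      ring
  have hhalf : Tendsto (fun k => 1 / p.alphaConj *
      (‖halfPow (U k T)‖ ^ 2 - ‖halfPow u₀‖ ^ 2)) atTop
      (𝓝 (1 / p.alphaConj * (‖halfPow (w T)‖ ^ 2 - ‖halfPow u₀‖ ^ 2))) :=
    (((tendsto_halfPow (H.tendsto_fn T ⟨H.pos.le, le_rfl⟩)).norm.pow 2).sub_const _).const_mul _
  have hDw : ∀ ε > 0, ∀ᶠ k in atTop, ∫ t, D k t (w t) ∂timeVol T ≤
      1 / p.alphaConj * ‖halfPow (w T)‖ ^ 2 - 1 / p.alphaConj * ‖halfPow (w 0)‖ ^ 2 + ε := by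
    intro ε hε
    refine eventually_integral_apply_le H.pos (D := D)
      (W := fun t => alphaConjToDual (fullPow (w t))) (u := w)
      (Φ := fun t => 1 / p.alphaConj * ‖halfPow (w t)‖ ^ 2) (M := M) (R := R)
      (fun k => (hDm k).aestronglyMeasurable) (fun k => ?_) (fun t ht => H.tendsto_primitive ht) hwm
      H.norm_lim_le H.clamp_eq ?_ (fun s _ t _ => ?_) hε
    · filter_upwards [ae_timeVol_mem T] with t ht using hDM k t (Ioo_subset_Ioc_self ht)
    · exact continuousOn_const.mul (H.continuousOn_halfPow.norm.pow 2)
    · have := alphaConjToDual_sub_apply_ge (w s) (w t)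
      change (alphaConjToDual (fullPow (w t)) - alphaConjToDual (fullPow (w s)) : WDual Ω p) (w s) ≤
        1 / p.alphaConj * ‖halfPow (w t)‖ ^ 2 - 1 / p.alphaConj * ‖halfPow (w s)‖ ^ 2
      rw [sub_apply] at this ⊢
      linarith
  refine Metric.tendsto_nhds.2 fun ε hε => ?_
  filter_upwards [hG0.eventually (gt_mem_nhds (by positivity : (0 : ℝ) < ε / 4)),
    hhalf.eventually (lt_mem_nhds (sub_lt_self _ (by positivity : (0 : ℝ) < ε / 4))),
    hDw (ε / 4) (by positivity)] with k h1 h2 h3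
  have h4 := H.le_integral_diffQuot_apply k (hiD k)
  have h5 : 0 ≤ ∫ t, (opA μ (U k t) - opA μ (w t) : WDual Ω p) (U k t - w t) ∂timeVol T :=
    integral_nonneg fun t => (mul_nonneg hc.le (Real.rpow_nonneg (norm_nonneg _) _)).trans
      (hmono _ _)
  rw [Real.dist_0_eq_abs, abs_of_nonneg h5, hsplit]
  rw [H.zero_eq] at h3
  change 1 / p.alphaConj * (‖halfPow (U k T)‖ ^ 2 - ‖halfPow u₀‖ ^ 2) ≤
    ∫ t, D k t (U k t) ∂timeVol T at h4
  linarith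

theorem exists_subseq_ae_tendsto : ∃ φ : ℕ → ℕ, StrictMono φ ∧ ∀ᵐ t ∂timeVol T,
    Tendsto (fun k => interp (T / N (φ k)) (u (φ k)) t) atTop (𝓝 (w t)) := by
  obtain ⟨M₁, hM₁⟩ := exists_norm_opA_le μ p R
  obtain ⟨c, hc, hmono⟩ := exists_opA_mono μ p
  set U : ℕ → ℝ → W0 Ω p := fun k => interp (T / N k) (u k)
  have hp : 0 < p.val := p.pos
  set g : ℕ → ℝ → ℝ := fun k t => (opA μ (U k t) - opA μ (w t) : WDual Ω p) (U k t - w t)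
  have hg0 : ∀ k t, 0 ≤ g k t := fun k t =>
    (mul_nonneg hc.le (Real.rpow_nonneg (norm_nonneg _) _)).trans (hmono _ _)
  have hgi : ∀ k, Integrable (g k) (timeVol T) := fun k => by
    have hUm : StronglyMeasurable (U k) := stronglyMeasurable_interp _ _
    have hwm := H.stronglyMeasurable
    refine H.integrable_apply (K := M₁ + M₁) (K' := R + R)
      (((continuous_opA μ).comp_stronglyMeasurable hUm).sub
        ((continuous_opA μ).comp_stronglyMeasurable hwm)).aestronglyMeasurable
      (hUm.sub hwm).aestronglyMeasurable (fun t ht => ?_) fun t ht => ?_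
    · have h1 := norm_sub_le (opA μ (U k t)) (opA μ (w t))
      have h2 := hM₁ _ (H.norm_interp_le k ht.2)
      have h3 := hM₁ _ (H.norm_lim_le t)
      change ‖opA μ (U k t)‖ ≤ M₁ at h2
      exact h1.trans (add_le_add h2 h3)
    · exact (norm_sub_le _ _).trans (add_le_add (H.norm_interp_le k ht.2) (H.norm_lim_le t))
  have hmeas : TendstoInMeasure (timeVol T) g atTop (fun _ => 0) := by
    refine tendstoInMeasure_of_tendsto_eLpNorm one_ne_zero (fun k => (hgi k).1)
      aestronglyMeasurable_const ?_
    have h1 : ∀ k, eLpNorm (g k - fun _ => 0) 1 (timeVol T) =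
        ENNReal.ofReal (∫ t, g k t ∂timeVol T) := fun k => by
      have : (g k - fun _ => 0) = g k := by
        funext t
        simp
      rw [this, eLpNorm_one_eq_lintegral_enorm, ofReal_integral_eq_lintegral_ofReal (hgi k)
        (Eventually.of_forall (hg0 k))]
      refine lintegral_congr fun t => ?_
      rw [Real.enorm_eq_ofReal (hg0 k t)]
    simp only [h1]
    have := ENNReal.tendsto_ofReal H.tendsto_integral_opA
    rwa [ENNReal.ofReal_zero] at this
  obtain ⟨φ, hφ, hlim⟩ := hmeas.exists_seq_tendsto_ae
  refine ⟨φ, hφ, ?_⟩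
  filter_upwards [hlim] with t ht
  rw [tendsto_iff_norm_sub_tendsto_zero]
  have h1 : Tendsto (fun k => (c⁻¹ * g (φ k) t) ^ (1 / p.val)) atTop (𝓝 0) := by
    have := ((Real.continuousAt_rpow_const 0 (1 / p.val) (Or.inr (by positivity))).tendsto).comp
      (by simpa using ht.const_mul c⁻¹ : Tendsto (fun k => c⁻¹ * g (φ k) t) atTop (𝓝 0))
    rwa [Real.zero_rpow (by positivity)] at this
  refine squeeze_zero (fun _ => norm_nonneg _) (fun k => ?_) h1
  rw [one_div, Real.le_rpow_inv_iff_of_pos (norm_nonneg _)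
    (mul_nonneg (inv_pos.2 hc).le (hg0 _ _)) hp, ← div_eq_inv_mul, le_div_iff₀ hc, mul_comm]
  exact hmono _ _

end ConvergentScheme

/-! ### Weak compactness in `L²(0,T;E)` -/

section WeakL2

variable {E : Type*} [NormedAddCommGroup E] [InnerProductSpace ℝ E] [CompleteSpace E] {T : ℝ}

lemma exists_weak_subseq_of_bounded {V : Type*} [NormedAddCommGroup V] [InnerProductSpace ℝ V]
    [CompleteSpace V] [TopologicalSpace.SeparableSpace V] {d : ℕ → V} {K : ℝ}
    (hK : ∀ k, ‖d k‖ ≤ K) : ∃ (φ : ℕ → ℕ) (g : V), StrictMono φ ∧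
      ∀ f, Tendsto (fun k => inner ℝ f (d (φ k))) atTop (𝓝 (inner ℝ f g)) := by
  obtain ⟨G, -, φ, hφ, hlim⟩ := WeakDual.isSeqCompact_closedBall ℝ V 0 K
    (x := fun k => StrongDual.toWeakDual (InnerProductSpace.toDual ℝ V (d k))) fun k => by
      change InnerProductSpace.toDual ℝ V (d k) ∈ Metric.closedBall 0 K
      rw [mem_closedBall_zero_iff, LinearIsometryEquiv.norm_map]
      exact hK k
  refine ⟨φ, (InnerProductSpace.toDual ℝ V).symm (WeakDual.toStrongDual G), hφ, fun f => ?_⟩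
  have h1 := ((WeakDual.eval_continuous f).tendsto G).comp hlim
  rw [real_inner_comm, InnerProductSpace.toDual_symm_apply]
  refine Tendsto.congr (fun k => ?_) h1
  rw [real_inner_comm]
  rfl

lemma exists_weakTendsto_of_bounded [SecondCountableTopology E] {d : ℕ → ℝ → E}
    (hd : ∀ k, MemLp (d k) 2 (timeVol T)) {K : ℝ} (hK : ∀ k, ∫ t, ‖d k t‖ ^ 2 ∂timeVol T ≤ K) :
    ∃ (φ : ℕ → ℕ) (g : ℝ → E), StrictMono φ ∧
      WeakTendsto 2 2 T (fun f v : E => inner ℝ f v) (fun k => d (φ k)) g := by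
  have : Fact ((2 : ℝ≥0∞) ≠ ⊤) := ⟨by norm_num⟩
  have : IsSeparable (timeVol T) := by
    unfold timeVol
    infer_instance
  have hnorm : ∀ k, ‖(hd k).toLp (d k)‖ ≤ Real.sqrt K := fun k => by
    refine Real.le_sqrt_of_sq_le (le_trans (le_of_eq ?_) (hK k))
    rw [← real_inner_self_eq_norm_sq, L2.inner_def]
    refine integral_congr_ae ?_
    filter_upwards [(hd k).coeFn_toLp] with t ht
    rw [ht, real_inner_self_eq_norm_sq]
  obtain ⟨φ, g, hφ, hlim⟩ := exists_weak_subseq_of_bounded hnorm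
  refine ⟨φ, g, hφ, fun k => hd _, Lp.memLp g, fun f hf => ?_⟩
  have h := hlim (hf.toLp f)
  simp only [L2.inner_def] at h
  have e1 : ∀ k, ∫ t, inner ℝ (hf.toLp f t) ((hd (φ k)).toLp (d (φ k)) t) ∂timeVol T =
      ∫ t, inner ℝ (f t) (d (φ k) t) ∂timeVol T := fun k => by
    refine integral_congr_ae ?_
    filter_upwards [hf.coeFn_toLp, (hd (φ k)).coeFn_toLp] with t h1 h2
    rw [h1, h2]
  have e2 : ∫ t, inner ℝ (hf.toLp f t) (g t) ∂timeVol T = ∫ t, inner ℝ (f t) (g t) ∂timeVol T := by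
    refine integral_congr_ae ?_
    filter_upwards [hf.coeFn_toLp] with t h1
    rw [h1]
  simp only [e1] at h
  rwa [e2] at h

/-- Primitives of weakly convergent sequences. -/
lemma WeakTendsto.primitive_eq {d : ℕ → ℝ → E} {g : ℝ → E}
    (h : WeakTendsto 2 2 T (fun f v : E => inner ℝ f v) d g) {t : ℝ} (ht : t ∈ Ioo 0 T) {y : E}
    (hy : Tendsto (fun k => ∫ s in (0:ℝ)..t, d k s) atTop (𝓝 y)) :
    y = ∫ s in (0:ℝ)..t, g s := by
  obtain ⟨hd, hg, hw⟩ := h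
  refine ext_inner_left ℝ fun z => ?_
  have key : ∀ b : ℝ → E, MemLp b 2 (timeVol T) →
      ∫ s, inner ℝ ((Iic t).indicator (fun _ => z) s) (b s) ∂timeVol T =
        inner ℝ z (∫ s in (0:ℝ)..t, b s) := fun b hb => by
    have hb1 : IntervalIntegrable b volume 0 t :=
      intervalIntegrable_of_timeVol (hb.integrable (by norm_num))
        ⟨le_rfl, (ht.1.trans ht.2).le⟩ (Ioo_subset_Icc_self ht)
    have h1 := (innerSL ℝ z).intervalIntegral_comp_comm hb1
    simp only [innerSL_apply_apply] at h1
    rw [← h1, ← integral_timeVol_indicator _ ht]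
    refine integral_congr_ae (Eventually.of_forall fun s => ?_)
    by_cases hs : s ∈ Iic t
    · simp only [indicator_of_mem hs]
    · simp only [indicator_of_notMem hs, inner_zero_left]
  have hf : MemLp ((Iic t).indicator fun _ => z) 2 (timeVol T) :=
    (memLp_const z).indicator measurableSet_Iic
  have h1 := hw _ hf
  rw [key g hg] at h1
  simp only [key _ (hd _)] at h1
  exact tendsto_nhds_unique (tendsto_const_nhds.inner hy) h1

end WeakL2

namespace ConvergentScheme

variable {T κ : ℝ} {μ : Coefficient Ω} {a : ℝ → Ω.CClosure} {u₀ : W0 Ω p} {N : ℕ → ℕ}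
  {u : ℕ → ℕ → W0 Ω p} {w : ℝ → W0 Ω p} {A : ℝ → Ω.CClosure} {R C M L : ℝ}
  (H : ConvergentScheme T κ μ a u₀ N u w A R C M L)
include H

lemma norm_halfPow_step_le (k : ℕ) {n : ℕ} (hn : n < N k) :
    ‖halfPow (u k (n + 1)) - halfPow (u k n)‖ ^ 2 ≤ C * (T / N k) :=
  (Finset.single_le_sum (f := fun n => ‖halfPow (u k (n + 1)) - halfPow (u k n)‖ ^ 2)
    (fun _ _ => sq_nonneg _) (Finset.mem_range.2 hn)).trans (H.sum_le k)

lemma memLp_diffQuot_halfPow (k : ℕ) :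
    MemLp (diffQuot (T / N k) (fun n => halfPow (u k n))) 2 (timeVol T) := by
  have hl := step_pos H.pos (H.one_le k)
  refine MemLp.of_bound (stronglyMeasurable_diffQuot _ _).aestronglyMeasurable
    ((T / N k)⁻¹ * Real.sqrt (C * (T / N k))) ?_
  filter_upwards [ae_timeVol_mem T] with t ht
  obtain ⟨n, hn, e, -, -⟩ := H.exists_index k (Ioo_subset_Ioc_self ht)
  rw [diffQuot, e, Nat.add_sub_cancel, norm_smul, norm_inv, Real.norm_of_nonneg hl.le]
  exact mul_le_mul_of_nonneg_left (Real.le_sqrt_of_sq_le (H.norm_halfPow_step_le k hn))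
    (inv_pos.2 hl).le

lemma integral_norm_diffQuot_halfPow_le (k : ℕ) :
    ∫ t, ‖diffQuot (T / N k) (fun n => halfPow (u k n)) t‖ ^ 2 ∂timeVol T ≤ C := by
  have hl := step_pos H.pos (H.one_le k)
  set S : ℕ → ℝ := fun n =>
    ∑ j ∈ Finset.range n, ‖halfPow (u k (j + 1)) - halfPow (u k j)‖ ^ 2
  have hg := diffQuot_integral_grid hl S (N k)
  rw [H.mul_T] at hg
  have e : ∫ t, ‖diffQuot (T / N k) (fun n => halfPow (u k n)) t‖ ^ 2 ∂timeVol T =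
      (T / N k)⁻¹ * ∫ t, diffQuot (T / N k) S t ∂timeVol T := by
    rw [← integral_const_mul]
    refine integral_congr_ae ?_
    filter_upwards [ae_timeVol_mem T] with t ht
    obtain ⟨n, hn, e, -, -⟩ := H.exists_index k (Ioo_subset_Ioc_self ht)
    simp only [diffQuot]
    rw [e, Nat.add_sub_cancel, norm_smul, norm_inv, Real.norm_of_nonneg hl.le, mul_pow,
      smul_eq_mul]
    simp only [S]
    rw [Finset.sum_range_succ, add_sub_cancel_left]
    ring
  rw [e, ← intervalIntegral_eq_timeVol _ H.pos.le, hg.2, inv_mul_le_iff₀ hl]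
  simpa [S, mul_comm] using H.sum_le k

lemma tendsto_primitive_halfPow {t : ℝ} (ht : t ∈ Icc 0 T) :
    Tendsto (fun k => ∫ s in (0:ℝ)..t, diffQuot (T / N k) (fun n => halfPow (u k n)) s) atTop
      (𝓝 (halfPow (w t) - halfPow (w 0))) := by
  set v : ℕ → ℕ → Lp ℝ 2 Ω.vol := fun k n => halfPow (u k n)
  have h1 : Tendsto (fun k => v k ⌈t / (T / N k)⌉₊) atTop (𝓝 (halfPow (w t))) :=
    tendsto_halfPow (H.tendsto_fn t ht)
  have h0 : ∀ k, v k 0 = halfPow (w 0) := fun k => by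
    rw [H.zero_eq, ← (H.sol k).1]
  have h2 : Tendsto (fun k => v k 0 + (∫ s in (0:ℝ)..t, diffQuot (T / N k) (v k) s)
      - v k ⌈t / (T / N k)⌉₊) atTop (𝓝 0) := by
    refine squeeze_zero_norm (a := fun k => Real.sqrt (C * (T / N k))) (fun k => ?_) ?_
    · have hl := step_pos H.pos (H.one_le k)
      refine (norm_primitive_diffQuot_sub_le hl (v k) ht.1).trans ?_
      rcases ht.1.eq_or_lt with rfl | h
      · simp
      · obtain ⟨n, hn, e, -, -⟩ := H.exists_index k ⟨h, ht.2⟩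
        rw [e, Nat.add_sub_cancel]
        exact Real.le_sqrt_of_sq_le (H.norm_halfPow_step_le k hn)
    · have := (H.tendsto_step.const_mul C).sqrt
      rwa [mul_zero, Real.sqrt_zero] at this
  have h3 := (h2.add h1).sub_const (halfPow (w 0))
  rw [zero_add] at h3
  refine h3.congr fun k => ?_
  rw [sub_add_cancel, h0, add_sub_cancel_left]

end ConvergentScheme

/-! ### Passage to the limit -/

lemma norm_inclAlpha_fn_rpow_le {R r : ℝ} (hr : 0 ≤ r) {u : W0 Ω p} (hu : ‖u‖ ≤ R) :
    2 * ‖inclAlpha Ω p (u.fn - (0 : W0 Ω p).fn)‖ ^ r ≤ 2 * (‖inclAlpha Ω p‖ * R) ^ r := by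
  have h0 : (0 : W0 Ω p).fn = 0 := rfl
  rw [h0, sub_zero]
  refine mul_le_mul_of_nonneg_left (Real.rpow_le_rpow (norm_nonneg _) ?_ hr) zero_le_two
  exact ((inclAlpha Ω p).le_opNorm _).trans
    (mul_le_mul_of_nonneg_left ((W0.norm_fn_le u).trans hu) (norm_nonneg _))

lemma exists_norm_halfPow_le (Ω : BddOpen) (p : GlenExp) (R : ℝ) :
    ∃ K : ℝ, ∀ u : W0 Ω p, ‖u‖ ≤ R → ‖halfPow u‖ ≤ K := by
  refine ⟨‖halfPow (0 : W0 Ω p)‖ + 2 * (‖inclAlpha Ω p‖ * R) ^ (p.alpha / 2), fun u hu => ?_⟩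
  have h1 := norm_halfPow_sub_le u 0
  have h2 := norm_inclAlpha_fn_rpow_le (r := p.alpha / 2) (by linarith [p.one_lt_alpha]) hu
  have h3 := norm_le_norm_add_norm_sub' (halfPow u) (halfPow (0 : W0 Ω p))
  linarith

lemma exists_norm_fullPow_le (Ω : BddOpen) (p : GlenExp) (R : ℝ) :
    ∃ K : ℝ, ∀ u : W0 Ω p, ‖u‖ ≤ R → ‖fullPow u‖ ≤ K := by
  refine ⟨‖fullPow (0 : W0 Ω p)‖ + 2 * (‖inclAlpha Ω p‖ * R) ^ (p.alpha - 1), fun u hu => ?_⟩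
  have h1 := norm_fullPow_sub_le u 0
  have h2 := norm_inclAlpha_fn_rpow_le (r := p.alpha - 1) (by linarith [p.one_lt_alpha]) hu
  have h3 := norm_le_norm_add_norm_sub' (fullPow u) (fullPow (0 : W0 Ω p))
  linarith

/-- The duality between `L^α(Ω)` and `L^{α'}(Ω)`. -/
def alphaPairing (Ω : BddOpen) (p : GlenExp) :
    Lp ℝ p.alphaE Ω.vol →L[ℝ] Lp ℝ p.alphaConjE Ω.vol →L[ℝ] ℝ :=
  (ContinuousLinearMap.mul ℝ ℝ).lpPairing Ω.vol p.alphaE p.alphaConjE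

lemma alphaPairing_apply (f : Lp ℝ p.alphaE Ω.vol) (v : Lp ℝ p.alphaConjE Ω.vol) :
    alphaPairing Ω p f v = ∫ x in Ω.carrier, f x * v x :=
  ContinuousLinearMap.lpPairing_eq_integral _ _ _

lemma continuous_alphaPairing :
    Continuous fun q : Lp ℝ p.alphaE Ω.vol × Lp ℝ p.alphaConjE Ω.vol =>
      ∫ x in Ω.carrier, q.1 x * q.2 x := by
  have : Continuous fun q : Lp ℝ p.alphaE Ω.vol × Lp ℝ p.alphaConjE Ω.vol =>
      alphaPairing Ω p q.1 q.2 :=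
    (alphaPairing Ω p).isBoundedBilinearMap.continuous
  simpa only [alphaPairing_apply] using this

lemma abs_alphaPairing_le (f : Lp ℝ p.alphaE Ω.vol) (v : Lp ℝ p.alphaConjE Ω.vol) :
    |∫ x in Ω.carrier, f x * v x| ≤ ‖alphaPairing Ω p‖ * ‖f‖ * ‖v‖ := by
  rw [← alphaPairing_apply]
  exact (alphaPairing Ω p).le_opNorm₂ f v

instance : SecondCountableTopology (Lp ℝ 2 Ω.vol) :=
  have : Fact ((2 : ℝ≥0∞) ≠ ⊤) := ⟨by norm_num⟩
  inferInstance

lemma continuous_dual_eval : Continuous fun q : WDual Ω p × W0 Ω p => q.1 q.2 :=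
  continuous_dual_apply (X := W0 Ω p)

lemma continuous_eval_dual : Continuous fun q : W0 Ω p × WDual Ω p => q.2 q.1 :=
  continuous_dual_eval.comp continuous_swap

namespace ConvergentScheme

variable {T κ : ℝ} {μ : Coefficient Ω} {a : ℝ → Ω.CClosure} {u₀ : W0 Ω p} {N : ℕ → ℕ}
  {u : ℕ → ℕ → W0 Ω p} {w : ℝ → W0 Ω p} {A : ℝ → Ω.CClosure} {R C M L : ℝ}
  (H : ConvergentScheme T κ μ a u₀ N u w A R C M L)
include H

lemma weakTendsto_interp : WeakTendsto ⊤ 1 T (fun (f : WDual Ω p) (v : W0 Ω p) => f v)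
    (fun k => interp (T / N k) (u k)) w := by
  refine weakTendsto_of_ae_tendsto (C := 1) (R := R) continuous_dual_eval (fun f v => ?_)
    zero_le_one (fun k => (stronglyMeasurable_interp _ _).aestronglyMeasurable)
    H.stronglyMeasurable.aestronglyMeasurable (fun k => ?_) (Eventually.of_forall H.norm_lim_le) ?_
  · rw [one_mul]
    exact f.le_opNorm v
  · filter_upwards [ae_timeVol_mem T] with t ht using H.norm_interp_le k ht.2.le
  · filter_upwards [ae_timeVol_mem T] with t ht using H.tendsto_weak t (Ioo_subset_Icc_self ht)

lemma weakTendsto_opB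
    (hs : ∀ᵐ t ∂timeVol T, Tendsto (fun k => interp (T / N k) (u k) t) atTop (𝓝 (w t))) :
    WeakTendsto ⊤ 1 T (fun (f : W0 Ω p) (v : WDual Ω p) => v f)
      (fun k t => opB μ κ (interp (T / N k) (u k) t)) (fun t => opB μ κ (w t)) := by
  obtain ⟨K, hK⟩ := exists_norm_opB_le μ p κ R
  refine weakTendsto_of_ae_tendsto (C := 1) (R := K) continuous_eval_dual
    (fun v f => ?_) zero_le_one
    (fun k => ((continuous_opB μ κ).comp_stronglyMeasurable
      (stronglyMeasurable_interp _ _)).aestronglyMeasurable)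
    ((continuous_opB μ κ).comp_stronglyMeasurable H.stronglyMeasurable).aestronglyMeasurable
    (fun k => ?_) (Eventually.of_forall fun t => hK _ (H.norm_lim_le t)) ?_
  · rw [one_mul, mul_comm]
    exact f.le_opNorm v
  · filter_upwards [ae_timeVol_mem T] with t ht using hK _ (H.norm_interp_le k ht.2.le)
  · filter_upwards [hs] with t ht y
    exact (continuous_eval_dual.comp (Continuous.prodMk_right y)).tendsto _ |>.comp
      (((continuous_opB μ κ).tendsto _).comp ht)

lemma weakTendsto_halfPow : WeakTendsto ⊤ 1 T (fun f v : Lp ℝ 2 Ω.vol => inner ℝ f v)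
    (fun k t => halfPow (interp (T / N k) (u k) t)) (fun t => halfPow (w t)) := by
  obtain ⟨K, hK⟩ := exists_norm_halfPow_le Ω p R
  refine weakTendsto_of_ae_tendsto (C := 1) (R := K) continuous_inner
    (fun f v => ?_) zero_le_one
    (fun k => (continuous_halfPow.comp_stronglyMeasurable
      (stronglyMeasurable_interp _ _)).aestronglyMeasurable)
    (continuous_halfPow.comp_stronglyMeasurable H.stronglyMeasurable).aestronglyMeasurable
    (fun k => ?_) (Eventually.of_forall fun t => hK _ (H.norm_lim_le t)) ?_
  · rw [one_mul]
    exact abs_real_inner_le_norm f v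
  · filter_upwards [ae_timeVol_mem T] with t ht using hK _ (H.norm_interp_le k ht.2.le)
  · filter_upwards [ae_timeVol_mem T] with t ht y
    exact tendsto_const_nhds.inner (tendsto_halfPow (H.tendsto_fn t (Ioo_subset_Icc_self ht)))

lemma weakTendsto_fullPow :
    WeakTendsto ⊤ 1 T (fun (f : Lp ℝ p.alphaE Ω.vol) (v : Lp ℝ p.alphaConjE Ω.vol) =>
        ∫ x in Ω.carrier, f x * v x)
      (fun k t => fullPow (interp (T / N k) (u k) t)) (fun t => fullPow (w t)) := by
  obtain ⟨K, hK⟩ := exists_norm_fullPow_le Ω p R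
  refine weakTendsto_of_ae_tendsto (C := ‖alphaPairing Ω p‖) (R := K) continuous_alphaPairing
    abs_alphaPairing_le (norm_nonneg (alphaPairing Ω p))
    (fun k => (continuous_fullPow.comp_stronglyMeasurable
      (stronglyMeasurable_interp _ _)).aestronglyMeasurable)
    (continuous_fullPow.comp_stronglyMeasurable H.stronglyMeasurable).aestronglyMeasurable
    (fun k => ?_) (Eventually.of_forall fun t => hK _ (H.norm_lim_le t)) ?_
  · filter_upwards [ae_timeVol_mem T] with t ht using hK _ (H.norm_interp_le k ht.2.le)
  · filter_upwards [ae_timeVol_mem T] with t ht y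
    exact (continuous_alphaPairing.tendsto (y, fullPow (w t))).comp
      (tendsto_const_nhds.prodMk_nhds (tendsto_fullPow (H.tendsto_fn t (Ioo_subset_Icc_self ht))))

lemma tendsto_final (f : Lp ℝ p.alphaE Ω.vol) :
    Tendsto (fun k => ∫ x in Ω.carrier, f x * fullPow (u k (N k)) x) atTop
      (𝓝 (∫ x in Ω.carrier, f x * fullPow (w T) x)) := by
  have h := tendsto_fullPow (H.tendsto_fn T ⟨H.pos.le, le_rfl⟩)
  simp only [H.interp_T] at h
  exact (continuous_alphaPairing.tendsto (f, fullPow (w T))).comp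
    (tendsto_const_nhds.prodMk_nhds h)

/-- The time derivative of `|w|^{α-2} w`, expressed through the equation. -/
lemma ae_tendsto_diffQuot
    (hs : ∀ᵐ t ∂timeVol T, Tendsto (fun k => interp (T / N k) (u k) t) atTop (𝓝 (w t))) :
    ∀ᵐ t ∂timeVol T, Tendsto (fun k =>
      diffQuot (T / N k) (fun n => alphaConjToDual (fullPow (u k n))) t) atTop
        (𝓝 (contToDualL Ω p (A t) - opB μ κ (w t))) := by
  filter_upwards [hs, ae_timeVol_mem T] with t ht htT
  have ht' := Ioo_subset_Ioc_self htT
  refine ((H.tendsto_source ht').sub (((continuous_opB μ κ).tendsto _).comp ht)).congr fun k => ?_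
  exact (H.diffQuot_eq_source k ht').symm

lemma aestronglyMeasurable_deriv
    (hs : ∀ᵐ t ∂timeVol T, Tendsto (fun k => interp (T / N k) (u k) t) atTop (𝓝 (w t))) :
    AEStronglyMeasurable (fun t => contToDualL Ω p (A t) - opB μ κ (w t)) (timeVol T) :=
  aestronglyMeasurable_of_tendsto_ae atTop
    (fun k => (stronglyMeasurable_diffQuot (T / N k)
      (fun n => alphaConjToDual (fullPow (u k n)))).aestronglyMeasurable) (H.ae_tendsto_diffQuot hs)

lemma ae_norm_deriv_le
    (hs : ∀ᵐ t ∂timeVol T, Tendsto (fun k => interp (T / N k) (u k) t) atTop (𝓝 (w t))) :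
    ∀ᵐ t ∂timeVol T, ‖contToDualL Ω p (A t) - opB μ κ (w t)‖ ≤ M := by
  filter_upwards [H.ae_tendsto_diffQuot hs, ae_timeVol_mem T] with t ht htT
  exact le_of_tendsto ht.norm (Eventually.of_forall fun k =>
    H.norm_diffQuot_le k (Ioo_subset_Ioc_self htT))

lemma weakTendsto_diffQuot
    (hs : ∀ᵐ t ∂timeVol T, Tendsto (fun k => interp (T / N k) (u k) t) atTop (𝓝 (w t))) :
    WeakTendsto ⊤ 1 T (fun (f : W0 Ω p) (v : WDual Ω p) => v f)
      (fun k => diffQuot (T / N k) (fun n => alphaConjToDual (fullPow (u k n))))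
      (fun t => contToDualL Ω p (A t) - opB μ κ (w t)) := by
  refine weakTendsto_of_ae_tendsto (C := 1) (R := M) continuous_eval_dual
    (fun v f => ?_) zero_le_one
    (fun k => (stronglyMeasurable_diffQuot _ _).aestronglyMeasurable)
    (H.aestronglyMeasurable_deriv hs) (fun k => ?_) (H.ae_norm_deriv_le hs) ?_
  · rw [one_mul, mul_comm]
    exact f.le_opNorm v
  · filter_upwards [ae_timeVol_mem T] with t ht
    exact H.norm_diffQuot_le k (Ioo_subset_Ioc_self ht)
  · filter_upwards [H.ae_tendsto_diffQuot hs] with t ht y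
    exact (continuous_eval_dual.comp (Continuous.prodMk_right y)).tendsto _ |>.comp ht

lemma hasWeakTimeDeriv_fullPow
    (hs : ∀ᵐ t ∂timeVol T, Tendsto (fun k => interp (T / N k) (u k) t) atTop (𝓝 (w t))) :
    HasWeakTimeDeriv T (fun t => alphaConjToDual (fullPow (w t)))
      (fun t => contToDualL Ω p (A t) - opB μ κ (w t)) := by
  have hi : Integrable (fun t => contToDualL Ω p (A t) - opB μ κ (w t)) (timeVol T) :=
    (integrable_const M).mono' (H.aestronglyMeasurable_deriv hs) (H.ae_norm_deriv_le hs)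
  refine hasWeakTimeDeriv_of_eq_primitive H.pos.le hi (alphaConjToDual (fullPow (w 0))) ?_
  filter_upwards [ae_timeVol_mem T] with t ht
  have h1 := H.tendsto_primitive (Ioo_subset_Icc_self ht)
  have hsub : Ioc 0 t ⊆ Ioo 0 T := fun s hs => ⟨hs.1, hs.2.trans_lt ht.2⟩
  have h2 : Tendsto (fun k => ∫ s in (0:ℝ)..t,
      diffQuot (T / N k) (fun n => alphaConjToDual (fullPow (u k n))) s) atTop
      (𝓝 (∫ s in (0:ℝ)..t, (contToDualL Ω p (A s) - opB μ κ (w s)))) := by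
    simp only [intervalIntegral.integral_of_le ht.1.le]
    refine tendsto_integral_of_dominated_convergence (fun _ => M)
      (fun k => (stronglyMeasurable_diffQuot _ _).aestronglyMeasurable) (integrable_const _)
      (fun k => ?_) ?_
    · refine ae_restrict_of_ae_restrict_of_subset hsub ?_
      filter_upwards [ae_timeVol_mem T] with s hs
      exact H.norm_diffQuot_le k (Ioo_subset_Ioc_self hs)
    · exact ae_restrict_of_ae_restrict_of_subset hsub (H.ae_tendsto_diffQuot hs)
  exact (sub_eq_iff_eq_add'.1 (tendsto_nhds_unique h1 h2))

lemma hasWeakTimeDeriv_halfPow {g : ℝ → Lp ℝ 2 Ω.vol}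
    (hg : WeakTendsto 2 2 T (fun f v : Lp ℝ 2 Ω.vol => inner ℝ f v)
      (fun k => diffQuot (T / N k) (fun n => halfPow (u k n))) g) :
    HasWeakTimeDeriv T (fun t => halfPow (w t)) g := by
  refine hasWeakTimeDeriv_of_eq_primitive H.pos.le (hg.2.1.integrable (by norm_num))
    (halfPow (w 0)) ?_
  filter_upwards [ae_timeVol_mem T] with t ht
  exact sub_eq_iff_eq_add'.1 (hg.primitive_eq ht (H.tendsto_primitive_halfPow
    (Ioo_subset_Icc_self ht)))

lemma continuousOn_fn : ContinuousOn (fun t => (w t).fn) (Icc 0 T) := by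
  intro t ht
  refine tendsto_of_seq_tendsto fun x hx => ?_
  have h1 : Tendsto (fun k => halfPow (w (x k))) atTop (𝓝 (halfPow (w t))) :=
    (H.continuousOn_halfPow t ht).tendsto.comp hx
  obtain ⟨z, -, h2, h3, -⟩ := W0.exists_limit_of_halfPow (fun k => w (x k)) R
    (fun k => H.norm_lim_le _) _ h1
  rw [halfPow_injective h2] at h3
  exact h3

lemma hasInitialValue : HasInitialValue T w u₀ := by
  have hae : ∀ t, inclAlpha Ω p (w t).fn =ᵐ[Ω.vol] (w t).fn := fun t =>
    inclL_ae p.alphaE_le_pE ENNReal.ofReal_ne_top (w t).fn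
  refine ⟨fun t => inclAlpha Ω p (w t).fn, Eventually.of_forall hae,
    (inclAlpha Ω p).continuous.comp_continuousOn H.continuousOn_fn, ?_, ?_⟩
  · refine H.continuousOn_halfPow.congr fun t _ => ?_
    refine MemLp.toLp_congr _ _ ?_
    filter_upwards [hae t] with x hx
    rw [hx]
  · have := hae 0
    rw [H.zero_eq] at this
    change inclAlpha Ω p (w 0).fn =ᵐ[Ω.vol] u₀.fn
    rwa [H.zero_eq]

lemma isPenalizedSolution
    (hs : ∀ᵐ t ∂timeVol T, Tendsto (fun k => interp (T / N k) (u k) t) atTop (𝓝 (w t)))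
    {g : ℝ → Lp ℝ 2 Ω.vol}
    (hg : WeakTendsto 2 2 T (fun f v : Lp ℝ 2 Ω.vol => inner ℝ f v)
      (fun k => diffQuot (T / N k) (fun n => halfPow (u k n))) g) :
    IsPenalizedSolution T κ μ a u₀ w := by
  refine ⟨H.weakTendsto_interp.2.1, ⟨g, hg.2.1, H.hasWeakTimeDeriv_halfPow hg⟩,
    ⟨_, (H.weakTendsto_diffQuot hs).2.1, H.hasWeakTimeDeriv_fullPow hs, fun v ψ _ _ _ => ?_⟩,
    H.hasInitialValue⟩
  refine integral_congr_ae ?_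
  filter_upwards [H.ae_eq] with t ht
  rw [sub_apply, sub_add_cancel, ht]
  rfl

end ConvergentScheme

/-- Solutions of the semi-discrete scheme have a subsequence which converges at every time. -/
theorem exists_convergentScheme {T κ : ℝ} (hT : 0 < T) (hκ : 0 < κ) (μ : Coefficient Ω)
    {a : ℝ → Ω.CClosure} (ha : MemW1 p.pE T a) (u₀ : W0 Ω p) (u : ℕ → ℕ → W0 Ω p)
    (hu : ∀ N : ℕ, 1 ≤ N → IsDiscreteSolution T κ μ a u₀ N (u N)) :
    ∃ (N : ℕ → ℕ) (w : ℝ → W0 Ω p) (A : ℝ → Ω.CClosure) (R C M L : ℝ),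
      ConvergentScheme T κ μ a u₀ N (fun k => u (N k)) w A R C M L := by
  obtain ⟨A, L, hA, hAc, hL⟩ := ha.exists_continuous hT
  obtain ⟨R, C, M, hC, hb⟩ := exists_a_priori_bounds hT hκ μ ha u₀
  obtain ⟨N, w, h1, h2, h3, h4, h5, h6, h7, h8⟩ := exists_convergent_subsequence hT hC (u := u)
    (u₀ := u₀) (R := R) (fun N hN => (hu N hN).1) (fun N hN => (hb N _ hN (hu N hN)).1)
    (fun N hN => (hb N _ hN (hu N hN)).2.1)
  exact ⟨N, w, A, R, C, M, L, {
    pos := hT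
    strictMono := h1
    one_le := h2
    sol := fun k => hu _ (h2 k)
    norm_le := fun k => (hb _ _ (h2 k) (hu _ (h2 k))).1
    sum_le := fun k => (hb _ _ (h2 k) (hu _ (h2 k))).2.1
    quot_le := fun k => (hb _ _ (h2 k) (hu _ (h2 k))).2.2
    mean_le := fun k => (hL _ (h2 k)).1
    ae_eq := hA
    continuousOn := hAc
    norm_lim_le := h3
    clamp_eq := h4
    stronglyMeasurable := h5
    zero_eq := h6
    holder := h7
    tendsto_fn := fun t ht => (h8 t ht).1
    tendsto_weak := fun t ht => (h8 t ht).2 }⟩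

end IceSheet

end

open IceSheet in
theorem mainTheorem2 (Ω : BddOpen) (p : GlenExp) (T : ℝ) (hT : 0 < T) (κ : ℝ) (hκ : 0 < κ)
    (μ : Coefficient Ω) (a : ℝ → Ω.CClosure) (ha : MemW1 p.pE T a)
    (u₀ : W0 Ω p) (hu₀ : u₀ ∈ obstacleSet Ω p)
    (u : ℕ → ℕ → W0 Ω p) (hu : ∀ N : ℕ, 1 ≤ N → IsDiscreteSolution T κ μ a u₀ N (u N)) :
    ∃ (N : ℕ → ℕ) (uκ : ℝ → W0 Ω p) (gκ : ℝ → WDual Ω p) (vκ dvκ : ℝ → Lp ℝ 2 Ω.vol)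
      (wκ : ℝ → Lp ℝ p.alphaConjE Ω.vol) (dwκ : ℝ → WDual Ω p) (χκ : Lp ℝ p.alphaConjE Ω.vol),
      StrictMono N ∧ (∀ k, 1 ≤ N k) ∧
      WeakTendsto ∞ 1 T (fun (f : WDual Ω p) (v : W0 Ω p) => f v)
        (fun k => interp (T / N k) (u (N k))) uκ ∧
      WeakTendsto ∞ 1 T (fun (f : W0 Ω p) (v : WDual Ω p) => v f)
        (fun k t => opB μ κ (interp (T / N k) (u (N k)) t)) gκ ∧
      WeakTendsto ∞ 1 T (fun f v : Lp ℝ 2 Ω.vol => inner ℝ f v)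
        (fun k t => halfPow (interp (T / N k) (u (N k)) t)) vκ ∧
      (HasWeakTimeDeriv T vκ dvκ ∧
        WeakTendsto 2 2 T (fun f v : Lp ℝ 2 Ω.vol => inner ℝ f v)
          (fun k => diffQuot (T / N k) (fun n => halfPow (u (N k) n))) dvκ) ∧
      WeakTendsto ∞ 1 T (fun (f : Lp ℝ p.alphaE Ω.vol) (v : Lp ℝ p.alphaConjE Ω.vol) =>
          ∫ x in Ω.carrier, f x * v x)
        (fun k t => fullPow (interp (T / N k) (u (N k)) t)) wκ ∧
      (HasWeakTimeDeriv T (fun t => alphaConjToDual (wκ t)) dwκ ∧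
        WeakTendsto ∞ 1 T (fun (f : W0 Ω p) (v : WDual Ω p) => v f)
          (fun k => diffQuot (T / N k) (fun n => alphaConjToDual (fullPow (u (N k) n)))) dwκ) ∧
      (∀ f : Lp ℝ p.alphaE Ω.vol,
        Tendsto (fun k => ∫ x in Ω.carrier, f x * fullPow (u (N k) (N k)) x) atTop
          (𝓝 (∫ x in Ω.carrier, f x * χκ x))) ∧
      IsPenalizedSolution T κ μ a u₀ uκ ∧
      (∀ᵐ t ∂timeVol T, vκ t = halfPow (uκ t)) ∧
      (∀ᵐ t ∂timeVol T, wκ t = fullPow (uκ t)) := by 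
  obtain ⟨N, w, A, R, C, M, L, H⟩ := exists_convergentScheme hT hκ μ ha u₀ u hu
  obtain ⟨φ, hφ, hs⟩ := H.exists_subseq_ae_tendsto
  have H₁ := H.comp hφ
  obtain ⟨ρ, g, hρ, hg⟩ := exists_weakTendsto_of_bounded H₁.memLp_diffQuot_halfPow
    H₁.integral_norm_diffQuot_halfPow_le
  have H₂ := H₁.comp hρ
  have hs₂ : ∀ᵐ t ∂timeVol T, Tendsto (fun k => interp (T / N (φ (ρ k))) (u (N (φ (ρ k)))) t)
      atTop (𝓝 (w t)) := by
    filter_upwards [hs] with t ht using ht.comp hρ.tendsto_atTop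
  exact ⟨fun k => N (φ (ρ k)), w, fun t => opB μ κ (w t), fun t => halfPow (w t), g,
    fun t => fullPow (w t), fun t => contToDualL Ω p (A t) - opB μ κ (w t), fullPow (w T),
    H₂.strictMono, H₂.one_le, H₂.weakTendsto_interp, H₂.weakTendsto_opB hs₂,
    H₂.weakTendsto_halfPow, ⟨H₂.hasWeakTimeDeriv_halfPow hg, hg⟩, H₂.weakTendsto_fullPow,
    ⟨H₂.hasWeakTimeDeriv_fullPow hs₂, H₂.weakTendsto_diffQuot hs₂⟩, H₂.tendsto_final,
    H₂.isPenalizedSolution hs₂ hg, Eventually.of_forall fun _ => rfl,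
    Eventually.of_forall fun _ => rfl⟩
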